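/- Everything is real-analytic and local: a second order ODE $y''=J(x,y,p)$, $p=y'$, is a germ at a point $q_0=(x_0,y_0,p_0)$ of first order jet space. A fibre-preserving map is an analytic map $X=\varphi(x)$, $Y=\psi(x,y)$ near $(x_0,y_0)$ with $\varphi'(x_0)\ne0$, $\psi_y(x_0,y_0)\neq 0$. It sends $y''=J$ at $q_0$ to $y''=K$ at a jet $q_1$ if its prolongation $P=D_xY/D_xX$, $Y_{XX}=D_xP/D_xX$ maps $q_0$ to $q_1$ and $\{y_{xx}=J\}$ near $q_0$ into $\{Y_{XX}=K(X,Y,P)\}$. If such a map exists, the two equations are called fibre-preserving equivalent. With $D_x=\partial_x+p\,\partial_y+K\,\partial_p$ and group parameters $A,B\neq0$, $C$, the primary relative invariants of $y''=K(x,y,p)$ are $$I_1=-\frac{A}{2B^2}K_{ppp},\qquad I_2=\frac1{2AB}\bigl(D_xK_{pp}-K_{py}\bigr),$$ $$I_3=-C\,I_2+\frac1{2A^2B}\bigl(D_xK_{py}+K_{pp}K_y-K_{py}K_p-2K_{yy}\bigr).$$ The equation $y''=K$, with $K$ analytic at the origin, is in normal form if, near the origin, $K(x,y,0)\equiv0$,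 $K_p(0,y,0)\equiv0$, $K_p(x,0,0)\equiv0$ and $K_{pp}(0,y,0)\equiv0$. Write $K_{i,j,k}=\partial_x^i\partial_y^j\partial_p^kK(0,0,0)$. **Corollary 6.44.** Let $J$ be analytic at $q_0=(x_0,y_0,p_0)$. (a) The following are equivalent: 1. near $q_0$, $y''=J$ admits a six-dimensional local Lie group of fibre-preserving point symmetries (an analytic, locally effective local action of a six-dimensional local Lie group by fibre-preserving maps preserving the equation); 2. $I_1,I_2,I_3$ of $J$ vanish identically near $q_0$, for all group parameters $A,B\ne0$, $C$; 3. some fibre-preserving map sends $y''=J$ at $q_0$ to a normal form $y''=K=M(x,y)p^2+N(x,y)p$ at the origin, with $M,N$ analytic and given near the origin by the convergent series $$M=\sum_{i,j\ge0}\frac{K_{1+i,j,2}}{(1+i)!\,j!\,2!}x^{1+i}y^j,\qquad N=\sum_{i,j\ge0}\frac{K_{1+i,1+j,1}}{(1+i)!\,(1+j)!}x^{1+i}y^{1+j},$$ and satisfying the relations $2M_x=N_y$ and $N_{xy}=N_yN$ near the origin; 4. $y''=J$ at $q_0$ is fibre-preserving equivalent to $y''=0$ at the origin. (b) If $y''=J$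 admits such a six-dimensional group, then every normal form $y''=K$ at the origin to which a fibre-preserving map sends it has the shape $K=Mp^2+Np$ with analytic $M,N$ that have the expansions and satisfy the relations in 3. (c) If $y''=K$ is in normal form, $K=Mp^2+Np$ near the origin with $M,N$ analytic, $2M_x=N_y$ and $N_{xy}=N_yN$, then $M\equiv N\equiv0$ near the origin, and $y''=K$ at the origin is fibre-preserving equivalent to $y''=0$ at the origin. -/

import Mathlib

open Filter Topology

namespace SecondOrderODE

/-! A second order equation `y'' = K(x, y, p)`, with `p = y'`, is given by a function
`K : ℝ → ℝ → ℝ → ℝ`. All notions are local: they concern germs at a first order jet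
`(x₀, y₀, p₀)`, written with `∀ᶠ … in 𝓝 …`. -/

noncomputable section

/-- The partial derivative in `x` of a function of `(x, y)`. -/
def dx (g : ℝ → ℝ → ℝ) (x y : ℝ) : ℝ := deriv (fun t => g t y) x

/-- The partial derivative in `y` of a function of `(x, y)`. -/
def dy (g : ℝ → ℝ → ℝ) (x y : ℝ) : ℝ := deriv (fun t => g x t) y

/-- The partial derivative in `x` of a function of `(x, y, p)`. -/
def jetDx (F : ℝ → ℝ → ℝ → ℝ) (x y p : ℝ) : ℝ := deriv (fun t => F t y p) x

/-- The partial derivative in `y` of a function of `(x, y, p)`. -/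
def jetDy (F : ℝ → ℝ → ℝ → ℝ) (x y p : ℝ) : ℝ := deriv (fun t => F x t p) y

/-- The partial derivative in `p` of a function of `(x, y, p)`. -/
def jetDp (F : ℝ → ℝ → ℝ → ℝ) (x y p : ℝ) : ℝ := deriv (fun t => F x y t) p

/-- The total derivative `D_x F = F_x + p F_y + K F_p` along `y'' = K(x, y, p)`. -/
def totalD (K F : ℝ → ℝ → ℝ → ℝ) (x y p : ℝ) : ℝ :=
  jetDx F x y p + p * jetDy F x y p + K x y p * jetDp F x y p

/-- `K` is real-analytic near the jet `(x₀, y₀, p₀)`. -/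
def IsAnalyticODE (K : ℝ → ℝ → ℝ → ℝ) (x₀ y₀ p₀ : ℝ) : Prop :=
  AnalyticAt ℝ (fun z : ℝ × ℝ × ℝ => K z.1 z.2.1 z.2.2) (x₀, y₀, p₀)

/-! ### Fibre-preserving point transformations and equivalence -/

/-- The first prolongation `P = D_x Y / D_x X` of `X = φ(x)`, `Y = ψ(x, y)`. -/
def prolongP (φ : ℝ → ℝ) (ψ : ℝ → ℝ → ℝ) (x y p : ℝ) : ℝ :=
  (dx ψ x y + dy ψ x y * p) / deriv φ x

/-- The second prolongation `Y_XX = D_x P / D_x X` of `X = φ(x)`, `Y = ψ(x, y)`;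
`r` stands for `y''`. -/
def prolongQ (φ : ℝ → ℝ) (ψ : ℝ → ℝ → ℝ) (x y p r : ℝ) : ℝ :=
  (deriv φ x * dy (dy ψ) x y * p ^ 2 + 2 * deriv φ x * dx (dy ψ) x y * p
      + deriv φ x * dx (dx ψ) x y + (-dx ψ x y - dy ψ x y * p) * deriv (deriv φ) x
      + dy ψ x y * deriv φ x * r) / deriv φ x ^ 3

/-- The prolongation of `X = φ(x)`, `Y = ψ(x, y)` maps `y'' = J` at `(x, y, p)` into
`Y'' = K`. -/
def MapsODEAt (φ : ℝ → ℝ) (ψ : ℝ → ℝ → ℝ) (J K : ℝ → ℝ → ℝ → ℝ) (x y p : ℝ) : Prop :=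
  prolongQ φ ψ x y p (J x y p) = K (φ x) (ψ x y) (prolongP φ ψ x y p)

/-- The germ of `y'' = J` at the jet `(x₀, y₀, p₀)` is sent to the germ of `y'' = K` at the jet
`(x₁, y₁, p₁)` by an analytic, locally invertible, fibre-preserving point transformation. -/
def FibreEquivalent (J : ℝ → ℝ → ℝ → ℝ) (x₀ y₀ p₀ : ℝ) (K : ℝ → ℝ → ℝ → ℝ)
    (x₁ y₁ p₁ : ℝ) : Prop :=
  ∃ (φ : ℝ → ℝ) (ψ : ℝ → ℝ → ℝ),
    AnalyticAt ℝ φ x₀ ∧ AnalyticAt ℝ (fun z : ℝ × ℝ => ψ z.1 z.2) (x₀, y₀) ∧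
    deriv φ x₀ ≠ 0 ∧ dy ψ x₀ y₀ ≠ 0 ∧
    φ x₀ = x₁ ∧ ψ x₀ y₀ = y₁ ∧ prolongP φ ψ x₀ y₀ p₀ = p₁ ∧
    ∀ᶠ z : ℝ × ℝ × ℝ in 𝓝 (x₀, y₀, p₀), MapsODEAt φ ψ J K z.1 z.2.1 z.2.2

/-! ### The primary relative invariants -/

/-- `I₁` on the bundle with group parameters `A, B, C` over the jets `(x, y, p)`. -/
def invI1 (K : ℝ → ℝ → ℝ → ℝ) (A B _C x y p : ℝ) : ℝ :=
  -(A / (2 * B ^ 2)) * jetDp (jetDp (jetDp K)) x y p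

/-- `I₂` on the bundle with group parameters `A, B, C` over the jets `(x, y, p)`. -/
def invI2 (K : ℝ → ℝ → ℝ → ℝ) (A B _C x y p : ℝ) : ℝ :=
  1 / (2 * A * B) * (totalD K (jetDp (jetDp K)) x y p - jetDy (jetDp K) x y p)

/-- `I₃` on the bundle with group parameters `A, B, C` over the jets `(x, y, p)`. -/
def invI3 (K : ℝ → ℝ → ℝ → ℝ) (A B C x y p : ℝ) : ℝ :=
  -C * invI2 K A B C x y p
    + 1 / (2 * A ^ 2 * B) * (totalD K (jetDy (jetDp K)) x y p
        + jetDp (jetDp K) x y p * jetDy K x y p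
        - jetDy (jetDp K) x y p * jetDp K x y p - 2 * jetDy (jetDy K) x y p)

/-- `I₁`, `I₂`, `I₃` vanish identically near the jet `(x₀, y₀, p₀)`. -/
def InvariantsVanish (K : ℝ → ℝ → ℝ → ℝ) (x₀ y₀ p₀ : ℝ) : Prop :=
  ∀ᶠ z : ℝ × ℝ × ℝ in 𝓝 (x₀, y₀, p₀), ∀ A B C : ℝ, A ≠ 0 → B ≠ 0 →
    invI1 K A B C z.1 z.2.1 z.2.2 = 0 ∧ invI2 K A B C z.1 z.2.1 z.2.2 = 0 ∧
      invI3 K A B C z.1 z.2.1 z.2.2 = 0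

/-! ### Local Lie groups of fibre-preserving symmetries -/

/-- An `n`-dimensional (analytic) local Lie group, in coordinates centred at the identity. -/
structure LocalLieGroup (n : ℕ) where
  mul : (Fin n → ℝ) → (Fin n → ℝ) → (Fin n → ℝ)
  inv : (Fin n → ℝ) → (Fin n → ℝ)
  analyticAt_mul : AnalyticAt ℝ (fun a : (Fin n → ℝ) × (Fin n → ℝ) => mul a.1 a.2) (0, 0)
  analyticAt_inv : AnalyticAt ℝ inv 0
  one_mul : ∀ᶠ a in 𝓝 (0 : Fin n → ℝ), mul 0 a = a
  mul_one : ∀ᶠ a in 𝓝 (0 : Fin n → ℝ), mul a 0 = a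
  inv_one : inv 0 = 0
  inv_mul : ∀ᶠ a in 𝓝 (0 : Fin n → ℝ), mul (inv a) a = 0
  mul_inv : ∀ᶠ a in 𝓝 (0 : Fin n → ℝ), mul a (inv a) = 0
  mul_assoc : ∀ᶠ a : (Fin n → ℝ) × (Fin n → ℝ) × (Fin n → ℝ) in 𝓝 (0, 0, 0),
    mul (mul a.1 a.2.1) a.2.2 = mul a.1 (mul a.2.1 a.2.2)

/-- A local, locally effective, analytic action of a local Lie group near `(x₀, y₀)` by
fibre-preserving point transformations `(x, y) ↦ (φ a x, ψ a x y)` that are symmetries of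
`y'' = K` near the jet `(x₀, y₀, p₀)`. -/
structure FibreSymmetryAction {n : ℕ} (G : LocalLieGroup n) (K : ℝ → ℝ → ℝ → ℝ)
    (x₀ y₀ p₀ : ℝ) where
  φ : (Fin n → ℝ) → ℝ → ℝ
  ψ : (Fin n → ℝ) → ℝ → ℝ → ℝ
  analyticAt_φ : AnalyticAt ℝ (fun z : (Fin n → ℝ) × ℝ => φ z.1 z.2) (0, x₀)
  analyticAt_ψ : AnalyticAt ℝ (fun z : (Fin n → ℝ) × ℝ × ℝ => ψ z.1 z.2.1 z.2.2) (0, x₀, y₀)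
  one_act : ∀ᶠ z : ℝ × ℝ in 𝓝 (x₀, y₀), φ 0 z.1 = z.1 ∧ ψ 0 z.1 z.2 = z.2
  mul_act : ∀ᶠ z : (Fin n → ℝ) × (Fin n → ℝ) × ℝ × ℝ in 𝓝 (0, 0, x₀, y₀),
    φ (G.mul z.1 z.2.1) z.2.2.1 = φ z.1 (φ z.2.1 z.2.2.1) ∧
    ψ (G.mul z.1 z.2.1) z.2.2.1 z.2.2.2
      = ψ z.1 (φ z.2.1 z.2.2.1) (ψ z.2.1 z.2.2.1 z.2.2.2)
  effective : ∀ᶠ a in 𝓝 (0 : Fin n → ℝ),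
    (∀ᶠ z : ℝ × ℝ in 𝓝 (x₀, y₀), φ a z.1 = z.1 ∧ ψ a z.1 z.2 = z.2) → a = 0
  symmetry : ∀ᶠ z : (Fin n → ℝ) × ℝ × ℝ × ℝ in 𝓝 (0, x₀, y₀, p₀),
    MapsODEAt (φ z.1) (ψ z.1) K K z.2.1 z.2.2.1 z.2.2.2

/-- Near the jet `(x₀, y₀, p₀)`, the equation `y'' = K` admits an `n`-dimensional local Lie group
of fibre-preserving point symmetries. -/
def AdmitsSymmetryGroup (n : ℕ) (K : ℝ → ℝ → ℝ → ℝ) (x₀ y₀ p₀ : ℝ) : Prop :=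
  ∃ G : LocalLieGroup n, Nonempty (FibreSymmetryAction G K x₀ y₀ p₀)

/-! ### Normal forms -/

/-- The analytic equation `y'' = K` is in normal form at the origin. -/
structure IsNormalForm (K : ℝ → ℝ → ℝ → ℝ) : Prop where
  analytic : IsAnalyticODE K 0 0 0
  d1 : ∀ᶠ z : ℝ × ℝ in 𝓝 (0, 0), K z.1 z.2 0 = 0
  d2 : ∀ᶠ y in 𝓝 (0 : ℝ), jetDp K 0 y 0 = 0
  d3 : ∀ᶠ x in 𝓝 (0 : ℝ), jetDp K x 0 0 = 0
  d4 : ∀ᶠ y in 𝓝 (0 : ℝ), jetDp (jetDp K) 0 y 0 = 0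

/-- `K = M(x, y) p² + N(x, y) p` near the origin, with `M`, `N` analytic at the origin. -/
structure HasQuadraticShape (K : ℝ → ℝ → ℝ → ℝ) (M N : ℝ → ℝ → ℝ) : Prop where
  analytic_M : AnalyticAt ℝ (fun z : ℝ × ℝ => M z.1 z.2) (0, 0)
  analytic_N : AnalyticAt ℝ (fun z : ℝ × ℝ => N z.1 z.2) (0, 0)
  eq : ∀ᶠ z : ℝ × ℝ × ℝ in 𝓝 (0, 0, 0),
    K z.1 z.2.1 z.2.2 = M z.1 z.2.1 * z.2.2 ^ 2 + N z.1 z.2.1 * z.2.2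

/-- The derivative `K_{i,j,k} = ∂_x^i ∂_y^j ∂_p^k K (0, 0, 0)`. -/
def jetCoeff (K : ℝ → ℝ → ℝ → ℝ) (i j k : ℕ) : ℝ :=
  iteratedDeriv i (fun x => iteratedDeriv j (fun y => iteratedDeriv k (fun p => K x y p) 0) 0) 0

/-- Near the origin, `M` and `N` are the sums of the convergent power series
`∑ K_{1+i,j,2} x^{1+i} y^j / ((1+i)! j! 2!)` and
`∑ K_{1+i,1+j,1} x^{1+i} y^{1+j} / ((1+i)! (1+j)!)` over `i, j ≥ 0`. -/
def HasNormalExpansion (K : ℝ → ℝ → ℝ → ℝ) (M N : ℝ → ℝ → ℝ) : Prop :=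
  ∀ᶠ z : ℝ × ℝ in 𝓝 (0, 0),
    HasSum (fun ij : ℕ × ℕ => jetCoeff K (1 + ij.1) ij.2 2 * z.1 ^ (1 + ij.1) * z.2 ^ ij.2
      / ((1 + ij.1).factorial * ij.2.factorial * Nat.factorial 2 : ℝ)) (M z.1 z.2) ∧
    HasSum (fun ij : ℕ × ℕ =>
      jetCoeff K (1 + ij.1) (1 + ij.2) 1 * z.1 ^ (1 + ij.1) * z.2 ^ (1 + ij.2)
      / ((1 + ij.1).factorial * (1 + ij.2).factorial : ℝ)) (N z.1 z.2)

/-- The relations `2 M_x = N_y` and `N_xy = N_y N` near the origin. -/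
def SatisfyRelations (M N : ℝ → ℝ → ℝ) : Prop :=
  ∀ᶠ z : ℝ × ℝ in 𝓝 (0, 0),
    2 * dx M z.1 z.2 = dy N z.1 z.2 ∧ dy (dx N) z.1 z.2 = dy N z.1 z.2 * N z.1 z.2

end

end SecondOrderODE

open SecondOrderODE

/-! The cycle is: group ⇒ vanishing invariants ⇒ flat ⇒ group, together with flat ⇔ normal form with
the two relations.

Group ⇒ invariants. The generators ξ(x)∂_x + η(x,y)∂_y of the action satisfy the linear determining
equation (`determining_equation`). This equation is of finite type: ξ, ξ_x, ξ_xx, η, η_x, η_y at one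
point determine the generator (`InfSymmetry.mem_ideal`, `infSymmetry_eq_zero`). Effectivity makes v
↦ generator injective (`FibreSymmetryAction.eq_zero_of_generator`), so a six-dimensional group
attains all values of these six numbers at every nearby jet. In particular some generator fixes the
given jet to first order and has η_y = 1 there. The invariants have nonzero weight under it, so its
determining equation, differentiated and evaluated at that jet, forces K_ppp, then the second and
then the third invariant expression to vanish (`eval_ppp`, `eval_second`, `eval_third`).

Invariants ⇒ flat. Since J_ppp = 0, J = a p² + b p + c. The other two invariants give 2a_x = b_y and
b_xy + 2(ac)_y - b b_y - 2c_yy = 0. A map (φ, ψ) sends J to 0 exactly when, with h = φ''/φ', ψ_yy =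
-aψ_y, 2ψ_xy = (h - b)ψ_y and ψ_xx = hψ_x - cψ_y. The first relation is the integrability of the
first two equations. The second says that 2b_x - b² - 4c_y + 4ac depends on x alone, which turns
compatibility with the third equation into a Riccati equation for h, i.e. a Schwarzian equation for
φ (`exists_baseChange`, `exists_linearizing`).

Flat ⇒ group. The projective maps of the plane preserving the vertical fibration form a
six-parameter group of symmetries of y'' = 0, and conjugation carries it to J
(`AdmitsSymmetryGroup.of_fibreEquivalent`).

Normal forms. N_xy = N_y N is a linear homogeneous equation in x for N_y, which vanishes at x = 0;
hence N_y = 0, N = 0, M_x = 0 and M = 0 (`eventually_eq_zero_of_isNormalForm`). So the normal form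
in the theorem is y'' = 0 and all its expansion coefficients are zero. For (b), the group is moved
to K, where the first implication applies. -/

namespace SecondOrderODE

noncomputable section

/-! ### Germs of analytic functions as a ring with commuting derivations. -/

section DirectionalDerivative

variable {E : Type*} [NormedAddCommGroup E] [NormedSpace ℝ E]

/-- The derivative of `f` in the direction `v`. -/
def dirDeriv (v : E) (f : E → ℝ) (z : E) : ℝ := fderiv ℝ f z v

theorem analyticAt_dirDeriv {f : E → ℝ} {z : E} (v : E) (hf : AnalyticAt ℝ f z) :
    AnalyticAt ℝ (dirDeriv v f) z :=
  ((ContinuousLinearMap.apply ℝ ℝ v : (E →L[ℝ] ℝ) →L[ℝ] ℝ).analyticAt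
    (fderiv ℝ f z)).comp hf.fderiv

theorem dirDeriv_congr {f g : E → ℝ} {z : E} (v : E) (h : f =ᶠ[𝓝 z] g) :
    dirDeriv v f =ᶠ[𝓝 z] dirDeriv v g := by
  filter_upwards [h.fderiv (𝕜 := ℝ)] with w hw
  simp [dirDeriv, hw]

theorem dirDeriv_comm {f : E → ℝ} {z : E} (u v : E) (hf : AnalyticAt ℝ f z) :
    dirDeriv u (dirDeriv v f) z = dirDeriv v (dirDeriv u f) z := by
  have key : ∀ a b : E, dirDeriv a (dirDeriv b f) z = fderiv ℝ (fderiv ℝ f) z a b := by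
    intro a b
    have h1 : HasFDerivAt (fderiv ℝ f) (fderiv ℝ (fderiv ℝ f) z) z :=
      hf.fderiv.differentiableAt.hasFDerivAt
    have h2 := ((ContinuousLinearMap.apply ℝ ℝ b : (E →L[ℝ] ℝ) →L[ℝ] ℝ).hasFDerivAt.comp z h1)
    have h3 : fderiv ℝ (dirDeriv b f) z = _ := h2.fderiv
    rw [dirDeriv, h3]
    rfl
  rw [key, key]
  have : IsSymmSndFDerivAt ℝ f z :=
    (hf.contDiffAt (n := 2)).isSymmSndFDerivAt (by simp)
  exact this u v

theorem dirDeriv_add {f g : E → ℝ} {z : E} (v : E) (hf : DifferentiableAt ℝ f z)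
    (hg : DifferentiableAt ℝ g z) :
    dirDeriv v (f + g) z = dirDeriv v f z + dirDeriv v g z := by
  simp [dirDeriv, fderiv_add hf hg]

theorem dirDeriv_mul {f g : E → ℝ} {z : E} (v : E) (hf : DifferentiableAt ℝ f z)
    (hg : DifferentiableAt ℝ g z) :
    dirDeriv v (f * g) z = f z * dirDeriv v g z + g z * dirDeriv v f z := by
  simp [dirDeriv, fderiv_mul hf hg]

theorem hasDerivAt_line {f : E → ℝ} {z : E} (v : E) {t : ℝ}
    (hf : DifferentiableAt ℝ f (z + t • v)) :
    HasDerivAt (fun s : ℝ => f (z + s • v)) (dirDeriv v f (z + t • v)) t := by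
  have h : HasDerivAt (fun s : ℝ => z + s • v) v t := by
    simpa using ((hasDerivAt_id t).smul_const v).const_add z
  exact hf.hasFDerivAt.comp_hasDerivAt t h

/-- The ring of germs at `z` of real-analytic functions. -/
def AnGerm (z : E) : Subring (Germ (𝓝 z) ℝ) where
  carrier := {f | ∃ g : E → ℝ, AnalyticAt ℝ g z ∧ f = (g : Germ (𝓝 z) ℝ)}
  mul_mem' := by
    rintro _ _ ⟨f, hf, rfl⟩ ⟨g, hg, rfl⟩
    exact ⟨f * g, hf.mul hg, rfl⟩
  one_mem' := ⟨1, analyticAt_const, rfl⟩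
  add_mem' := by
    rintro _ _ ⟨f, hf, rfl⟩ ⟨g, hg, rfl⟩
    exact ⟨f + g, hf.add hg, rfl⟩
  zero_mem' := ⟨0, analyticAt_const, rfl⟩
  neg_mem' := by
    rintro _ ⟨f, hf, rfl⟩
    exact ⟨-f, hf.neg, rfl⟩

namespace AnGerm

variable {z : E}

/-- The germ of an analytic function. -/
def mk (f : E → ℝ) (hf : AnalyticAt ℝ f z) : AnGerm z := ⟨(f : Germ (𝓝 z) ℝ), f, hf, rfl⟩

theorem mk_eq_mk {f g : E → ℝ} {hf : AnalyticAt ℝ f z} {hg : AnalyticAt ℝ g z} :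
    mk f hf = mk g hg ↔ f =ᶠ[𝓝 z] g := by
  exact Subtype.ext_iff.trans Germ.coe_eq

theorem exists_rep (a : AnGerm z) : ∃ (f : E → ℝ) (hf : AnalyticAt ℝ f z), a = mk f hf := by
  obtain ⟨a, f, hf, rfl⟩ := a
  exact ⟨f, hf, rfl⟩

theorem mk_add {f g : E → ℝ} (hf : AnalyticAt ℝ f z) (hg : AnalyticAt ℝ g z) :
    mk f hf + mk g hg = mk (f + g) (hf.add hg) := rfl

theorem mk_mul {f g : E → ℝ} (hf : AnalyticAt ℝ f z) (hg : AnalyticAt ℝ g z) :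
    mk f hf * mk g hg = mk (f * g) (hf.mul hg) := rfl

/-- Evaluation of a germ at its base point. -/
def ev (z : E) : AnGerm z →+* ℝ := Germ.valueRingHom.comp (AnGerm z).subtype

@[simp]
theorem ev_mk {f : E → ℝ} (hf : AnalyticAt ℝ f z) : ev z (mk f hf) = f z := rfl

theorem mk_neg {f : E → ℝ} (hf : AnalyticAt ℝ f z) : -mk f hf = mk (-f) hf.neg := rfl

theorem mk_eq_one {f : E → ℝ} {hf : AnalyticAt ℝ f z} :
    mk f hf = 1 ↔ ∀ᶠ w in 𝓝 z, f w = 1 := mk_eq_mk (hg := analyticAt_const (v := (1 : ℝ)))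

theorem mk_eq_zero {f : E → ℝ} {hf : AnalyticAt ℝ f z} :
    mk f hf = 0 ↔ ∀ᶠ w in 𝓝 z, f w = 0 := mk_eq_mk (hg := analyticAt_const (v := (0 : ℝ)))

theorem mk_choose (a : AnGerm z) : a = mk a.2.choose a.2.choose_spec.1 :=
  Subtype.ext a.2.choose_spec.2

/-- The germ of the directional derivative. -/
def dirAux (v : E) (a : AnGerm z) : AnGerm z :=
  mk (dirDeriv v a.2.choose) (analyticAt_dirDeriv v a.2.choose_spec.1)

theorem dirAux_mk {f : E → ℝ} (v : E) (hf : AnalyticAt ℝ f z) :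
    dirAux v (mk f hf) = mk (dirDeriv v f) (analyticAt_dirDeriv v hf) := by
  rw [dirAux, mk_eq_mk]
  exact dirDeriv_congr v (mk_eq_mk.1 (mk_choose (mk f hf)).symm)

/-- The directional derivative as a derivation of the ring of germs. -/
def D (v : E) : Derivation ℤ (AnGerm z) (AnGerm z) :=
  Derivation.mk' (AddMonoidHom.toIntLinearMap
    (AddMonoidHom.mk' (dirAux v) (by
      intro a b
      obtain ⟨f, hf, rfl⟩ := exists_rep a
      obtain ⟨g, hg, rfl⟩ := exists_rep b
      rw [mk_add, dirAux_mk, dirAux_mk, dirAux_mk, mk_add, mk_eq_mk]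
      filter_upwards [hf.eventually_analyticAt, hg.eventually_analyticAt] with w h1 h2
      exact dirDeriv_add v h1.differentiableAt h2.differentiableAt))) (by
      intro a b
      obtain ⟨f, hf, rfl⟩ := exists_rep a
      obtain ⟨g, hg, rfl⟩ := exists_rep b
      change dirAux v _ = mk f hf * dirAux v (mk g hg) + mk g hg * dirAux v (mk f hf)
      rw [mk_mul, dirAux_mk, dirAux_mk, dirAux_mk, mk_mul, mk_mul, mk_add, mk_eq_mk]
      filter_upwards [hf.eventually_analyticAt, hg.eventually_analyticAt] with w h1 h2
      exact dirDeriv_mul v h1.differentiableAt h2.differentiableAt)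

theorem D_mk {f : E → ℝ} (v : E) (hf : AnalyticAt ℝ f z) :
    D v (mk f hf) = mk (dirDeriv v f) (analyticAt_dirDeriv v hf) := dirAux_mk v hf

theorem D_comm (u v : E) (a : AnGerm z) : D u (D v a) = D v (D u a) := by
  obtain ⟨f, hf, rfl⟩ := exists_rep a
  simp only [D_mk]
  rw [mk_eq_mk]
  filter_upwards [hf.eventually_analyticAt] with w h1
  exact dirDeriv_comm u v h1

theorem D_add_left (u v : E) (a : AnGerm z) : D (u + v) a = D u a + D v a := by
  obtain ⟨f, hf, rfl⟩ := exists_rep a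
  simp only [D_mk, mk_add]
  rw [mk_eq_mk]
  exact Eventually.of_forall fun w => by simp [dirDeriv]

theorem isUnit_of_ev_ne_zero {a : AnGerm z} (h : ev z a ≠ 0) : IsUnit a := by
  obtain ⟨f, hf, rfl⟩ := exists_rep a
  refine IsUnit.of_mul_eq_one (mk f⁻¹ (hf.inv h)) ?_
  rw [mk_mul, mk_eq_one]
  filter_upwards [hf.continuousAt.eventually_ne h] with w hw
  simpa using mul_inv_cancel₀ hw

end AnGerm

end DirectionalDerivative

/-! ### Infinitesimal symmetries: pure differential algebra of the determining equation. -/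

section DifferentialAlgebra

set_option linter.unusedSimpArgs false

variable {R : Type*} [CommRing R]

theorem derivation_two (d : Derivation ℤ R R) : d 2 = 0 := by
  simpa using d.map_natCast 2

/-- A ring with three commuting derivations, in which `p` behaves as the third coordinate,
`K` is the right-hand side of an equation `y'' = K` and `ξ ∂_x + η ∂_y` is a fibre-preserving
infinitesimal symmetry of it. -/
structure InfSymmetry (X Y P : Derivation ℤ R R) (p K ξ η : R) : Prop where
  yx : ∀ f, Y (X f) = X (Y f)
  px : ∀ f, P (X f) = X (P f)
  py : ∀ f, P (Y f) = Y (P f)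
  xp : X p = 0
  yp : Y p = 0
  pp : P p = 1
  yξ : Y ξ = 0
  pξ : P ξ = 0
  pη : P η = 0
  eq : Y (Y η) * (p * p) + (2 * X (Y η) - X (X ξ)) * p + X (X η) + (Y η - 2 * X ξ) * K =
    ξ * X K + η * Y K + (X η + p * (Y η - X ξ)) * P K

namespace InfSymmetry

variable {X Y P : Derivation ℤ R R} {p K ξ η : R}

/-- Differentiating the determining equation in p, where ξ and η are constant, lowers the degree of
its left side. After three steps (`eq_ppp`) only a homogeneous linear equation for K_ppp is left. -/
theorem eq_p (h : InfSymmetry X Y P p K ξ η) :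
    2 * Y (Y η) * p + 2 * X (Y η) - X (X ξ) =
      ξ * X (P K) + η * Y (P K) + (X η + p * (Y η - X ξ)) * P (P K) + X ξ * P K := by
  have e := congrArg P h.eq
  simp only [map_add, map_sub, map_zero, Derivation.leibniz, smul_eq_mul,
    derivation_two, h.yx, h.px, h.py, h.xp, h.yp, h.pp, h.yξ, h.pξ, h.pη] at e
  linear_combination e

theorem eq_pp (h : InfSymmetry X Y P p K ξ η) :
    2 * Y (Y η) =
      ξ * X (P (P K)) + η * Y (P (P K)) + (X η + p * (Y η - X ξ)) * P (P (P K)) +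
        Y η * P (P K) := by
  have e := congrArg P h.eq_p
  simp only [map_add, map_sub, map_zero, Derivation.leibniz, smul_eq_mul,
    derivation_two, h.yx, h.px, h.py, h.xp, h.yp, h.pp, h.yξ, h.pξ, h.pη] at e
  linear_combination e

theorem eq_ppp (h : InfSymmetry X Y P p K ξ η) :
    ξ * X (P (P (P K))) + η * Y (P (P (P K))) + (X η + p * (Y η - X ξ)) * P (P (P (P K))) +
        (2 * Y η - X ξ) * P (P (P K)) = 0 := by
  have e := congrArg P h.eq_pp
  simp only [map_add, map_sub, map_zero, Derivation.leibniz, smul_eq_mul,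
    derivation_two, h.yx, h.px, h.py, h.xp, h.yp, h.pp, h.yξ, h.pξ, h.pη] at e
  linear_combination -e

variable {S : Type*} [CommRing S]

/-- The values at a point, under the evaluation `ε`, of a vertical symmetry that fixes the jet. -/
structure IsVertical (ε : R →+* S) (X Y : Derivation ℤ R R) (p ξ η : R) : Prop where
  ev_ξ : ε ξ = 0
  ev_xξ : ε (X ξ) = 0
  ev_xxξ : ε (X (X ξ)) = 0
  ev_η : ε η = 0
  ev_xη : ε (X η) = -ε p
  ev_yη : ε (Y η) = 1

/-- The jet is fixed, so the transport terms die, and K_ppp remains with weight 2η_y - ξ_x = 2. -/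
theorem eval_ppp [IsDomain S] [CharZero S] (h : InfSymmetry X Y P p K ξ η) {ε : R →+* S}
    (hv : IsVertical ε X Y p ξ η) :
    ε (P (P (P K))) = 0 := by
  have e := congrArg ε h.eq_ppp
  simp only [map_add, map_mul, map_sub, map_zero, hv.ev_ξ, hv.ev_xξ, hv.ev_η, hv.ev_xη, hv.ev_yη,
    map_ofNat] at e
  have : (2 : S) * ε (P (P (P K))) = 0 := by linear_combination e
  simpa using this

/-- The combination (∂_x + p∂_y) of `eq_pp` minus ∂_y of `eq_p` cancels the third derivatives of η
and the second derivatives multiplying K_pp. What remains is the second invariant expression with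
weight η_y = 1. `h3` is needed as an identity in the ring, because K_ppp gets differentiated. -/
theorem eval_second (h : InfSymmetry X Y P p K ξ η) {ε : R →+* S}
    (hv : IsVertical ε X Y p ξ η) (h3 : P (P (P K)) = 0) :
    ε (X (P (P K)) + p * Y (P (P K)) + K * P (P (P K)) - Y (P K)) = 0 := by
  have e := congrArg ε (congrArg X h.eq_pp)
  have e' := congrArg ε (congrArg Y h.eq_pp)
  have e1 := congrArg ε (congrArg Y h.eq_p)
  have f1 := congrArg ε h.eq_pp
  simp only [map_add, map_sub, map_zero, Derivation.leibniz, smul_eq_mul, map_mul,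
    derivation_two, h.yx, h.px, h.py, h.xp, h.yp, h.pp, h.yξ, h.pξ, h.pη, map_ofNat,
    hv.ev_ξ, hv.ev_xξ, hv.ev_xxξ, hv.ev_η, hv.ev_xη, hv.ev_yη, h3] at e e' e1 f1 ⊢
  linear_combination -e - ε p * e' + e1

/-- The expression is linearized by the Leibniz rule, with the matching derivative of the
determining equation put in for each varied factor. The second derivatives of η survive only in
pη_yy + η_xy times the second invariant expression. The third is thus a relative invariant only
modulo the second, whence `h2`. -/
theorem eval_third (h : InfSymmetry X Y P p K ξ η) {ε : R →+* S}
    (hv : IsVertical ε X Y p ξ η) (h3 : P (P (P K)) = 0)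
    (h2 : X (P (P K)) + p * Y (P (P K)) + K * P (P (P K)) - Y (P K) = 0) :
    ε (X (Y (P K)) + p * Y (Y (P K)) + K * P (Y (P K)) + P (P K) * Y K - Y (P K) * P K
      - 2 * Y (Y K)) = 0 := by
  have e := congrArg ε (congrArg X (congrArg Y h.eq_p))
  have e' := congrArg ε (congrArg Y (congrArg Y h.eq_p))
  have e0 := congrArg ε (congrArg Y (congrArg Y h.eq))
  have g1 := congrArg ε (congrArg Y h.eq_p)
  have g0 := congrArg ε (congrArg Y h.eq)
  have g2 := congrArg ε (congrArg Y h.eq_pp)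
  have f1 := congrArg ε h.eq_pp
  have f2 := congrArg ε h.eq_p
  have f3 := congrArg ε h.eq
  have l0 := congrArg ε h2
  simp only [map_add, map_sub, map_zero, Derivation.leibniz, smul_eq_mul, map_mul, map_pow,
    derivation_two, h.yx, h.px, h.py, h.xp, h.yp, h.pp, h.yξ, h.pξ, h.pη, map_ofNat,
    hv.ev_ξ, hv.ev_xξ, hv.ev_xxξ, hv.ev_η, hv.ev_xη, hv.ev_yη, h3] at e e' e0 f1 f2 f3 l0 g0 g1 g2 ⊢
  linear_combination -e - ε p * e' + 2* e0 + ε (P K) * g1 - ε (P (P K)) * g0 - ε K * g2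
    + ε (Y (P K)) * f2 - (ε p * ε (Y (Y η)) + ε (X (Y η))) * l0 - ε (Y (P (P K))) * f3
    - ε (Y K) * f1

/-- The system closes: modulo the six quantities, `eq_pp`, `eq_p` and the equation itself give η_yy,
η_xy and η_xx in turn, and first derivatives of these equations then give ξ_xxx. An ideal generated
by the six is therefore stable under all the derivations. -/
theorem mem_ideal [Invertible (2 : R)] (h : InfSymmetry X Y P p K ξ η) (I : Ideal R) (h₁ : ξ ∈ I)
    (h₂ : X ξ ∈ I) (h₃ : X (X ξ) ∈ I) (h₄ : η ∈ I) (h₅ : X η ∈ I) (h₆ : Y η ∈ I) :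
    X (X η) ∈ I ∧ X (Y η) ∈ I ∧ Y (Y η) ∈ I ∧ X (X (X ξ)) ∈ I := by
  simp only [← Ideal.Quotient.eq_zero_iff_mem] at h₁ h₂ h₃ h₄ h₅ h₆ ⊢
  have half : ∀ a : R, Ideal.Quotient.mk I (2 * a) = 0 → Ideal.Quotient.mk I a = 0 := by
    intro a ha
    rw [← invOf_mul_cancel_left (2 : R) a, map_mul, ha, mul_zero]
  have hyy : Ideal.Quotient.mk I (Y (Y η)) = 0 := by
    apply half
    rw [h.eq_pp]
    simp [h₁, h₂, h₄, h₅, h₆]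
  have hxy : Ideal.Quotient.mk I (X (Y η)) = 0 := by
    apply half
    have e := congrArg (Ideal.Quotient.mk I) h.eq_p
    simp only [map_add, map_sub, map_mul, h₁, h₂, h₃, h₄, h₅, h₆, hyy] at e ⊢
    linear_combination e
  have hxx : Ideal.Quotient.mk I (X (X η)) = 0 := by
    have e := congrArg (Ideal.Quotient.mk I) h.eq
    simp only [map_add, map_sub, map_mul, h₁, h₂, h₃, h₄, h₅, h₆, hyy, hxy] at e
    linear_combination e
  have hxyy := congrArg (Ideal.Quotient.mk I) (congrArg X h.eq_pp)
  have hxxy := congrArg (Ideal.Quotient.mk I) (congrArg Y h.eq)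
  have hxxx := congrArg (Ideal.Quotient.mk I) (congrArg X h.eq_p)
  have hyyy := congrArg (Ideal.Quotient.mk I) (congrArg Y h.eq_pp)
  simp only [map_add, map_sub, map_zero, Derivation.leibniz, smul_eq_mul, map_mul,
    derivation_two, h.yx, h.px, h.py, h.xp, h.yp, h.pp, h.yξ, h.pξ, h.pη, map_ofNat,
    h₁, h₂, h₃, h₄, h₅, h₆, hyy, hxy, hxx, zero_mul, mul_zero, add_zero, zero_add, sub_zero,
    zero_sub, mul_one] at hxyy hxxy hxxx hyyy
  refine ⟨hxx, hxy, hyy, ?_⟩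
  set π := Ideal.Quotient.mk I
  linear_combination -hxxx + 2 * hxxy - π p * hxyy - π p * π p * hyyy

end InfSymmetry

end DifferentialAlgebra

/-! ### Vanishing of analytic germs in differentially stable ideals. -/

section Vanishing

variable {E : Type*} [NormedAddCommGroup E] [NormedSpace ℝ E]

theorem eventually_eq_zero_of_iteratedDeriv {g : ℝ → ℝ} {t : ℝ} (hg : AnalyticAt ℝ g t)
    (h : ∀ n, iteratedDeriv n g t = 0) : ∀ᶠ s in 𝓝 t, g s = 0 := by
  have h1 := hg.hasFPowerSeriesAt
  simp only [h, zero_div] at h1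
  have h2 : FormalMultilinearSeries.ofScalars ℝ (fun _ : ℕ => (0 : ℝ)) = 0 := by
    ext n
    simp [FormalMultilinearSeries.ofScalars]
  rw [h2] at h1
  exact h1.eventually_eq_zero

theorem analyticAt_line {f : E → ℝ} {z w : E} {t : ℝ} (hf : AnalyticAt ℝ f (z + t • w)) :
    AnalyticAt ℝ (fun s : ℝ => f (z + s • w)) t := by
  have : AnalyticAt ℝ (fun s : ℝ => z + s • w) t := by fun_prop
  exact AnalyticAt.fun_comp (f := fun s : ℝ => z + s • w) hf this

theorem iteratedDeriv_line {f : E → ℝ} {z w : E} {U : Set E} (hU : IsOpen U)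
    (hf : AnalyticOnNhd ℝ f U) (n : ℕ) {t : ℝ} (ht : z + t • w ∈ U) :
    iteratedDeriv n (fun s : ℝ => f (z + s • w)) t = (dirDeriv w)^[n] f (z + t • w) := by
  induction n generalizing f with
  | zero => simp
  | succ n ih =>
    have hd : AnalyticOnNhd ℝ (dirDeriv w f) U := fun x hx => analyticAt_dirDeriv w (hf x hx)
    rw [Function.iterate_succ_apply, ← ih hd, iteratedDeriv_succ']
    have hV : IsOpen ((fun s : ℝ => z + s • w) ⁻¹' U) := hU.preimage (by fun_prop)
    have : deriv (fun s : ℝ => f (z + s • w)) =ᶠ[𝓝 t] fun s => dirDeriv w f (z + s • w) := by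
      filter_upwards [hV.mem_nhds ht] with s hs
      exact (hasDerivAt_line w (hf _ hs).differentiableAt).deriv
    exact this.iteratedDeriv_eq n

/-- Every iterated derivative of a member stays in the ideal and so vanishes at z. Hence the Taylor
series along each line through z is zero, and the identity theorem on the segment from z to w gives
the value at w. This replaces a uniqueness theorem for linear systems. -/
theorem AnGerm.eq_zero_of_mem_ideal {z : E} (I : Ideal (AnGerm z)) (hI : ∀ a ∈ I, ev z a = 0)
    (hD : ∀ v, ∀ a ∈ I, D v a ∈ I) {a : AnGerm z} (ha : a ∈ I) : a = 0 := by
  obtain ⟨f, hf, rfl⟩ := exists_rep a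
  obtain ⟨r, hr, hfr⟩ := Metric.eventually_nhds_iff_ball.1 hf.eventually_analyticAt
  rw [mk_eq_zero]
  filter_upwards [Metric.ball_mem_nhds z hr] with w hw
  set v := w - z with hv
  have hseg : ∀ t ∈ Set.Icc (0 : ℝ) 1, z + t • v ∈ Metric.ball z r := by
    intro t ht
    rw [mem_ball_iff_norm] at hw ⊢
    rw [add_sub_cancel_left, norm_smul, Real.norm_of_nonneg ht.1]
    exact (mul_le_of_le_one_left (norm_nonneg _) ht.2).trans_lt hw
  have hiter : ∀ n (g : E → ℝ) (hg : AnalyticAt ℝ g z), mk g hg ∈ I →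
      (dirDeriv v)^[n] g z = 0 := by
    intro n
    induction n with
    | zero => intro g hg h; simpa using hI _ h
    | succ n ih =>
      intro g hg h
      rw [Function.iterate_succ_apply]
      refine ih _ (analyticAt_dirDeriv v hg) ?_
      rw [← D_mk v hg]
      exact hD v _ h
  have han : AnalyticOnNhd ℝ (fun s : ℝ => f (z + s • v)) (Set.Icc 0 1) := fun t ht =>
    analyticAt_line (hfr _ (hseg t ht))
  have h0 : ∀ᶠ s : ℝ in 𝓝 0, f (z + s • v) = 0 := by
    refine eventually_eq_zero_of_iteratedDeriv (han 0 (by simp)) fun n => ?_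
    rw [iteratedDeriv_line Metric.isOpen_ball (fun x hx => hfr x hx) n (hseg 0 (by simp))]
    simpa using hiter n f hf ha
  have := han.eqOn_zero_of_preconnected_of_eventuallyEq_zero isPreconnected_Icc
    (Set.left_mem_Icc.2 zero_le_one) h0 (Set.right_mem_Icc.2 zero_le_one)
  simpa [hv] using this

theorem AnGerm.D_smul_left {z : E} (c : ℝ) (v : E) (a : AnGerm z) :
    D (c • v) a = mk (fun _ => c) analyticAt_const * D v a := by
  obtain ⟨f, hf, rfl⟩ := exists_rep a
  simp only [D_mk, mk_mul]
  rw [mk_eq_mk]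
  exact Eventually.of_forall fun w => by simp [dirDeriv]

/-- A germ in an ideal spanned by germs vanishing at the base point, all of whose derivatives
stay in the ideal, is zero. -/
theorem AnGerm.eq_zero_of_mem_span {z : E} (s : Set (AnGerm z)) (hs : ∀ a ∈ s, ev z a = 0)
    (hD : ∀ v, ∀ a ∈ s, D v a ∈ Ideal.span s) {a : AnGerm z} (ha : a ∈ Ideal.span s) : a = 0 := by
  refine eq_zero_of_mem_ideal (Ideal.span s) ?_ ?_ ha
  · intro b hb
    have : Ideal.span s ≤ RingHom.ker (ev z) := Ideal.span_le.2 fun x hx => hs x hx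
    exact this hb
  · intro v b hb
    induction hb using Submodule.span_induction with
    | mem x hx => exact hD v x hx
    | zero => simp
    | add x y _ _ hx hy => rw [map_add]; exact add_mem hx hy
    | smul c x hx h =>
      rw [smul_eq_mul, Derivation.leibniz, smul_eq_mul, smul_eq_mul]
      exact add_mem (Ideal.mul_mem_left _ _ h) (Ideal.mul_mem_right _ _ hx)

end Vanishing

/-! ### Coordinate derivatives of curried functions as directional derivatives. -/

section Coordinates

/-- A function of three real variables as a function on `ℝ × ℝ × ℝ`. -/
def unc₃ (F : ℝ → ℝ → ℝ → ℝ) (z : ℝ × ℝ × ℝ) : ℝ := F z.1 z.2.1 z.2.2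

/-- A function of two real variables as a function on `ℝ × ℝ`. -/
def unc₂ (f : ℝ → ℝ → ℝ) (z : ℝ × ℝ) : ℝ := f z.1 z.2

/-- The first coordinate direction of the jet space. -/
abbrev ex : ℝ × ℝ × ℝ := (1, 0, 0)

/-- The second coordinate direction of the jet space. -/
abbrev ey : ℝ × ℝ × ℝ := (0, 1, 0)

/-- The third coordinate direction of the jet space. -/
abbrev ep : ℝ × ℝ × ℝ := (0, 0, 1)

variable {F G : ℝ → ℝ → ℝ → ℝ} {f g : ℝ → ℝ → ℝ} {x y p : ℝ}

theorem hasDerivAt_unc₃_x (h : DifferentiableAt ℝ (unc₃ F) (x, y, p)) :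
    HasDerivAt (fun t => F t y p) (dirDeriv ex (unc₃ F) (x, y, p)) x := by
  have h1 : HasDerivAt (fun t : ℝ => ((t, y, p) : ℝ × ℝ × ℝ)) ex x :=
    (hasDerivAt_id x).prodMk (hasDerivAt_const x _)
  exact h.hasFDerivAt.comp_hasDerivAt x h1

theorem hasDerivAt_unc₃_y (h : DifferentiableAt ℝ (unc₃ F) (x, y, p)) :
    HasDerivAt (fun t => F x t p) (dirDeriv ey (unc₃ F) (x, y, p)) y := by
  have h1 : HasDerivAt (fun t : ℝ => ((x, t, p) : ℝ × ℝ × ℝ)) ey y :=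
    (hasDerivAt_const y _).prodMk ((hasDerivAt_id y).prodMk (hasDerivAt_const y _))
  exact h.hasFDerivAt.comp_hasDerivAt y h1

theorem hasDerivAt_unc₃_p (h : DifferentiableAt ℝ (unc₃ F) (x, y, p)) :
    HasDerivAt (fun t => F x y t) (dirDeriv ep (unc₃ F) (x, y, p)) p := by
  have h1 : HasDerivAt (fun t : ℝ => ((x, y, t) : ℝ × ℝ × ℝ)) ep p :=
    (hasDerivAt_const p _).prodMk ((hasDerivAt_const p _).prodMk (hasDerivAt_id p))
  exact h.hasFDerivAt.comp_hasDerivAt p h1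

theorem hasDerivAt_unc₂_x (h : DifferentiableAt ℝ (unc₂ f) (x, y)) :
    HasDerivAt (fun t => f t y) (dirDeriv (1, 0) (unc₂ f) (x, y)) x := by
  have h1 : HasDerivAt (fun t : ℝ => ((t, y) : ℝ × ℝ)) (1, 0) x :=
    (hasDerivAt_id x).prodMk (hasDerivAt_const x _)
  exact h.hasFDerivAt.comp_hasDerivAt x h1

theorem hasDerivAt_unc₂_y (h : DifferentiableAt ℝ (unc₂ f) (x, y)) :
    HasDerivAt (fun t => f x t) (dirDeriv (0, 1) (unc₂ f) (x, y)) y := by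
  have h1 : HasDerivAt (fun t : ℝ => ((x, t) : ℝ × ℝ)) (0, 1) y :=
    (hasDerivAt_const y _).prodMk (hasDerivAt_id y)
  exact h.hasFDerivAt.comp_hasDerivAt y h1

theorem unc₃_jetDx {q : ℝ × ℝ × ℝ} (h : AnalyticAt ℝ (unc₃ F) q) :
    unc₃ (jetDx F) =ᶠ[𝓝 q] dirDeriv ex (unc₃ F) := by
  filter_upwards [h.eventually_analyticAt] with w hw
  exact (hasDerivAt_unc₃_x hw.differentiableAt).deriv

theorem unc₃_jetDy {q : ℝ × ℝ × ℝ} (h : AnalyticAt ℝ (unc₃ F) q) :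
    unc₃ (jetDy F) =ᶠ[𝓝 q] dirDeriv ey (unc₃ F) := by
  filter_upwards [h.eventually_analyticAt] with w hw
  exact (hasDerivAt_unc₃_y hw.differentiableAt).deriv

theorem unc₃_jetDp {q : ℝ × ℝ × ℝ} (h : AnalyticAt ℝ (unc₃ F) q) :
    unc₃ (jetDp F) =ᶠ[𝓝 q] dirDeriv ep (unc₃ F) := by
  filter_upwards [h.eventually_analyticAt] with w hw
  exact (hasDerivAt_unc₃_p hw.differentiableAt).deriv

theorem unc₂_dx {q : ℝ × ℝ} (h : AnalyticAt ℝ (unc₂ f) q) :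
    unc₂ (dx f) =ᶠ[𝓝 q] dirDeriv (1, 0) (unc₂ f) := by
  filter_upwards [h.eventually_analyticAt] with w hw
  exact (hasDerivAt_unc₂_x hw.differentiableAt).deriv

theorem unc₂_dy {q : ℝ × ℝ} (h : AnalyticAt ℝ (unc₂ f) q) :
    unc₂ (dy f) =ᶠ[𝓝 q] dirDeriv (0, 1) (unc₂ f) := by
  filter_upwards [h.eventually_analyticAt] with w hw
  exact (hasDerivAt_unc₂_y hw.differentiableAt).deriv

theorem analyticAt_jetDx {q : ℝ × ℝ × ℝ} (h : AnalyticAt ℝ (unc₃ F) q) :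
    AnalyticAt ℝ (unc₃ (jetDx F)) q :=
  (analyticAt_dirDeriv ex h).congr (unc₃_jetDx h).symm

theorem analyticAt_jetDy {q : ℝ × ℝ × ℝ} (h : AnalyticAt ℝ (unc₃ F) q) :
    AnalyticAt ℝ (unc₃ (jetDy F)) q :=
  (analyticAt_dirDeriv ey h).congr (unc₃_jetDy h).symm

theorem analyticAt_jetDp {q : ℝ × ℝ × ℝ} (h : AnalyticAt ℝ (unc₃ F) q) :
    AnalyticAt ℝ (unc₃ (jetDp F)) q :=
  (analyticAt_dirDeriv ep h).congr (unc₃_jetDp h).symm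

theorem analyticAt_dx {q : ℝ × ℝ} (h : AnalyticAt ℝ (unc₂ f) q) :
    AnalyticAt ℝ (unc₂ (dx f)) q :=
  (analyticAt_dirDeriv (1, 0) h).congr (unc₂_dx h).symm

theorem analyticAt_dy {q : ℝ × ℝ} (h : AnalyticAt ℝ (unc₂ f) q) :
    AnalyticAt ℝ (unc₂ (dy f)) q :=
  (analyticAt_dirDeriv (0, 1) h).congr (unc₂_dy h).symm

theorem AnGerm.mk_jetDx {q : ℝ × ℝ × ℝ} (h : AnalyticAt ℝ (unc₃ F) q) :
    mk (unc₃ (jetDx F)) (analyticAt_jetDx h) = D ex (mk (unc₃ F) h) := by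
  rw [D_mk, mk_eq_mk]
  exact unc₃_jetDx h

theorem AnGerm.mk_jetDy {q : ℝ × ℝ × ℝ} (h : AnalyticAt ℝ (unc₃ F) q) :
    mk (unc₃ (jetDy F)) (analyticAt_jetDy h) = D ey (mk (unc₃ F) h) := by
  rw [D_mk, mk_eq_mk]
  exact unc₃_jetDy h

theorem AnGerm.mk_jetDp {q : ℝ × ℝ × ℝ} (h : AnalyticAt ℝ (unc₃ F) q) :
    mk (unc₃ (jetDp F)) (analyticAt_jetDp h) = D ep (mk (unc₃ F) h) := by
  rw [D_mk, mk_eq_mk]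
  exact unc₃_jetDp h

theorem AnGerm.mk_dx {q : ℝ × ℝ} (h : AnalyticAt ℝ (unc₂ f) q) :
    mk (unc₂ (dx f)) (analyticAt_dx h) = D (1, 0) (mk (unc₂ f) h) := by
  rw [D_mk, mk_eq_mk]
  exact unc₂_dx h

theorem AnGerm.mk_dy {q : ℝ × ℝ} (h : AnalyticAt ℝ (unc₂ f) q) :
    mk (unc₂ (dy f)) (analyticAt_dy h) = D (0, 1) (mk (unc₂ f) h) := by
  rw [D_mk, mk_eq_mk]
  exact unc₂_dy h

theorem hasDerivAt_dx (h : AnalyticAt ℝ (unc₂ f) (x, y)) :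
    HasDerivAt (fun t => f t y) (dx f x y) x := by
  have := hasDerivAt_unc₂_x h.differentiableAt
  rwa [dx, this.deriv]

theorem hasDerivAt_dy (h : AnalyticAt ℝ (unc₂ f) (x, y)) :
    HasDerivAt (fun t => f x t) (dy f x y) y := by
  have := hasDerivAt_unc₂_y h.differentiableAt
  rwa [dy, this.deriv]

theorem hasDerivAt_jetDp (h : AnalyticAt ℝ (unc₃ F) (x, y, p)) :
    HasDerivAt (fun t => F x y t) (jetDp F x y p) p := by
  have := hasDerivAt_unc₃_p h.differentiableAt
  rwa [jetDp, this.deriv]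

/-- The chain rule along a curve, for a function of two variables. -/
theorem hasDerivAt_comp_unc₂ {a b : ℝ → ℝ} {a' b' t : ℝ} (h : AnalyticAt ℝ (unc₂ f) (a t, b t))
    (ha : HasDerivAt a a' t) (hb : HasDerivAt b b' t) :
    HasDerivAt (fun s => f (a s) (b s)) (dx f (a t) (b t) * a' + dy f (a t) (b t) * b') t := by
  have h1 := h.differentiableAt.hasFDerivAt.comp_hasDerivAt t (ha.prodMk hb)
  have h2 : (fderiv ℝ (unc₂ f) (a t, b t)) (a', b')
      = dx f (a t) (b t) * a' + dy f (a t) (b t) * b' := by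
    have e1 : dx f (a t) (b t) = fderiv ℝ (unc₂ f) (a t, b t) (1, 0) :=
      (hasDerivAt_unc₂_x h.differentiableAt).deriv
    have e2 : dy f (a t) (b t) = fderiv ℝ (unc₂ f) (a t, b t) (0, 1) :=
      (hasDerivAt_unc₂_y h.differentiableAt).deriv
    have : ((a', b') : ℝ × ℝ) = a' • (1, 0) + b' • (0, 1) := by simp
    rw [this, map_add, map_smul, map_smul, e1, e2, smul_eq_mul, smul_eq_mul, mul_comm a',
      mul_comm b']
  rw [← h2]
  exact h1

theorem dx_dy_comm (h : AnalyticAt ℝ (unc₂ f) (x, y)) : dy (dx f) x y = dx (dy f) x y := by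
  have e1 := (hasDerivAt_unc₂_x (analyticAt_dy h).differentiableAt).deriv
  have e2 := (hasDerivAt_unc₂_y (analyticAt_dx h).differentiableAt).deriv
  rw [dx, e1, dy, e2, (dirDeriv_congr _ (unc₂_dx h)).eq_of_nhds,
    (dirDeriv_congr _ (unc₂_dy h)).eq_of_nhds]
  exact dirDeriv_comm _ _ h

theorem hasDerivAt_deriv {φ : ℝ → ℝ} (h : AnalyticAt ℝ φ x) : HasDerivAt φ (deriv φ x) x :=
  h.differentiableAt.hasDerivAt

end Coordinates

/-! ### Prolongation of fibre-preserving maps; equivalence is an equivalence relation. -/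

section Prolongation

theorem dx_congr {f g : ℝ → ℝ → ℝ} {x y : ℝ} (h : unc₂ f =ᶠ[𝓝 (x, y)] unc₂ g) :
    dx f x y = dx g x y := by
  refine EventuallyEq.deriv_eq ?_
  have : Tendsto (fun t : ℝ => (t, y)) (𝓝 x) (𝓝 (x, y)) :=
    (Continuous.prodMk_left y).tendsto x
  exact this.eventually h

theorem dy_congr {f g : ℝ → ℝ → ℝ} {x y : ℝ} (h : unc₂ f =ᶠ[𝓝 (x, y)] unc₂ g) :
    dy f x y = dy g x y := by
  refine EventuallyEq.deriv_eq ?_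
  have : Tendsto (fun t : ℝ => (x, t)) (𝓝 y) (𝓝 (x, y)) :=
    (Continuous.prodMk_right x).tendsto y
  exact this.eventually h

theorem unc₂_dx_congr {f g : ℝ → ℝ → ℝ} {z : ℝ × ℝ} (h : unc₂ f =ᶠ[𝓝 z] unc₂ g) :
    unc₂ (dx f) =ᶠ[𝓝 z] unc₂ (dx g) :=
  h.eventuallyEq_nhds.mono fun _ hw => dx_congr hw

theorem unc₂_dy_congr {f g : ℝ → ℝ → ℝ} {z : ℝ × ℝ} (h : unc₂ f =ᶠ[𝓝 z] unc₂ g) :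
    unc₂ (dy f) =ᶠ[𝓝 z] unc₂ (dy g) :=
  h.eventuallyEq_nhds.mono fun _ hw => dy_congr hw

variable {φ φ' : ℝ → ℝ} {ψ ψ' : ℝ → ℝ → ℝ} {x y : ℝ}

theorem prolongP_congr (hφ : φ =ᶠ[𝓝 x] φ') (hψ : unc₂ ψ =ᶠ[𝓝 (x, y)] unc₂ ψ') (p : ℝ) :
    prolongP φ ψ x y p = prolongP φ' ψ' x y p := by
  rw [prolongP, prolongP, dx_congr hψ, dy_congr hψ, hφ.deriv_eq]

theorem prolongQ_congr (hφ : φ =ᶠ[𝓝 x] φ') (hψ : unc₂ ψ =ᶠ[𝓝 (x, y)] unc₂ ψ') (p r : ℝ) :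
    prolongQ φ ψ x y p r = prolongQ φ' ψ' x y p r := by
  rw [prolongQ, prolongQ, dx_congr hψ, dy_congr hψ, hφ.deriv_eq, hφ.deriv.deriv_eq,
    dx_congr (unc₂_dx_congr hψ), dy_congr (unc₂_dy_congr hψ), dx_congr (unc₂_dy_congr hψ)]

theorem prolongP_id (p : ℝ) : prolongP (fun t => t) (fun _ t => t) x y p = p := by
  simp [prolongP, dx, dy]

theorem prolongQ_id (p r : ℝ) : prolongQ (fun t => t) (fun _ t => t) x y p r = r := by
  have h : deriv (fun t : ℝ => t) = fun _ => 1 := deriv_id'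
  simp [prolongQ, dx, dy, h]

section Comp

variable {φ₁ φ₂ : ℝ → ℝ} {ψ₁ ψ₂ : ℝ → ℝ → ℝ}

/-- The second component of the composition of two fibre-preserving maps. -/
def compFibre (ψ₂ : ℝ → ℝ → ℝ) (φ₁ : ℝ → ℝ) (ψ₁ : ℝ → ℝ → ℝ) (x y : ℝ) : ℝ :=
  ψ₂ (φ₁ x) (ψ₁ x y)

theorem analyticAt_base {φ : ℝ → ℝ} {x y : ℝ} (h : AnalyticAt ℝ φ x) :
    AnalyticAt ℝ (fun z : ℝ × ℝ => φ z.1) (x, y) :=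
  AnalyticAt.fun_comp (f := fun z : ℝ × ℝ => z.1) (x := (x, y)) h analyticAt_fst

theorem analyticAt_compFibre (hφ₁ : AnalyticAt ℝ φ₁ x) (hψ₁ : AnalyticAt ℝ (unc₂ ψ₁) (x, y))
    (hψ₂ : AnalyticAt ℝ (unc₂ ψ₂) (φ₁ x, ψ₁ x y)) :
    AnalyticAt ℝ (unc₂ (compFibre ψ₂ φ₁ ψ₁)) (x, y) := by
  have h : AnalyticAt ℝ (fun z : ℝ × ℝ => (φ₁ z.1, unc₂ ψ₁ z)) (x, y) :=
    (analyticAt_base hφ₁).prod hψ₁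
  exact AnalyticAt.fun_comp (f := fun z : ℝ × ℝ => (φ₁ z.1, unc₂ ψ₁ z)) (x := (x, y)) hψ₂ h

theorem dx_compFibre (hφ₁ : AnalyticAt ℝ φ₁ x) (hψ₁ : AnalyticAt ℝ (unc₂ ψ₁) (x, y))
    (hψ₂ : AnalyticAt ℝ (unc₂ ψ₂) (φ₁ x, ψ₁ x y)) :
    dx (compFibre ψ₂ φ₁ ψ₁) x y
      = dx ψ₂ (φ₁ x) (ψ₁ x y) * deriv φ₁ x + dy ψ₂ (φ₁ x) (ψ₁ x y) * dx ψ₁ x y :=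
  (hasDerivAt_comp_unc₂ (a := φ₁) (b := fun t => ψ₁ t y) hψ₂ (hasDerivAt_deriv hφ₁)
    (hasDerivAt_dx hψ₁)).deriv

theorem dy_compFibre (hψ₁ : AnalyticAt ℝ (unc₂ ψ₁) (x, y))
    (hψ₂ : AnalyticAt ℝ (unc₂ ψ₂) (φ₁ x, ψ₁ x y)) :
    dy (compFibre ψ₂ φ₁ ψ₁) x y = dy ψ₂ (φ₁ x) (ψ₁ x y) * dy ψ₁ x y := by
  have := (hasDerivAt_comp_unc₂ (a := fun _ => φ₁ x) (b := fun t => ψ₁ x t) hψ₂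
    (hasDerivAt_const y _) (hasDerivAt_dy hψ₁)).deriv
  rw [mul_zero, zero_add] at this
  exact this

theorem eventually_analyticAt_comp (hφ₁ : AnalyticAt ℝ φ₁ x)
    (hψ₁ : AnalyticAt ℝ (unc₂ ψ₁) (x, y)) (hψ₂ : AnalyticAt ℝ (unc₂ ψ₂) (φ₁ x, ψ₁ x y)) :
    ∀ᶠ z : ℝ × ℝ in 𝓝 (x, y), AnalyticAt ℝ φ₁ z.1 ∧ AnalyticAt ℝ (unc₂ ψ₁) z ∧
      AnalyticAt ℝ (unc₂ ψ₂) (φ₁ z.1, ψ₁ z.1 z.2) := by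
  have h1 : ∀ᶠ z : ℝ × ℝ in 𝓝 (x, y), AnalyticAt ℝ φ₁ z.1 :=
    (continuous_fst.tendsto (x, y)).eventually hφ₁.eventually_analyticAt
  have h : ContinuousAt (fun z : ℝ × ℝ => (φ₁ z.1, unc₂ ψ₁ z)) (x, y) :=
    ((analyticAt_base hφ₁).prod hψ₁).continuousAt
  exact h1.and (hψ₁.eventually_analyticAt.and (h.eventually hψ₂.eventually_analyticAt))

theorem deriv_comp_eventually (hφ₁ : AnalyticAt ℝ φ₁ x) (hφ₂ : AnalyticAt ℝ φ₂ (φ₁ x)) :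
    deriv (fun t => φ₂ (φ₁ t)) =ᶠ[𝓝 x] fun t => deriv φ₂ (φ₁ t) * deriv φ₁ t := by
  filter_upwards [hφ₁.eventually_analyticAt,
    hφ₁.continuousAt.eventually hφ₂.eventually_analyticAt] with t h1 h2
  exact ((hasDerivAt_deriv h2).comp t (hasDerivAt_deriv h1)).deriv

theorem deriv_deriv_comp (hφ₁ : AnalyticAt ℝ φ₁ x) (hφ₂ : AnalyticAt ℝ φ₂ (φ₁ x)) :
    deriv (deriv (fun t => φ₂ (φ₁ t))) x
      = deriv (deriv φ₂) (φ₁ x) * deriv φ₁ x ^ 2 + deriv φ₂ (φ₁ x) * deriv (deriv φ₁) x := by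
  rw [(deriv_comp_eventually hφ₁ hφ₂).deriv_eq]
  have h := ((hasDerivAt_deriv hφ₂.deriv).comp x (hasDerivAt_deriv hφ₁)).mul
    (hasDerivAt_deriv hφ₁.deriv)
  refine h.deriv.trans ?_
  simp only [Function.comp_apply]
  ring

variable (hφ₁ : AnalyticAt ℝ φ₁ x) (hψ₁ : AnalyticAt ℝ (unc₂ ψ₁) (x, y))
  (hψ₂ : AnalyticAt ℝ (unc₂ ψ₂) (φ₁ x, ψ₁ x y))

include hφ₁ hψ₁ hψ₂

theorem dy_dy_compFibre :
    dy (dy (compFibre ψ₂ φ₁ ψ₁)) x y = dy (dy ψ₂) (φ₁ x) (ψ₁ x y) * dy ψ₁ x y ^ 2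
      + dy ψ₂ (φ₁ x) (ψ₁ x y) * dy (dy ψ₁) x y := by
  have h : unc₂ (dy (compFibre ψ₂ φ₁ ψ₁)) =ᶠ[𝓝 (x, y)]
      unc₂ fun s t => dy ψ₂ (φ₁ s) (ψ₁ s t) * dy ψ₁ s t := by
    filter_upwards [eventually_analyticAt_comp hφ₁ hψ₁ hψ₂] with z hz
    exact dy_compFibre hz.2.1 hz.2.2
  rw [dy_congr h]
  have h1 := hasDerivAt_dy (analyticAt_compFibre hφ₁ hψ₁ (analyticAt_dy hψ₂))
  rw [dy_compFibre hψ₁ (analyticAt_dy hψ₂)] at h1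
  refine (h1.mul (hasDerivAt_dy (analyticAt_dy hψ₁))).deriv.trans ?_
  simp only [compFibre]
  ring

theorem dx_dy_compFibre :
    dx (dy (compFibre ψ₂ φ₁ ψ₁)) x y = (dx (dy ψ₂) (φ₁ x) (ψ₁ x y) * deriv φ₁ x
      + dy (dy ψ₂) (φ₁ x) (ψ₁ x y) * dx ψ₁ x y) * dy ψ₁ x y
      + dy ψ₂ (φ₁ x) (ψ₁ x y) * dx (dy ψ₁) x y := by
  have h : unc₂ (dy (compFibre ψ₂ φ₁ ψ₁)) =ᶠ[𝓝 (x, y)]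
      unc₂ fun s t => dy ψ₂ (φ₁ s) (ψ₁ s t) * dy ψ₁ s t := by
    filter_upwards [eventually_analyticAt_comp hφ₁ hψ₁ hψ₂] with z hz
    exact dy_compFibre hz.2.1 hz.2.2
  rw [dx_congr h]
  have h1 := hasDerivAt_dx (analyticAt_compFibre hφ₁ hψ₁ (analyticAt_dy hψ₂))
  rw [dx_compFibre hφ₁ hψ₁ (analyticAt_dy hψ₂)] at h1
  exact (h1.mul (hasDerivAt_dx (analyticAt_dy hψ₁))).deriv

theorem dx_dx_compFibre :
    dx (dx (compFibre ψ₂ φ₁ ψ₁)) x y = (dx (dx ψ₂) (φ₁ x) (ψ₁ x y) * deriv φ₁ x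
      + dx (dy ψ₂) (φ₁ x) (ψ₁ x y) * dx ψ₁ x y) * deriv φ₁ x
      + dx ψ₂ (φ₁ x) (ψ₁ x y) * deriv (deriv φ₁) x
      + (dx (dy ψ₂) (φ₁ x) (ψ₁ x y) * deriv φ₁ x
      + dy (dy ψ₂) (φ₁ x) (ψ₁ x y) * dx ψ₁ x y) * dx ψ₁ x y
      + dy ψ₂ (φ₁ x) (ψ₁ x y) * dx (dx ψ₁) x y := by
  have h : unc₂ (dx (compFibre ψ₂ φ₁ ψ₁)) =ᶠ[𝓝 (x, y)]
      unc₂ fun s t => dx ψ₂ (φ₁ s) (ψ₁ s t) * deriv φ₁ s + dy ψ₂ (φ₁ s) (ψ₁ s t) * dx ψ₁ s t := by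
    filter_upwards [eventually_analyticAt_comp hφ₁ hψ₁ hψ₂] with z hz
    exact dx_compFibre hz.1 hz.2.1 hz.2.2
  rw [dx_congr h]
  have h1 := hasDerivAt_dx (analyticAt_compFibre hφ₁ hψ₁ (analyticAt_dy hψ₂))
  rw [dx_compFibre hφ₁ hψ₁ (analyticAt_dy hψ₂)] at h1
  have h2 := hasDerivAt_dx (analyticAt_compFibre hφ₁ hψ₁ (analyticAt_dx hψ₂))
  rw [dx_compFibre hφ₁ hψ₁ (analyticAt_dx hψ₂), dx_dy_comm hψ₂] at h2
  have h3 := ((h2.mul (hasDerivAt_deriv hφ₁.deriv)).add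
    (h1.mul (hasDerivAt_dx (analyticAt_dx hψ₁)))).deriv
  refine h3.trans ?_
  simp only [compFibre]
  ring

variable (hφ₂ : AnalyticAt ℝ φ₂ (φ₁ x)) (h₁ : deriv φ₁ x ≠ 0) (h₂ : deriv φ₂ (φ₁ x) ≠ 0)

include hφ₂ h₁ h₂

theorem prolongP_comp (p : ℝ) :
    prolongP (fun t => φ₂ (φ₁ t)) (compFibre ψ₂ φ₁ ψ₁) x y p
      = prolongP φ₂ ψ₂ (φ₁ x) (ψ₁ x y) (prolongP φ₁ ψ₁ x y p) := by
  simp only [prolongP, (deriv_comp_eventually hφ₁ hφ₂).eq_of_nhds, dx_compFibre hφ₁ hψ₁ hψ₂,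
    dy_compFibre hψ₁ hψ₂]
  field_simp
  ring

/-- Functoriality of the second prolongation. Together with `prolongP_comp` it gives composition and
inversion of maps between equations without any further chain rule. -/
theorem prolongQ_comp (p r : ℝ) :
    prolongQ (fun t => φ₂ (φ₁ t)) (compFibre ψ₂ φ₁ ψ₁) x y p r
      = prolongQ φ₂ ψ₂ (φ₁ x) (ψ₁ x y) (prolongP φ₁ ψ₁ x y p) (prolongQ φ₁ ψ₁ x y p r) := by
  simp only [prolongP, prolongQ, (deriv_comp_eventually hφ₁ hφ₂).eq_of_nhds,
    dx_compFibre hφ₁ hψ₁ hψ₂, dy_compFibre hψ₁ hψ₂, deriv_deriv_comp hφ₁ hφ₂,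
    dx_dx_compFibre hφ₁ hψ₁ hψ₂, dx_dy_compFibre hφ₁ hψ₁ hψ₂, dy_dy_compFibre hφ₁ hψ₁ hψ₂]
  field_simp
  ring

theorem MapsODEAt.comp {J K L : ℝ → ℝ → ℝ → ℝ} {p : ℝ} (hJK : MapsODEAt φ₁ ψ₁ J K x y p)
    (hKL : MapsODEAt φ₂ ψ₂ K L (φ₁ x) (ψ₁ x y) (prolongP φ₁ ψ₁ x y p)) :
    MapsODEAt (fun t => φ₂ (φ₁ t)) (compFibre ψ₂ φ₁ ψ₁) J L x y p := by
  unfold MapsODEAt at *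
  rw [prolongQ_comp hφ₁ hψ₁ hψ₂ hφ₂ h₁ h₂, prolongP_comp hφ₁ hψ₁ hψ₂ hφ₂ h₁ h₂, hJK, hKL]
  rfl

variable (hφ : ∀ᶠ t in 𝓝 x, φ₂ (φ₁ t) = t)
  (hψ : ∀ᶠ z : ℝ × ℝ in 𝓝 (x, y), ψ₂ (φ₁ z.1) (ψ₁ z.1 z.2) = z.2)

include hφ hψ

theorem prolongP_of_leftInverse (p : ℝ) :
    prolongP φ₂ ψ₂ (φ₁ x) (ψ₁ x y) (prolongP φ₁ ψ₁ x y p) = p := by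
  rw [← prolongP_comp hφ₁ hψ₁ hψ₂ hφ₂ h₁ h₂, prolongP_congr (φ' := fun t => t)
    (ψ' := fun _ t => t) (ψ := compFibre ψ₂ φ₁ ψ₁) hφ hψ,
    prolongP_id]

/-- The composite of the two maps is the identity as a germ, whose prolongation is trivial;
functoriality then solves for the prolongation of the inverse. -/
theorem MapsODEAt.of_leftInverse {J K : ℝ → ℝ → ℝ → ℝ} {p : ℝ}
    (hJK : MapsODEAt φ₁ ψ₁ J K x y p) :
    MapsODEAt φ₂ ψ₂ K J (φ₁ x) (ψ₁ x y) (prolongP φ₁ ψ₁ x y p) := by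
  have hx : φ₂ (φ₁ x) = x := hφ.self_of_nhds
  have hy : ψ₂ (φ₁ x) (ψ₁ x y) = y := hψ.self_of_nhds
  unfold MapsODEAt at *
  rw [← hJK, prolongP_of_leftInverse hφ₁ hψ₁ hψ₂ hφ₂ h₁ h₂ hφ hψ, hx, hy,
    ← prolongQ_comp hφ₁ hψ₁ hψ₂ hφ₂ h₁ h₂, prolongQ_congr (φ' := fun t => t)
    (ψ' := fun _ t => t) (ψ := compFibre ψ₂ φ₁ ψ₁) hφ hψ,
    prolongQ_id]

end Comp

/-- A local analytic inverse of a fibre-preserving map exists. -/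
theorem exists_localInverse (hφ : AnalyticAt ℝ φ x) (hψ : AnalyticAt ℝ (unc₂ ψ) (x, y))
    (h₁ : deriv φ x ≠ 0) (h₂ : dy ψ x y ≠ 0) :
    ∃ (θ : ℝ → ℝ) (χ : ℝ → ℝ → ℝ), AnalyticAt ℝ θ (φ x) ∧ AnalyticAt ℝ (unc₂ χ) (φ x, ψ x y) ∧
      (∀ᶠ t in 𝓝 x, θ (φ t) = t) ∧ (∀ᶠ t in 𝓝 (φ x), φ (θ t) = t) ∧
      (∀ᶠ z : ℝ × ℝ in 𝓝 (x, y), χ (φ z.1) (ψ z.1 z.2) = z.2) ∧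
      (∀ᶠ z : ℝ × ℝ in 𝓝 (φ x, ψ x y), ψ (θ z.1) (χ z.1 z.2) = z.2) := by
  -- The base component of the inverse has to depend on one variable, so φ is inverted on its own.
  -- The planar inverse `I` supplies only the fibre component.
  set θ := hφ.hasStrictDerivAt.localInverse _ _ _ h₁ with hθ
  have hθl : ∀ᶠ t in 𝓝 x, θ (φ t) = t :=
    HasStrictFDerivAt.eventually_left_inverse _
  have hθr : ∀ᶠ t in 𝓝 (φ x), φ (θ t) = t :=
    HasStrictFDerivAt.eventually_right_inverse _
  set Φ : ℝ × ℝ → ℝ × ℝ := fun z => (φ z.1, unc₂ ψ z) with hΦ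
  have hΦa : AnalyticAt ℝ Φ (x, y) := (analyticAt_base hφ).prod hψ
  set a := deriv φ x
  set b := dx ψ x y with hb
  set c := dy ψ x y with hc
  let L : ℝ × ℝ →L[ℝ] ℝ × ℝ := (a • ContinuousLinearMap.fst ℝ ℝ ℝ).prod
    (b • ContinuousLinearMap.fst ℝ ℝ ℝ + c • ContinuousLinearMap.snd ℝ ℝ ℝ)
  -- The inverse of the triangular Jacobian with rows (a, 0) and (b, c).
  let M : ℝ × ℝ →L[ℝ] ℝ × ℝ := (a⁻¹ • ContinuousLinearMap.fst ℝ ℝ ℝ).prod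
    (c⁻¹ • (ContinuousLinearMap.snd ℝ ℝ ℝ - (b * a⁻¹) • ContinuousLinearMap.fst ℝ ℝ ℝ))
  let e : (ℝ × ℝ) ≃L[ℝ] (ℝ × ℝ) := ContinuousLinearEquiv.equivOfInverse L M
    (by intro z; ext <;> simp [L, M] <;> field_simp; ring)
    (by intro z; ext <;> simp [L, M] <;> field_simp; ring)
  have hL : HasFDerivAt Φ (e : ℝ × ℝ →L[ℝ] ℝ × ℝ) (x, y) := by
    have h1 : HasFDerivAt (fun z : ℝ × ℝ => φ z.1) (a • ContinuousLinearMap.fst ℝ ℝ ℝ) (x, y) :=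
      HasDerivAt.comp_hasFDerivAt (h₂ := φ) (x, y) (hasDerivAt_deriv hφ) hasFDerivAt_fst
    have h2 : HasFDerivAt (unc₂ ψ)
        (b • ContinuousLinearMap.fst ℝ ℝ ℝ + c • ContinuousLinearMap.snd ℝ ℝ ℝ) (x, y) := by
      have h3 := hψ.differentiableAt.hasFDerivAt
      have h4 : b • ContinuousLinearMap.fst ℝ ℝ ℝ + c • ContinuousLinearMap.snd ℝ ℝ ℝ
          = fderiv ℝ (unc₂ ψ) (x, y) := by
        ext
        · have := (hasDerivAt_unc₂_x hψ.differentiableAt).deriv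
          simpa [dirDeriv, hb, dx] using this
        · have := (hasDerivAt_unc₂_y hψ.differentiableAt).deriv
          simpa [dirDeriv, hc, dy] using this
      rw [h4]
      exact h3
    exact h1.prodMk h2
  -- The order `⊤` is analyticity, so the inverse function theorem yields an analytic inverse.
  have hC : ContDiffAt ℝ ⊤ Φ (x, y) := hΦa.contDiffAt
  set I := hC.localInverse hL (by simp) with hI
  have hstrict : HasStrictFDerivAt Φ (e : ℝ × ℝ →L[ℝ] ℝ × ℝ) (x, y) :=
    hC.hasStrictFDerivAt' hL (by simp)
  have hIl : ∀ᶠ z in 𝓝 (x, y), I (Φ z) = z := hstrict.eventually_left_inverse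
  have hIr : ∀ᶠ z in 𝓝 (Φ (x, y)), Φ (I z) = z := hstrict.eventually_right_inverse
  have hIa : AnalyticAt ℝ I (Φ (x, y)) := by
    have := hC.to_localInverse hL (by simp)
    exact this.analyticAt
  have hI0 : I (Φ (x, y)) = (x, y) := hIl.self_of_nhds
  refine ⟨θ, fun s t => (I (s, t)).2, hφ.analyticAt_localInverse h₁,
    analyticAt_snd.comp hIa, hθl, hθr, ?_, ?_⟩
  · filter_upwards [hIl] with z hz
    exact congrArg Prod.snd hz
  -- The first component of `I` stays near x, where θ inverts φ; hence it agrees with θ.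
  · have hI1 : Tendsto (fun z => (I z).1) (𝓝 (Φ (x, y))) (𝓝 x) := by
      have := (analyticAt_fst.comp hIa).continuousAt.tendsto
      simpa [Function.comp_def, hI0] using this
    filter_upwards [hIr, hI1.eventually hθl] with z hz hz'
    have h1 : φ (I z).1 = z.1 := congrArg Prod.fst hz
    have h2 : ψ (I z).1 (I z).2 = z.2 := congrArg Prod.snd hz
    rw [h1] at hz'
    rw [hz']
    exact h2

theorem deriv_ne_zero_of_leftInverse {θ : ℝ → ℝ} (hφ : AnalyticAt ℝ φ x)
    (hθ : AnalyticAt ℝ θ (φ x)) (h : ∀ᶠ t in 𝓝 x, θ (φ t) = t) : deriv θ (φ x) ≠ 0 := by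
  have h1 := (deriv_comp_eventually hφ hθ).eq_of_nhds
  have h2 : deriv (fun t => θ (φ t)) x = 1 := by
    rw [EventuallyEq.deriv_eq (f := fun t => t) h]
    simp
  intro h0
  simp [h2, h0] at h1

theorem dy_ne_zero_of_leftInverse {χ : ℝ → ℝ → ℝ} (hψ : AnalyticAt ℝ (unc₂ ψ) (x, y))
    (hχ : AnalyticAt ℝ (unc₂ χ) (φ x, ψ x y))
    (h : ∀ᶠ z : ℝ × ℝ in 𝓝 (x, y), χ (φ z.1) (ψ z.1 z.2) = z.2) : dy χ (φ x) (ψ x y) ≠ 0 := by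
  have h1 := dy_compFibre hψ hχ
  have h2 : dy (compFibre χ φ ψ) x y = 1 := by
    rw [dy_congr (f := compFibre χ φ ψ) (g := fun _ t => t) h]
    simp [dy]
  intro h0
  simp [h2, h0] at h1

theorem analyticAt_jet_y {A B C : Type*} [NormedAddCommGroup A] [NormedSpace ℝ A]
    [NormedAddCommGroup B] [NormedSpace ℝ B] [NormedAddCommGroup C] [NormedSpace ℝ C]
    {q : A × B × C} : AnalyticAt ℝ (fun z : A × B × C => z.2.1) q :=
  AnalyticAt.fun_comp (f := fun z : A × B × C => z.2) (g := Prod.fst) analyticAt_fst analyticAt_snd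

theorem analyticAt_jet_p {A B C : Type*} [NormedAddCommGroup A] [NormedSpace ℝ A]
    [NormedAddCommGroup B] [NormedSpace ℝ B] [NormedAddCommGroup C] [NormedSpace ℝ C]
    {q : A × B × C} : AnalyticAt ℝ (fun z : A × B × C => z.2.2) q :=
  AnalyticAt.fun_comp (f := fun z : A × B × C => z.2) (g := Prod.snd) analyticAt_snd analyticAt_snd

/-- The first prolongation is analytic. -/
theorem analyticAt_prolongP (hφ : AnalyticAt ℝ φ x) (hψ : AnalyticAt ℝ (unc₂ ψ) (x, y))
    (h₁ : deriv φ x ≠ 0) (p : ℝ) : AnalyticAt ℝ (unc₃ (prolongP φ ψ)) (x, y, p) := by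
  have hπ : AnalyticAt ℝ (fun z : ℝ × ℝ × ℝ => (z.1, z.2.1)) (x, y, p) :=
    analyticAt_fst.prod analyticAt_jet_y
  have a1 : AnalyticAt ℝ (fun z : ℝ × ℝ × ℝ => dx ψ z.1 z.2.1) (x, y, p) :=
    AnalyticAt.fun_comp (f := fun z : ℝ × ℝ × ℝ => (z.1, z.2.1)) (analyticAt_dx hψ) hπ
  have a2 : AnalyticAt ℝ (fun z : ℝ × ℝ × ℝ => dy ψ z.1 z.2.1) (x, y, p) :=
    AnalyticAt.fun_comp (f := fun z : ℝ × ℝ × ℝ => (z.1, z.2.1)) (analyticAt_dy hψ) hπ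
  have a3 : AnalyticAt ℝ (fun z : ℝ × ℝ × ℝ => deriv φ z.1) (x, y, p) :=
    AnalyticAt.fun_comp (f := fun z : ℝ × ℝ × ℝ => z.1) (x := (x, y, p)) hφ.deriv analyticAt_fst
  exact (a1.add (a2.mul analyticAt_jet_p)).div a3 h₁

/-- The first prolongation of a fibre-preserving map, as a map of jet spaces. -/
def prolongMap (φ : ℝ → ℝ) (ψ : ℝ → ℝ → ℝ) (z : ℝ × ℝ × ℝ) : ℝ × ℝ × ℝ :=
  (φ z.1, ψ z.1 z.2.1, prolongP φ ψ z.1 z.2.1 z.2.2)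

theorem continuousAt_prolongMap (hφ : AnalyticAt ℝ φ x) (hψ : AnalyticAt ℝ (unc₂ ψ) (x, y))
    (h₁ : deriv φ x ≠ 0) (p : ℝ) : ContinuousAt (prolongMap φ ψ) (x, y, p) := by
  have hπ : ContinuousAt (fun z : ℝ × ℝ × ℝ => (z.1, z.2.1)) (x, y, p) := by fun_prop
  have c1 : ContinuousAt (fun z : ℝ × ℝ × ℝ => φ z.1) (x, y, p) :=
    ContinuousAt.comp (f := fun z : ℝ × ℝ × ℝ => z.1) (x := (x, y, p)) hφ.continuousAt
      continuousAt_fst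
  have c2 : ContinuousAt (fun z : ℝ × ℝ × ℝ => ψ z.1 z.2.1) (x, y, p) :=
    ContinuousAt.comp (f := fun z : ℝ × ℝ × ℝ => (z.1, z.2.1)) (x := (x, y, p)) (g := unc₂ ψ)
      hψ.continuousAt hπ
  exact c1.prodMk (c2.prodMk (analyticAt_prolongP hφ hψ h₁ p).continuousAt)

/-- A property of the two-dimensional base holding near a point holds near every jet over it. -/
theorem eventually_jet {P : ℝ × ℝ → Prop} (h : ∀ᶠ z in 𝓝 (x, y), P z) (p : ℝ) :
    ∀ᶠ z : ℝ × ℝ × ℝ in 𝓝 (x, y, p), P (z.1, z.2.1) := by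
  have hπ : ContinuousAt (fun z : ℝ × ℝ × ℝ => (z.1, z.2.1)) (x, y, p) := by fun_prop
  exact hπ.eventually h

/-- A local inverse of a fibre-preserving map sends the image equation back. -/
theorem eventually_mapsODEAt_inverse {J K : ℝ → ℝ → ℝ → ℝ} {x₀ y₀ p₀ : ℝ} {θ : ℝ → ℝ}
    {χ : ℝ → ℝ → ℝ} (hφ : AnalyticAt ℝ φ x₀) (hψ : AnalyticAt ℝ (unc₂ ψ) (x₀, y₀))
    (h₁ : deriv φ x₀ ≠ 0)
    (hm : ∀ᶠ z : ℝ × ℝ × ℝ in 𝓝 (x₀, y₀, p₀), MapsODEAt φ ψ J K z.1 z.2.1 z.2.2)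
    (hθ : AnalyticAt ℝ θ (φ x₀)) (hχ : AnalyticAt ℝ (unc₂ χ) (φ x₀, ψ x₀ y₀))
    (hθl : ∀ᶠ t in 𝓝 x₀, θ (φ t) = t) (hθr : ∀ᶠ t in 𝓝 (φ x₀), φ (θ t) = t)
    (hχl : ∀ᶠ z : ℝ × ℝ in 𝓝 (x₀, y₀), χ (φ z.1) (ψ z.1 z.2) = z.2)
    (hχr : ∀ᶠ z : ℝ × ℝ in 𝓝 (φ x₀, ψ x₀ y₀), ψ (θ z.1) (χ z.1 z.2) = z.2) :
    ∀ᶠ z : ℝ × ℝ × ℝ in 𝓝 (φ x₀, ψ x₀ y₀, prolongP φ ψ x₀ y₀ p₀),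
      MapsODEAt θ χ K J z.1 z.2.1 z.2.2 := by
  have hθ' := deriv_ne_zero_of_leftInverse hφ hθ hθl
  have hθ0 : θ (φ x₀) = x₀ := hθl.self_of_nhds
  have hχ0 : χ (φ x₀) (ψ x₀ y₀) = y₀ := hχl.self_of_nhds
  have hP0 : prolongP θ χ (φ x₀) (ψ x₀ y₀) (prolongP φ ψ x₀ y₀ p₀) = p₀ :=
    prolongP_of_leftInverse hφ hψ hχ hθ h₁ hθ' hθl hχl p₀
  have hφ' : AnalyticAt ℝ φ (θ (φ x₀)) := by rwa [hθ0]
  have hψ' : AnalyticAt ℝ (unc₂ ψ) (θ (φ x₀), χ (φ x₀) (ψ x₀ y₀)) := by rwa [hθ0, hχ0]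
  have h₁' : deriv φ (θ (φ x₀)) ≠ 0 := by rwa [hθ0]
  -- The pointwise inversion statement holds at jets near the source. Continuity of the inverse
  -- prolongation (`cont`) pulls it back to jets near the target, and `back` identifies its image
  -- points with them.
  have good : ∀ᶠ z : ℝ × ℝ × ℝ in 𝓝 (x₀, y₀, p₀), AnalyticAt ℝ φ z.1 ∧
      AnalyticAt ℝ (unc₂ ψ) (z.1, z.2.1) ∧ AnalyticAt ℝ (unc₂ χ) (φ z.1, ψ z.1 z.2.1) ∧
      AnalyticAt ℝ θ (φ z.1) ∧ deriv φ z.1 ≠ 0 ∧ deriv θ (φ z.1) ≠ 0 ∧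
      (∀ᶠ t in 𝓝 z.1, θ (φ t) = t) ∧
      (∀ᶠ w : ℝ × ℝ in 𝓝 (z.1, z.2.1), χ (φ w.1) (ψ w.1 w.2) = w.2) ∧
      MapsODEAt φ ψ J K z.1 z.2.1 z.2.2 := by
    have g1 := eventually_jet (eventually_analyticAt_comp hφ hψ hχ) p₀
    have c1 : ContinuousAt (fun z : ℝ × ℝ × ℝ => z.1) (x₀, y₀, p₀) := continuousAt_fst
    have g2 := c1.eventually (hφ.continuousAt.eventually hθ.eventually_analyticAt)
    have g3 := c1.eventually (hφ.deriv.continuousAt.eventually_ne h₁)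
    have g4 := c1.eventually (hφ.continuousAt.eventually (hθ.deriv.continuousAt.eventually_ne hθ'))
    have g5 := c1.eventually hθl.eventually_nhds
    have g6 := eventually_jet hχl.eventually_nhds p₀
    filter_upwards [g1, g2, g3, g4, g5, g6, hm] with z e1 e2 e3 e4 e5 e6 e7
    exact ⟨e1.1, e1.2.1, e1.2.2, e2, e3, e4, e5, e6, e7⟩
  have cont : Tendsto (prolongMap θ χ) (𝓝 (φ x₀, ψ x₀ y₀, prolongP φ ψ x₀ y₀ p₀))
      (𝓝 (x₀, y₀, p₀)) := by
    have := (continuousAt_prolongMap hθ hχ hθ' (prolongP φ ψ x₀ y₀ p₀)).tendsto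
    rwa [prolongMap, hθ0, hχ0, hP0] at this
  have back : ∀ᶠ z in 𝓝 (φ x₀, ψ x₀ y₀, prolongP φ ψ x₀ y₀ p₀),
      prolongMap φ ψ (prolongMap θ χ z) = z := by
    have g1 := eventually_jet (eventually_analyticAt_comp hθ hχ hψ') (prolongP φ ψ x₀ y₀ p₀)
    have c1 : ContinuousAt (fun z : ℝ × ℝ × ℝ => z.1)
      (φ x₀, ψ x₀ y₀, prolongP φ ψ x₀ y₀ p₀) := continuousAt_fst
    have g2 := c1.eventually (hθ.continuousAt.eventually hφ'.eventually_analyticAt)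
    have g3 := c1.eventually (hθ.deriv.continuousAt.eventually_ne hθ')
    have g4 := c1.eventually
      (hθ.continuousAt.eventually (hφ'.deriv.continuousAt.eventually_ne h₁'))
    have g5 := c1.eventually hθr.eventually_nhds
    have g6 := eventually_jet hχr.eventually_nhds (prolongP φ ψ x₀ y₀ p₀)
    filter_upwards [g1, g2, g3, g4, g5, g6] with z e1 e2 e3 e4 e5 e6
    have hP := prolongP_of_leftInverse e1.1 e1.2.1 e1.2.2 e2 e3 e4 e5 e6 z.2.2
    have e5' := e5.self_of_nhds
    have e6' := e6.self_of_nhds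
    simp only [prolongMap] at *
    rw [hP, e5', e6']
  filter_upwards [cont.eventually good, back] with z hz hb
  obtain ⟨e1, e2, e3, e4, e5, e6, e7, e8, e9⟩ := hz
  have := MapsODEAt.of_leftInverse e1 e2 e3 e4 e5 e6 e7 e8 e9
  have b1 : φ (prolongMap θ χ z).1 = z.1 := congrArg Prod.fst hb
  have b2 : ψ (prolongMap θ χ z).1 (prolongMap θ χ z).2.1 = z.2.1 :=
    congrArg (fun w => w.2.1) hb
  have b3 : prolongP φ ψ (prolongMap θ χ z).1 (prolongMap θ χ z).2.1 (prolongMap θ χ z).2.2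
      = z.2.2 := congrArg (fun w => w.2.2) hb
  rwa [b1, b2, b3] at this

theorem FibreEquivalent.symm {J K : ℝ → ℝ → ℝ → ℝ} {x₀ y₀ p₀ x₁ y₁ p₁ : ℝ}
    (h : FibreEquivalent J x₀ y₀ p₀ K x₁ y₁ p₁) : FibreEquivalent K x₁ y₁ p₁ J x₀ y₀ p₀ := by
  obtain ⟨φ, ψ, hφ, hψ, h₁, h₂, rfl, rfl, rfl, hm⟩ := h
  change AnalyticAt ℝ (unc₂ ψ) (x₀, y₀) at hψ
  obtain ⟨θ, χ, hθ, hχ, hθl, hθr, hχl, hχr⟩ := exists_localInverse hφ hψ h₁ h₂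
  have hθ' := deriv_ne_zero_of_leftInverse hφ hθ hθl
  exact ⟨θ, χ, hθ, hχ, hθ', dy_ne_zero_of_leftInverse hψ hχ hχl, hθl.self_of_nhds,
    hχl.self_of_nhds, prolongP_of_leftInverse hφ hψ hχ hθ h₁ hθ' hθl hχl p₀,
    eventually_mapsODEAt_inverse hφ hψ h₁ hm hθ hχ hθl hθr hχl hχr⟩

theorem FibreEquivalent.trans {J K L : ℝ → ℝ → ℝ → ℝ} {x₀ y₀ p₀ x₁ y₁ p₁ x₂ y₂ p₂ : ℝ}
    (h : FibreEquivalent J x₀ y₀ p₀ K x₁ y₁ p₁) (h' : FibreEquivalent K x₁ y₁ p₁ L x₂ y₂ p₂) :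
    FibreEquivalent J x₀ y₀ p₀ L x₂ y₂ p₂ := by
  obtain ⟨φ₁, ψ₁, hφ₁, hψ₁, h₁, k₁, rfl, rfl, rfl, hm₁⟩ := h
  obtain ⟨φ₂, ψ₂, hφ₂, hψ₂, h₂, k₂, rfl, rfl, rfl, hm₂⟩ := h'
  change AnalyticAt ℝ (unc₂ ψ₁) _ at hψ₁
  change AnalyticAt ℝ (unc₂ ψ₂) _ at hψ₂
  refine ⟨fun t => φ₂ (φ₁ t), compFibre ψ₂ φ₁ ψ₁, AnalyticAt.fun_comp hφ₂ hφ₁,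
    analyticAt_compFibre hφ₁ hψ₁ hψ₂, ?_, ?_, rfl, rfl,
    prolongP_comp hφ₁ hψ₁ hψ₂ hφ₂ h₁ h₂ p₀, ?_⟩
  · rw [(deriv_comp_eventually hφ₁ hφ₂).eq_of_nhds]
    exact mul_ne_zero h₂ h₁
  · rw [dy_compFibre hψ₁ hψ₂]
    exact mul_ne_zero k₂ k₁
  · have g1 := eventually_jet (eventually_analyticAt_comp hφ₁ hψ₁ hψ₂) p₀
    have c1 : ContinuousAt (fun z : ℝ × ℝ × ℝ => z.1) (x₀, y₀, p₀) := continuousAt_fst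
    have g2 := c1.eventually (hφ₁.continuousAt.eventually hφ₂.eventually_analyticAt)
    have g3 := c1.eventually (hφ₁.deriv.continuousAt.eventually_ne h₁)
    have g4 := c1.eventually
      (hφ₁.continuousAt.eventually (hφ₂.deriv.continuousAt.eventually_ne h₂))
    have g5 := (continuousAt_prolongMap hφ₁ hψ₁ h₁ p₀).eventually hm₂
    filter_upwards [g1, g2, g3, g4, g5, hm₁] with z e1 e2 e3 e4 e5 e6
    exact MapsODEAt.comp e1.1 e1.2.1 e1.2.2 e2 e3 e4 e6 e5

theorem FibreEquivalent.congr_right {J K K' : ℝ → ℝ → ℝ → ℝ} {x₀ y₀ p₀ x₁ y₁ p₁ : ℝ}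
    (h : FibreEquivalent J x₀ y₀ p₀ K x₁ y₁ p₁)
    (hK : ∀ᶠ z : ℝ × ℝ × ℝ in 𝓝 (x₁, y₁, p₁), K z.1 z.2.1 z.2.2 = K' z.1 z.2.1 z.2.2) :
    FibreEquivalent J x₀ y₀ p₀ K' x₁ y₁ p₁ := by
  refine h.trans ⟨fun t => t, fun _ t => t, analyticAt_id, analyticAt_snd, by simp, by simp [dy],
    rfl, rfl, prolongP_id _, ?_⟩
  filter_upwards [hK] with z hz
  rw [MapsODEAt, prolongQ_id, prolongP_id, hz]

theorem FibreEquivalent.refl (J : ℝ → ℝ → ℝ → ℝ) (x₀ y₀ p₀ : ℝ) :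
    FibreEquivalent J x₀ y₀ p₀ J x₀ y₀ p₀ := by
  refine ⟨fun t => t, fun _ t => t, analyticAt_id, analyticAt_snd, by simp, by simp [dy],
    rfl, rfl, prolongP_id _, Eventually.of_forall fun z => ?_⟩
  rw [MapsODEAt, prolongQ_id, prolongP_id]

end Prolongation

/-! ### Families of maps depending analytically on a parameter. -/

section Families

variable {A : Type*} [NormedAddCommGroup A] [NormedSpace ℝ A]

/-- A family of functions of one variable as a function of the parameter and the variable. -/
def fam₁ (φ : A → ℝ → ℝ) (z : A × ℝ) : ℝ := φ z.1 z.2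

/-- A family of functions of two variables as a function of the parameter and the variables. -/
def fam₂ (ψ : A → ℝ → ℝ → ℝ) (z : A × ℝ × ℝ) : ℝ := ψ z.1 z.2.1 z.2.2

variable {φ : A → ℝ → ℝ} {ψ : A → ℝ → ℝ → ℝ} {a : A} {x y p : ℝ}

theorem analyticAt_of_fam₁ (h : AnalyticAt ℝ (fam₁ φ) (a, x)) : AnalyticAt ℝ (φ a) x :=
  AnalyticAt.fun_comp (f := fun t : ℝ => (a, t)) h (analyticAt_const.prod analyticAt_id)

theorem analyticAt_of_fam₂ (h : AnalyticAt ℝ (fam₂ ψ) (a, x, y)) :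
    AnalyticAt ℝ (unc₂ (ψ a)) (x, y) :=
  AnalyticAt.fun_comp (f := fun t : ℝ × ℝ => (a, t)) h (analyticAt_const.prod analyticAt_id)

theorem fam₁_deriv {q : A × ℝ} (h : AnalyticAt ℝ (fam₁ φ) q) :
    fam₁ (fun a => deriv (φ a)) =ᶠ[𝓝 q] dirDeriv (0, 1) (fam₁ φ) := by
  filter_upwards [h.eventually_analyticAt] with w hw
  have h1 : HasDerivAt (fun t : ℝ => (w.1, t)) (0, 1) w.2 :=
    (hasDerivAt_const w.2 w.1).prodMk (hasDerivAt_id w.2)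
  exact (hw.differentiableAt.hasFDerivAt.comp_hasDerivAt w.2 h1).deriv

theorem fam₂_dx {q : A × ℝ × ℝ} (h : AnalyticAt ℝ (fam₂ ψ) q) :
    fam₂ (fun a => dx (ψ a)) =ᶠ[𝓝 q] dirDeriv (0, 1, 0) (fam₂ ψ) := by
  filter_upwards [h.eventually_analyticAt] with w hw
  have h1 : HasDerivAt (fun t : ℝ => (w.1, t, w.2.2)) (0, 1, 0) w.2.1 :=
    (hasDerivAt_const w.2.1 w.1).prodMk
      ((hasDerivAt_id w.2.1).prodMk (hasDerivAt_const w.2.1 w.2.2))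
  exact (hw.differentiableAt.hasFDerivAt.comp_hasDerivAt w.2.1 h1).deriv

theorem fam₂_dy {q : A × ℝ × ℝ} (h : AnalyticAt ℝ (fam₂ ψ) q) :
    fam₂ (fun a => dy (ψ a)) =ᶠ[𝓝 q] dirDeriv (0, 0, 1) (fam₂ ψ) := by
  filter_upwards [h.eventually_analyticAt] with w hw
  have h1 : HasDerivAt (fun t : ℝ => (w.1, w.2.1, t)) (0, 0, 1) w.2.2 :=
    (hasDerivAt_const w.2.2 w.1).prodMk
      ((hasDerivAt_const w.2.2 w.2.1).prodMk (hasDerivAt_id w.2.2))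
  exact (hw.differentiableAt.hasFDerivAt.comp_hasDerivAt w.2.2 h1).deriv

theorem analyticAt_fam₁_deriv {q : A × ℝ} (h : AnalyticAt ℝ (fam₁ φ) q) :
    AnalyticAt ℝ (fam₁ fun a => deriv (φ a)) q :=
  (analyticAt_dirDeriv _ h).congr (fam₁_deriv h).symm

theorem analyticAt_fam₂_dx {q : A × ℝ × ℝ} (h : AnalyticAt ℝ (fam₂ ψ) q) :
    AnalyticAt ℝ (fam₂ fun a => dx (ψ a)) q :=
  (analyticAt_dirDeriv _ h).congr (fam₂_dx h).symm

theorem analyticAt_fam₂_dy {q : A × ℝ × ℝ} (h : AnalyticAt ℝ (fam₂ ψ) q) :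
    AnalyticAt ℝ (fam₂ fun a => dy (ψ a)) q :=
  (analyticAt_dirDeriv _ h).congr (fam₂_dy h).symm

theorem continuousAt_fam_prolongP (hφ : AnalyticAt ℝ (fam₁ φ) (a, x))
    (hψ : AnalyticAt ℝ (fam₂ ψ) (a, x, y)) (h₁ : deriv (φ a) x ≠ 0) :
    ContinuousAt (fun z : A × ℝ × ℝ × ℝ => prolongP (φ z.1) (ψ z.1) z.2.1 z.2.2.1 z.2.2.2)
      (a, x, y, p) := by
  have hπ : ContinuousAt (fun z : A × ℝ × ℝ × ℝ => (z.1, z.2.1, z.2.2.1)) (a, x, y, p) := by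
    fun_prop
  have hπ' : ContinuousAt (fun z : A × ℝ × ℝ × ℝ => (z.1, z.2.1)) (a, x, y, p) := by
    fun_prop
  have c1 := ContinuousAt.comp (x := (a, x, y, p)) (analyticAt_fam₂_dx hψ).continuousAt hπ
  have c2 := ContinuousAt.comp (x := (a, x, y, p)) (analyticAt_fam₂_dy hψ).continuousAt hπ
  have c3 := ContinuousAt.comp (x := (a, x, y, p)) (analyticAt_fam₁_deriv hφ).continuousAt hπ'
  have c4 : ContinuousAt (fun z : A × ℝ × ℝ × ℝ => z.2.2.2) (a, x, y, p) := by fun_prop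
  exact (c1.add (c2.mul c4)).div c3 h₁

end Families

/-! ### Transport of a symmetry group along an equivalence. -/

section Transport

variable {n : ℕ}

/-- The map of the base given by a group element. -/
def FibreSymmetryAction.act {G : LocalLieGroup n} {K : ℝ → ℝ → ℝ → ℝ} {x₀ y₀ p₀ : ℝ}
    (S : FibreSymmetryAction G K x₀ y₀ p₀) (z : (Fin n → ℝ) × ℝ × ℝ) : ℝ × ℝ :=
  (S.φ z.1 z.2.1, S.ψ z.1 z.2.1 z.2.2)

theorem FibreSymmetryAction.analyticAt_act {G : LocalLieGroup n} {K : ℝ → ℝ → ℝ → ℝ}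
    {x₀ y₀ p₀ : ℝ} (S : FibreSymmetryAction G K x₀ y₀ p₀) :
    AnalyticAt ℝ S.act (0, x₀, y₀) := by
  have h : AnalyticAt ℝ (fun z : (Fin n → ℝ) × ℝ × ℝ => (z.1, z.2.1)) (0, x₀, y₀) :=
    analyticAt_fst.prod analyticAt_jet_y
  exact (AnalyticAt.fun_comp (f := fun z : (Fin n → ℝ) × ℝ × ℝ => (z.1, z.2.1))
    S.analyticAt_φ h).prod S.analyticAt_ψ

/-- Conjugation: with Φ the equivalence and Ψ its local inverse, the same group acts by Ψ ∘ a ∘ Φ.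
The work lies in staying inside the neighbourhoods where these germs are defined and inverse to each
other. -/
theorem AdmitsSymmetryGroup.of_fibreEquivalent {J K : ℝ → ℝ → ℝ → ℝ} {x₀ y₀ p₀ x₁ y₁ p₁ : ℝ}
    (h : FibreEquivalent J x₀ y₀ p₀ K x₁ y₁ p₁) (hK : AdmitsSymmetryGroup n K x₁ y₁ p₁) :
    AdmitsSymmetryGroup n J x₀ y₀ p₀ := by
  obtain ⟨φ, ψ, hφ, hψ, h₁, h₂, rfl, rfl, hp₁, hm⟩ := h
  obtain ⟨G, ⟨S⟩⟩ := hK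
  change AnalyticAt ℝ (unc₂ ψ) (x₀, y₀) at hψ
  obtain ⟨θ, χ, hθ, hχ, hθl, hθr, hχl, hχr⟩ := exists_localInverse hφ hψ h₁ h₂
  have hθ' := deriv_ne_zero_of_leftInverse hφ hθ hθl
  have hinv := eventually_mapsODEAt_inverse hφ hψ h₁ hm hθ hχ hθl hθr hχl hχr
  rw [hp₁] at hinv
  set Φ : ℝ × ℝ → ℝ × ℝ := fun z => (φ z.1, ψ z.1 z.2) with hΦ
  set Ψ : ℝ × ℝ → ℝ × ℝ := fun z => (θ z.1, χ z.1 z.2) with hΨ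
  have hΦa : AnalyticAt ℝ Φ (x₀, y₀) := (analyticAt_base hφ).prod hψ
  have hΨa : AnalyticAt ℝ Ψ (φ x₀, ψ x₀ y₀) := (analyticAt_base hθ).prod hχ
  have hΨΦ : ∀ᶠ z in 𝓝 (x₀, y₀), Ψ (Φ z) = z := by
    have c1 : ContinuousAt (fun z : ℝ × ℝ => z.1) (x₀, y₀) := continuousAt_fst
    filter_upwards [c1.eventually hθl, hχl] with z h1 h2
    exact Prod.ext h1 h2
  have hΦΨ : ∀ᶠ z in 𝓝 (φ x₀, ψ x₀ y₀), Φ (Ψ z) = z := by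
    have c1 : ContinuousAt (fun z : ℝ × ℝ => z.1) (φ x₀, ψ x₀ y₀) := continuousAt_fst
    filter_upwards [c1.eventually hθr, hχr] with z h1 h2
    refine Prod.ext h1 h2
  have hone : ∀ᶠ z in 𝓝 (φ x₀, ψ x₀ y₀), S.act (0, z) = z :=
    S.one_act.mono fun z hz => Prod.ext hz.1 hz.2
  have hone0 : S.act (0, φ x₀, ψ x₀ y₀) = (φ x₀, ψ x₀ y₀) := hone.self_of_nhds
  have hφ0 : S.φ 0 (φ x₀) = φ x₀ := congrArg Prod.fst hone0
  have hψ0 : S.ψ 0 (φ x₀) (ψ x₀ y₀) = ψ x₀ y₀ := congrArg Prod.snd hone0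
  have hF : AnalyticAt ℝ (fun z : (Fin n → ℝ) × ℝ × ℝ => S.act (z.1, Φ z.2)) (0, x₀, y₀) := by
    have h : AnalyticAt ℝ (fun z : (Fin n → ℝ) × ℝ × ℝ => (z.1, Φ z.2)) (0, x₀, y₀) :=
      analyticAt_fst.prod (AnalyticAt.fun_comp (f := fun z : (Fin n → ℝ) × ℝ × ℝ => z.2)
        (x := (0, x₀, y₀)) hΦa analyticAt_snd)
    exact AnalyticAt.fun_comp (f := fun z : (Fin n → ℝ) × ℝ × ℝ => (z.1, Φ z.2))
      (x := (0, x₀, y₀)) S.analyticAt_act h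
  have hFc : Tendsto (fun z : (Fin n → ℝ) × ℝ × ℝ => S.act (z.1, Φ z.2)) (𝓝 (0, x₀, y₀))
      (𝓝 (φ x₀, ψ x₀ y₀)) := by
    have := hF.continuousAt.tendsto
    rwa [show S.act (0, Φ (x₀, y₀)) = (φ x₀, ψ x₀ y₀) from hone0] at this
  -- This cancels the inner Φ ∘ Ψ when two conjugated elements are composed, and the outer one when
  -- effectivity is transferred.
  have hback := hFc.eventually hΦΨ
  refine ⟨G, ⟨{
    φ := fun a x => θ (S.φ a (φ x))
    ψ := fun a => compFibre χ (fun x => S.φ a (φ x)) (compFibre (S.ψ a) φ ψ)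
    analyticAt_φ := ?_
    analyticAt_ψ := ?_
    one_act := ?_
    mul_act := ?_
    effective := ?_
    symmetry := ?_ }⟩⟩
  · have h : AnalyticAt ℝ (fun z : (Fin n → ℝ) × ℝ => (z.1, φ z.2)) (0, x₀) :=
      analyticAt_fst.prod (AnalyticAt.fun_comp (f := fun z : (Fin n → ℝ) × ℝ => z.2)
        (x := (0, x₀)) hφ analyticAt_snd)
    have h' := AnalyticAt.fun_comp (f := fun z : (Fin n → ℝ) × ℝ => (z.1, φ z.2))
      (x := (0, x₀)) S.analyticAt_φ h
    exact AnalyticAt.fun_comp (f := fun z : (Fin n → ℝ) × ℝ => S.φ z.1 (φ z.2)) (x := (0, x₀))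
      (by simpa [hφ0] using hθ) h'
  · refine AnalyticAt.fun_comp (f := fun z : (Fin n → ℝ) × ℝ × ℝ => S.act (z.1, Φ z.2))
      (g := unc₂ χ) (x := (0, x₀, y₀)) ?_ hF
    rwa [show S.act (0, Φ (x₀, y₀)) = (φ x₀, ψ x₀ y₀) from hone0]
  · filter_upwards [hΦa.continuousAt.eventually hone, hΨΦ] with z h1 h2
    have h3 : Ψ (S.act (0, Φ z)) = z := by rw [h1, h2]
    exact ⟨congrArg Prod.fst h3, congrArg Prod.snd h3⟩
  · have t1 : Tendsto (fun z : (Fin n → ℝ) × (Fin n → ℝ) × ℝ × ℝ => (z.1, z.2.1, Φ z.2.2))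
        (𝓝 (0, 0, x₀, y₀)) (𝓝 (0, 0, φ x₀, ψ x₀ y₀)) := by
      have hc : ContinuousAt (fun z : (Fin n → ℝ) × (Fin n → ℝ) × ℝ × ℝ => Φ z.2.2)
          (0, 0, x₀, y₀) :=
        ContinuousAt.comp (f := fun z : (Fin n → ℝ) × (Fin n → ℝ) × ℝ × ℝ => z.2.2)
          (x := (0, 0, x₀, y₀)) hΦa.continuousAt (by fun_prop)
      exact (continuousAt_fst.prodMk ((continuousAt_fst.comp continuousAt_snd).prodMk hc)).tendsto
    have t2 : Tendsto (fun z : (Fin n → ℝ) × (Fin n → ℝ) × ℝ × ℝ => z.2)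
        (𝓝 (0, 0, x₀, y₀)) (𝓝 (0, x₀, y₀)) := continuousAt_snd.tendsto
    filter_upwards [t1.eventually S.mul_act, t2.eventually hback] with z h1 h2
    have e1 : φ (θ (S.φ z.2.1 (φ z.2.2.1))) = S.φ z.2.1 (φ z.2.2.1) := congrArg Prod.fst h2
    have e2 : ψ (θ (S.φ z.2.1 (φ z.2.2.1)))
        (χ (S.φ z.2.1 (φ z.2.2.1)) (S.ψ z.2.1 (φ z.2.2.1) (ψ z.2.2.1 z.2.2.2)))
        = S.ψ z.2.1 (φ z.2.2.1) (ψ z.2.2.1 z.2.2.2) := congrArg Prod.snd h2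
    simp only [compFibre]
    rw [e1, e2, h1.1, ← h1.2]
    exact ⟨rfl, rfl⟩
  · filter_upwards [S.effective, hback.curry_nhds] with a ha hb hid
    apply ha
    have hΨc : Tendsto Ψ (𝓝 (φ x₀, ψ x₀ y₀)) (𝓝 (x₀, y₀)) := by
      have := hΨa.continuousAt.tendsto
      rwa [show Ψ (φ x₀, ψ x₀ y₀) = (x₀, y₀) from hΨΦ.self_of_nhds] at this
    filter_upwards [hΦΨ, hΨc.eventually hid, hΨc.eventually hb] with w h1 h2 h3
    have h4 : Ψ (S.act (a, Φ (Ψ w))) = Ψ w := Prod.ext h2.1 h2.2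
    rw [h4, h1] at h3
    exact ⟨(congrArg Prod.fst h3).symm, (congrArg Prod.snd h3).symm⟩
  · have hfφ : AnalyticAt ℝ (fam₁ S.φ) (0, φ x₀) := S.analyticAt_φ
    have hfψ : AnalyticAt ℝ (fam₂ S.ψ) (0, φ x₀, ψ x₀ y₀) := S.analyticAt_ψ
    have hid : S.φ 0 =ᶠ[𝓝 (φ x₀)] fun t => t := by
      have : ∀ᶠ z : ℝ × ℝ in 𝓝 (φ x₀) ×ˢ 𝓝 (ψ x₀ y₀), S.φ 0 z.1 = z.1 := by
        rw [← nhds_prod_eq]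
        exact S.one_act.mono fun z hz => hz.1
      exact this.curry.mono fun t ht => ht.self_of_nhds
    have hid' : unc₂ (S.ψ 0) =ᶠ[𝓝 (φ x₀, ψ x₀ y₀)] unc₂ fun _ t => t :=
      S.one_act.mono fun z hz => hz.2
    have hd0 : deriv (S.φ 0) (φ x₀) = 1 := by rw [hid.deriv_eq]; simp
    have hd0' : deriv (S.φ 0) (φ x₀) ≠ 0 := by rw [hd0]; exact one_ne_zero
    have hP0 : prolongP (S.φ 0) (S.ψ 0) (φ x₀) (ψ x₀ y₀) p₁ = p₁ := by
      rw [prolongP_congr hid hid', prolongP_id]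
    have t0 : Tendsto (fun z : (Fin n → ℝ) × ℝ × ℝ × ℝ => z.2) (𝓝 (0, x₀, y₀, p₀))
      (𝓝 (x₀, y₀, p₀)) := continuousAt_snd.tendsto
    have t1 : Tendsto (fun z : (Fin n → ℝ) × ℝ × ℝ × ℝ => (z.1, prolongMap φ ψ z.2))
        (𝓝 (0, x₀, y₀, p₀)) (𝓝 (0, φ x₀, ψ x₀ y₀, p₁)) := by
      rw [← hp₁]
      exact (continuousAt_fst.prodMk (ContinuousAt.comp
        (f := fun z : (Fin n → ℝ) × ℝ × ℝ × ℝ => z.2) (x := (0, x₀, y₀, p₀))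
        (continuousAt_prolongMap hφ hψ h₁ p₀) continuousAt_snd)).tendsto
    have t2 : Tendsto (fun z : (Fin n → ℝ) × ℝ × ℝ × ℝ => prolongMap (S.φ z.1) (S.ψ z.1) z.2)
        (𝓝 (0, φ x₀, ψ x₀ y₀, p₁)) (𝓝 (φ x₀, ψ x₀ y₀, p₁)) := by
      have c1 : ContinuousAt (fun z : (Fin n → ℝ) × ℝ × ℝ × ℝ => S.act (z.1, z.2.1, z.2.2.1))
          (0, φ x₀, ψ x₀ y₀, p₁) :=
        ContinuousAt.comp (f := fun z : (Fin n → ℝ) × ℝ × ℝ × ℝ => (z.1, z.2.1, z.2.2.1))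
          (x := (0, φ x₀, ψ x₀ y₀, p₁)) S.analyticAt_act.continuousAt (by fun_prop)
      have c2 := continuousAt_fam_prolongP (p := p₁) hfφ hfψ hd0'
      have c3 : ContinuousAt
          (fun z : (Fin n → ℝ) × ℝ × ℝ × ℝ => prolongMap (S.φ z.1) (S.ψ z.1) z.2)
          (0, φ x₀, ψ x₀ y₀, p₁) := (c1.fst).prodMk ((c1.snd).prodMk c2)
      have := c3.tendsto
      simp only [prolongMap] at this
      rwa [hφ0, hψ0, hP0] at this
    -- A jet is moved by Φ, then by a, then by Ψ. The facts r1 to r12 provide analyticity,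
    -- nonvanishing derivatives and the map property at each of the three stages; `MapsODEAt.comp`
    -- is then applied twice.
    have r1 := t0.eventually (eventually_jet (hψ.eventually_analyticAt) p₀)
    have cx : ContinuousAt (fun z : ℝ × ℝ × ℝ => z.1) (x₀, y₀, p₀) := continuousAt_fst
    have r2 := t0.eventually (cx.eventually hφ.eventually_analyticAt)
    have r3 := t0.eventually (cx.eventually (hφ.deriv.continuousAt.eventually_ne h₁))
    have pr1 : ContinuousAt (fun z : (Fin n → ℝ) × ℝ × ℝ × ℝ => (z.1, z.2.1))
      (0, φ x₀, ψ x₀ y₀, p₁) := by fun_prop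
    have pr2 : ContinuousAt (fun z : (Fin n → ℝ) × ℝ × ℝ × ℝ => (z.1, z.2.1, z.2.2.1))
      (0, φ x₀, ψ x₀ y₀, p₁) := by fun_prop
    have r4 := t1.eventually (pr1.eventually hfφ.eventually_analyticAt)
    have r5 := t1.eventually (pr2.eventually hfψ.eventually_analyticAt)
    have r6 := t1.eventually (pr1.eventually
      ((analyticAt_fam₁_deriv hfφ).continuousAt.eventually_ne hd0'))
    have r7 := t1.eventually S.symmetry
    have cx1 : ContinuousAt (fun z : ℝ × ℝ × ℝ => z.1) (φ x₀, ψ x₀ y₀, p₁) := continuousAt_fst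
    have r8 := t1.eventually (t2.eventually (cx1.eventually hθ.eventually_analyticAt))
    have r9 := t1.eventually (t2.eventually (cx1.eventually
      (hθ.deriv.continuousAt.eventually_ne hθ')))
    have r10 := t1.eventually (t2.eventually (eventually_jet hχ.eventually_analyticAt p₁))
    have r11 := t1.eventually (t2.eventually hinv)
    have r12 := t0.eventually hm
    filter_upwards [r1, r2, r3, r4, r5, r6, r7, r8, r9, r10, r11, r12]
      with z e1 e2 e3 e4 e5 e6 e7 e8 e9 e10 e11 e12
    have e4' := analyticAt_of_fam₁ e4
    have e5' := analyticAt_of_fam₂ e5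
    have m1 := MapsODEAt.comp e2 e1 e5' e4' e3 e6 e12 e7
    refine MapsODEAt.comp (φ₁ := fun x => S.φ z.1 (φ x)) (AnalyticAt.fun_comp e4' e2)
      (analyticAt_compFibre e2 e1 e5') e10 e8 ?_ e9 m1 ?_
    · rw [(deriv_comp_eventually e2 e4').eq_of_nhds]
      exact mul_ne_zero e6 e3
    · rw [prolongP_comp e2 e1 e5' e4' e3 e6]
      exact e11

end Transport

/-! ### The six-dimensional projective group of y'' = 0. -/

section FlatGroup

/-- The product of two projective transformations, in coordinates centred at the identity. -/
def flatMul (a b : Fin 6 → ℝ) : Fin 6 → ℝ :=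
  ![((1 + a 0) * (1 + b 0) + a 1 * b 2) / (a 2 * b 1 + 1) - 1,
    ((1 + a 0) * b 1 + a 1) / (a 2 * b 1 + 1),
    (a 2 * (1 + b 0) + b 2) / (a 2 * b 1 + 1),
    (a 3 * (1 + b 0) + a 4 * b 2 + (1 + a 5) * b 3) / (a 2 * b 1 + 1),
    (a 3 * b 1 + a 4 + (1 + a 5) * b 4) / (a 2 * b 1 + 1),
    (1 + a 5) * (1 + b 5) / (a 2 * b 1 + 1) - 1]

/-- The inverse of a projective transformation, in coordinates centred at the identity. -/
def flatInv (a : Fin 6 → ℝ) : Fin 6 → ℝ :=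
  ![1 / (1 + a 0) - 1,
    -a 1 / (1 + a 0),
    -a 2 / (1 + a 0),
    -(a 3 - a 4 * a 2) / ((1 + a 5) * (1 + a 0)),
    -(a 4 * (1 + a 0) - a 3 * a 1) / ((1 + a 5) * (1 + a 0)),
    (1 + a 0 - a 1 * a 2) / ((1 + a 5) * (1 + a 0)) - 1]

/-- The action on the base `x`. -/
def flatφ (a : Fin 6 → ℝ) (x : ℝ) : ℝ := ((1 + a 0) * x + a 1) / (a 2 * x + 1)

/-- The action on the fibre coordinate `y`. -/
def flatψ (a : Fin 6 → ℝ) (x y : ℝ) : ℝ := ((1 + a 5) * y + a 3 * x + a 4) / (a 2 * x + 1)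

theorem analyticAt_flatMul :
    AnalyticAt ℝ (fun a : (Fin 6 → ℝ) × (Fin 6 → ℝ) => flatMul a.1 a.2) (0, 0) := by
  refine ContDiffAt.analyticAt (contDiffAt_pi.2 fun i => ?_)
  fin_cases i <;> simp [flatMul] <;> fun_prop (disch := simp)

theorem analyticAt_flatInv : AnalyticAt ℝ flatInv 0 := by
  refine ContDiffAt.analyticAt (contDiffAt_pi.2 fun i => ?_)
  fin_cases i <;> simp [flatInv] <;> fun_prop (disch := simp)

theorem eventually_ne_of_continuous {E : Type*} [TopologicalSpace E] {f : E → ℝ} {z : E}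
    (hf : Continuous f) (h : f z ≠ 0) : ∀ᶠ w in 𝓝 z, f w ≠ 0 :=
  hf.continuousAt.eventually_ne h

/-- The parameter a stands for the matrix with rows (1 + a₀, 0, a₁), (a₃, 1 + a₅, a₄), (a₂, 0, 1)
acting on (x, y, 1), and products are rescaled to have corner entry 1. The three hypotheses say that
the corner entries of the unscaled products of a with b, of b with c, and of all three, are nonzero.
-/
theorem flat_assoc (a b c : Fin 6 → ℝ) (h₁ : a 2 * b 1 + 1 ≠ 0) (h₂ : b 2 * c 1 + 1 ≠ 0)
    (h₃ : (a 2 * (1 + b 0) + b 2) * c 1 + (a 2 * b 1 + 1) ≠ 0) :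
    flatMul (flatMul a b) c = flatMul a (flatMul b c) := by
  have e₁ : flatMul a b 2 * c 1 + 1
      = ((a 2 * (1 + b 0) + b 2) * c 1 + (a 2 * b 1 + 1)) / (a 2 * b 1 + 1) := by
    simp only [flatMul, Matrix.cons_val]
    field_simp
  have e₂ : a 2 * flatMul b c 1 + 1
      = ((a 2 * (1 + b 0) + b 2) * c 1 + (a 2 * b 1 + 1)) / (b 2 * c 1 + 1) := by
    simp only [flatMul, Matrix.cons_val]
    rw [eq_div_iff h₂, add_mul, mul_assoc, div_mul_cancel₀ _ h₂]
    ring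
  rw [flatMul, e₁]
  conv_rhs => rw [flatMul, e₂]
  ext i
  fin_cases i <;> simp only [flatMul, Matrix.cons_val, Fin.zero_eta, Fin.mk_one,
    Fin.reduceFinMk] <;> field_simp <;> ring

/-- The local group of fibre-preserving symmetries of `y'' = 0`. -/
def flatGroup : LocalLieGroup 6 where
  mul := flatMul
  inv := flatInv
  analyticAt_mul := analyticAt_flatMul
  analyticAt_inv := analyticAt_flatInv
  one_mul := Eventually.of_forall fun a => by
    ext i
    fin_cases i <;> simp [flatMul]
  mul_one := Eventually.of_forall fun a => by
    ext i
    fin_cases i <;> simp [flatMul]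
  inv_one := by
    ext i
    fin_cases i <;> simp [flatInv]
  inv_mul := by
    filter_upwards [eventually_ne_of_continuous (f := fun a : Fin 6 → ℝ => 1 + a 0)
      (z := 0) (by fun_prop) (by simp), eventually_ne_of_continuous
      (f := fun a : Fin 6 → ℝ => 1 + a 5) (z := 0) (by fun_prop) (by simp),
      eventually_ne_of_continuous (f := fun a : Fin 6 → ℝ => 1 + a 0 - a 2 * a 1)
      (z := 0) (by fun_prop) (by simp)] with a h₁ h₂ h₃
    have h₄ : 1 + a 0 - a 1 * a 2 ≠ 0 := by rwa [mul_comm (a 1)]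
    have e : flatInv a 2 * a 1 + 1 = (1 + a 0 - a 2 * a 1) / (1 + a 0) := by
      simp only [flatInv, Matrix.cons_val]
      field_simp
      ring
    rw [flatMul, e]
    ext i
    fin_cases i <;> simp only [flatInv, Matrix.cons_val, Fin.zero_eta, Fin.mk_one,
      Fin.reduceFinMk, Pi.zero_apply] <;> field_simp <;> ring
  mul_inv := by
    filter_upwards [eventually_ne_of_continuous (f := fun a : Fin 6 → ℝ => 1 + a 0)
      (z := 0) (by fun_prop) (by simp), eventually_ne_of_continuous
      (f := fun a : Fin 6 → ℝ => 1 + a 5) (z := 0) (by fun_prop) (by simp),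
      eventually_ne_of_continuous (f := fun a : Fin 6 → ℝ => 1 + a 0 - a 2 * a 1)
      (z := 0) (by fun_prop) (by simp)] with a h₁ h₂ h₃
    have h₄ : 1 + a 0 - a 1 * a 2 ≠ 0 := by rwa [mul_comm (a 1)]
    have e : a 2 * flatInv a 1 + 1 = (1 + a 0 - a 2 * a 1) / (1 + a 0) := by
      simp only [flatInv, Matrix.cons_val]
      field_simp
      ring
    rw [flatMul, e]
    ext i
    fin_cases i <;> simp only [flatInv, Matrix.cons_val, Fin.zero_eta, Fin.mk_one,
      Fin.reduceFinMk, Pi.zero_apply] <;> field_simp <;> ring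
  mul_assoc := by
    filter_upwards [eventually_ne_of_continuous (z := (0, 0, 0))
      (f := fun a : (Fin 6 → ℝ) × (Fin 6 → ℝ) × (Fin 6 → ℝ) => a.1 2 * a.2.1 1 + 1)
      (by fun_prop) (by simp), eventually_ne_of_continuous (z := (0, 0, 0))
      (f := fun a : (Fin 6 → ℝ) × (Fin 6 → ℝ) × (Fin 6 → ℝ) => a.2.1 2 * a.2.2 1 + 1)
      (by fun_prop) (by simp), eventually_ne_of_continuous (z := (0, 0, 0))
      (f := fun a : (Fin 6 → ℝ) × (Fin 6 → ℝ) × (Fin 6 → ℝ) =>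
        (a.1 2 * (1 + a.2.1 0) + a.2.1 2) * a.2.2 1 + (a.1 2 * a.2.1 1 + 1))
      (by fun_prop) (by simp)] with a h₁ h₂ h₃
    exact flat_assoc _ _ _ h₁ h₂ h₃

theorem hasDerivAt_flatφ (a : Fin 6 → ℝ) (x : ℝ) (h : a 2 * x + 1 ≠ 0) :
    HasDerivAt (flatφ a) ((1 + a 0 - a 1 * a 2) / (a 2 * x + 1) ^ 2) x := by
  have h1 : HasDerivAt (fun x => (1 + a 0) * x + a 1) (1 + a 0) x := by
    simpa using ((hasDerivAt_id x).const_mul (1 + a 0)).add_const (a 1)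
  have h2 : HasDerivAt (fun x => a 2 * x + 1) (a 2) x := by
    simpa using ((hasDerivAt_id x).const_mul (a 2)).add_const 1
  refine (h1.div h2 h).congr_deriv ?_
  field_simp
  ring

theorem hasDerivAt_inv_pow (c d x : ℝ) (h : c * x + 1 ≠ 0) (n : ℕ) :
    HasDerivAt (fun t => d / (c * t + 1) ^ n) (-(n * c * d) / (c * x + 1) ^ (n + 1)) x := by
  have h2 : HasDerivAt (fun x => c * x + 1) c x := by
    simpa using ((hasDerivAt_id x).const_mul c).add_const 1
  have h3 := (hasDerivAt_const x d).div (h2.pow n) (pow_ne_zero n h)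
  refine h3.congr_deriv ?_
  rcases n with _ | n
  · simp
  · simp only [Nat.add_sub_cancel, Pi.pow_apply]
    field_simp
    ring

theorem eventually_flat_ne {a : Fin 6 → ℝ} {x : ℝ} (h : a 2 * x + 1 ≠ 0) :
    ∀ᶠ t in 𝓝 x, a 2 * t + 1 ≠ 0 :=
  eventually_ne_of_continuous (f := fun t => a 2 * t + 1) (by fun_prop) h

theorem deriv_deriv_flatφ (a : Fin 6 → ℝ) (x : ℝ) (h : a 2 * x + 1 ≠ 0) :
    deriv (deriv (flatφ a)) x = -(2 * a 2 * (1 + a 0 - a 1 * a 2)) / (a 2 * x + 1) ^ 3 := by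
  have e : deriv (flatφ a) =ᶠ[𝓝 x] fun t => (1 + a 0 - a 1 * a 2) / (a 2 * t + 1) ^ 2 := by
    filter_upwards [eventually_flat_ne h] with t ht
    exact (hasDerivAt_flatφ a t ht).deriv
  rw [e.deriv_eq]
  exact_mod_cast (hasDerivAt_inv_pow (a 2) (1 + a 0 - a 1 * a 2) x h 2).deriv

theorem dy_flatψ (a : Fin 6 → ℝ) (x y : ℝ) : dy (flatψ a) x y = (1 + a 5) / (a 2 * x + 1) := by
  have h1 : HasDerivAt (fun y => (1 + a 5) * y + a 3 * x + a 4) (1 + a 5) y := by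
    simpa using (((hasDerivAt_id y).const_mul (1 + a 5)).add_const (a 3 * x)).add_const (a 4)
  exact (h1.div_const (a 2 * x + 1)).deriv

theorem dx_flatψ (a : Fin 6 → ℝ) (x y : ℝ) (h : a 2 * x + 1 ≠ 0) :
    dx (flatψ a) x y = (a 3 - a 2 * ((1 + a 5) * y + a 4)) / (a 2 * x + 1) ^ 2 := by
  have h1 : HasDerivAt (fun x => (1 + a 5) * y + a 3 * x + a 4) (a 3) x := by
    simpa using (((hasDerivAt_id x).const_mul (a 3)).const_add ((1 + a 5) * y)).add_const (a 4)
  have h2 : HasDerivAt (fun x => a 2 * x + 1) (a 2) x := by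
    simpa using ((hasDerivAt_id x).const_mul (a 2)).add_const 1
  refine (h1.div h2 h).deriv.trans ?_
  field_simp
  ring

/-- Projective maps carry straight lines to straight lines. -/
theorem prolongQ_flat (a : Fin 6 → ℝ) (x y p : ℝ) (h : a 2 * x + 1 ≠ 0) :
    prolongQ (flatφ a) (flatψ a) x y p 0 = 0 := by
  have e1 : dy (dy (flatψ a)) x y = 0 := by
    have : dy (flatψ a) = fun x _ => (1 + a 5) / (a 2 * x + 1) := by
      funext s t
      exact dy_flatψ a s t
    rw [this]
    simp [dy]
  have e2 : dx (dy (flatψ a)) x y = -(a 2 * (1 + a 5)) / (a 2 * x + 1) ^ 2 := by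
    have : dy (flatψ a) = fun x _ => (1 + a 5) / (a 2 * x + 1) ^ 1 := by
      funext s t
      rw [dy_flatψ a s t, pow_one]
    rw [this]
    simpa [dx] using (hasDerivAt_inv_pow (a 2) (1 + a 5) x h 1).deriv
  have e3 : dx (dx (flatψ a)) x y
      = -(2 * a 2 * (a 3 - a 2 * ((1 + a 5) * y + a 4))) / (a 2 * x + 1) ^ 3 := by
    have e : (fun t => dx (flatψ a) t y) =ᶠ[𝓝 x]
        fun t => (a 3 - a 2 * ((1 + a 5) * y + a 4)) / (a 2 * t + 1) ^ 2 := by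
      filter_upwards [eventually_flat_ne h] with t ht
      exact dx_flatψ a t y ht
    have := (hasDerivAt_inv_pow (a 2) (a 3 - a 2 * ((1 + a 5) * y + a 4)) x h 2).deriv
    rw [dx, e.deriv_eq]
    exact_mod_cast this
  rw [prolongQ, e1, e2, e3, (hasDerivAt_flatφ a x h).deriv, deriv_deriv_flatφ a x h,
    dx_flatψ a x y h, dy_flatψ, div_eq_zero_iff]
  left
  field_simp
  ring

theorem flat_effective {a : Fin 6 → ℝ}
    (h : ∀ᶠ z : ℝ × ℝ in 𝓝 (0, 0), flatφ a z.1 = z.1 ∧ flatψ a z.1 z.2 = z.2) : a = 0 := by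
  obtain ⟨ε, hε, H⟩ := Metric.eventually_nhds_iff_ball.1
    (h.and (eventually_ne_of_continuous (z := ((0, 0) : ℝ × ℝ))
      (f := fun z : ℝ × ℝ => a 2 * z.1 + 1) (by fun_prop) (by simp)))
  have mem : ∀ s t : ℝ, |s| < ε → |t| < ε → ((s, t) : ℝ × ℝ) ∈ Metric.ball (0, 0) ε := by
    intro s t hs ht
    rw [← ball_prod_same]
    exact ⟨by simpa using hs, by simpa using ht⟩
  have rel : ∀ s t : ℝ, |s| < ε → |t| < ε → (1 + a 0) * s + a 1 = s * (a 2 * s + 1) ∧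
      (1 + a 5) * t + a 3 * s + a 4 = t * (a 2 * s + 1) := by
    intro s t hs ht
    obtain ⟨⟨h1, h2⟩, h3⟩ := H _ (mem s t hs ht)
    exact ⟨(div_eq_iff h3).1 h1, (div_eq_iff h3).1 h2⟩
  have b0 : |(0 : ℝ)| < ε := by simpa using hε
  have b1 : |ε / 2| < ε := by rw [abs_of_pos (by positivity)]; linarith
  have b2 : |ε / 3| < ε := by rw [abs_of_pos (by positivity)]; linarith
  have r00 := rel 0 0 b0 b0
  have r10 := rel (ε / 2) 0 b1 b0
  have r20 := rel (ε / 3) 0 b2 b0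
  have r01 := rel 0 (ε / 2) b0 b1
  have a1 : a 1 = 0 := by linarith [r00.1]
  have a4 : a 4 = 0 := by linarith [r00.2]
  -- Being the identity at a nonzero abscissa t gives a₀ = a₂ t; two different abscissae force a₀ =
  -- a₂ = 0.
  have q1 : a 0 = a 2 * (ε / 2) :=
    mul_right_cancel₀ (ne_of_gt (half_pos hε)) (by linear_combination r10.1 - a1)
  have q2 : a 0 = a 2 * (ε / 3) :=
    mul_right_cancel₀ (ne_of_gt (show 0 < ε / 3 by positivity)) (by linear_combination r20.1 - a1)
  have a2 : a 2 = 0 := by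
    have : a 2 * ε = 0 := by linear_combination 6 * q2 - 6 * q1
    exact (mul_eq_zero.1 this).resolve_right hε.ne'
  have a0 : a 0 = 0 := by rw [q1, a2, zero_mul]
  have a3 : a 3 = 0 := by
    have : a 3 * ε = 0 := by linear_combination 2 * r10.2 - 2 * a4
    exact (mul_eq_zero.1 this).resolve_right hε.ne'
  have a5 : a 5 = 0 := by
    have : a 5 * ε = 0 := by linear_combination 2 * r01.2 - 2 * a4
    exact (mul_eq_zero.1 this).resolve_right hε.ne'
  ext i
  fin_cases i <;> simpa

theorem admitsSymmetryGroup_flat : AdmitsSymmetryGroup 6 (fun _ _ _ => 0) 0 0 0 := by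
  refine ⟨flatGroup, ⟨{
    φ := flatφ
    ψ := flatψ
    analyticAt_φ := ?_
    analyticAt_ψ := ?_
    one_act := Eventually.of_forall fun z => by simp [flatφ, flatψ]
    mul_act := ?_
    effective := Eventually.of_forall fun a => flat_effective
    symmetry := ?_ }⟩⟩
  · refine ContDiffAt.analyticAt ?_
    simp only [flatφ]
    fun_prop (disch := simp)
  · refine ContDiffAt.analyticAt ?_
    simp only [flatψ]
    fun_prop (disch := simp)
  · filter_upwards [eventually_ne_of_continuous (z := (0, 0, 0, 0))
      (f := fun z : (Fin 6 → ℝ) × (Fin 6 → ℝ) × ℝ × ℝ => z.1 2 * z.2.1 1 + 1)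
      (by fun_prop) (by simp), eventually_ne_of_continuous (z := (0, 0, 0, 0))
      (f := fun z : (Fin 6 → ℝ) × (Fin 6 → ℝ) × ℝ × ℝ => z.2.1 2 * z.2.2.1 + 1)
      (by fun_prop) (by simp), eventually_ne_of_continuous (z := (0, 0, 0, 0))
      (f := fun z : (Fin 6 → ℝ) × (Fin 6 → ℝ) × ℝ × ℝ =>
        (z.1 2 * (1 + z.2.1 0) + z.2.1 2) * z.2.2.1 + (z.1 2 * z.2.1 1 + 1))
      (by fun_prop) (by simp)] with ⟨a, b, x, y⟩ h₁ h₂ h₃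
    dsimp only at h₁ h₂ h₃
    have e₁ : flatMul a b 2 * x + 1
        = ((a 2 * (1 + b 0) + b 2) * x + (a 2 * b 1 + 1)) / (a 2 * b 1 + 1) := by
      simp only [flatMul, Matrix.cons_val]
      field_simp
    have e₂ : a 2 * flatφ b x + 1
        = ((a 2 * (1 + b 0) + b 2) * x + (a 2 * b 1 + 1)) / (b 2 * x + 1) := by
      simp only [flatφ]
      rw [eq_div_iff h₂, add_mul, mul_assoc, div_mul_cancel₀ _ h₂]
      ring
    change flatφ (flatMul a b) x = flatφ a (flatφ b x) ∧
      flatψ (flatMul a b) x y = flatψ a (flatφ b x) (flatψ b x y)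
    constructor
    · rw [flatφ, e₁]
      conv_rhs => rw [flatφ, e₂]
      simp only [flatφ, flatMul, Matrix.cons_val]
      field_simp
      ring
    · rw [flatψ, e₁]
      conv_rhs => rw [flatψ, e₂]
      simp only [flatφ, flatψ, flatMul, Matrix.cons_val]
      field_simp
      ring
  · filter_upwards [eventually_ne_of_continuous (z := (0, 0, 0, 0))
      (f := fun z : (Fin 6 → ℝ) × ℝ × ℝ × ℝ => z.1 2 * z.2.1 + 1)
      (by fun_prop) (by simp)] with z hz
    exact prolongQ_flat z.1 z.2.1 z.2.2.1 z.2.2.2 hz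

end FlatGroup

/-! ### A locally effective action has no zero generators. -/

section Effectivity

variable {n : ℕ} {G : LocalLieGroup n} {K : ℝ → ℝ → ℝ → ℝ} {x₀ y₀ p₀ : ℝ}

/-- The left-invariant vector field of a local Lie group with value `v` at the identity. -/
def LocalLieGroup.leftInvariant (G : LocalLieGroup n) (v a : Fin n → ℝ) : Fin n → ℝ :=
  fderiv ℝ (fun w : (Fin n → ℝ) × (Fin n → ℝ) => G.mul w.1 w.2) (a, 0) (0, v)

theorem LocalLieGroup.leftInvariant_zero (G : LocalLieGroup n) (v : Fin n → ℝ) :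
    G.leftInvariant v 0 = v := by
  have h1 : HasFDerivAt (fun b : Fin n → ℝ => ((0, b) : (Fin n → ℝ) × (Fin n → ℝ)))
      (ContinuousLinearMap.inr ℝ (Fin n → ℝ) (Fin n → ℝ)) 0 :=
    (ContinuousLinearMap.inr ℝ (Fin n → ℝ) (Fin n → ℝ)).hasFDerivAt
  have h2 := HasFDerivAt.comp (0 : Fin n → ℝ)
    (show HasFDerivAt (fun w : (Fin n → ℝ) × (Fin n → ℝ) => G.mul w.1 w.2) _ (0, 0) from
      G.analyticAt_mul.differentiableAt.hasFDerivAt) h1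
  have h3 : HasFDerivAt ((fun w : (Fin n → ℝ) × (Fin n → ℝ) => G.mul w.1 w.2) ∘
      fun b : Fin n → ℝ => ((0, b) : (Fin n → ℝ) × (Fin n → ℝ)))
      (ContinuousLinearMap.id ℝ (Fin n → ℝ)) 0 :=
    (hasFDerivAt_id 0).congr_of_eventuallyEq G.one_mul
  have h4 := congrArg (fun L : (Fin n → ℝ) →L[ℝ] (Fin n → ℝ) => L v) (h2.unique h3)
  simpa [LocalLieGroup.leftInvariant] using h4

theorem LocalLieGroup.analyticAt_leftInvariant (G : LocalLieGroup n) (v : Fin n → ℝ) :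
    AnalyticAt ℝ (G.leftInvariant v) 0 := by
  have h1 : AnalyticAt ℝ (fun a : Fin n → ℝ => ((a, 0) : (Fin n → ℝ) × (Fin n → ℝ))) 0 :=
    analyticAt_id.prod analyticAt_const
  have h2 : AnalyticAt ℝ (fun a : Fin n → ℝ =>
      fderiv ℝ (fun w : (Fin n → ℝ) × (Fin n → ℝ) => G.mul w.1 w.2) (a, 0)) 0 :=
    AnalyticAt.fun_comp (f := fun a : Fin n → ℝ => ((a, 0) : (Fin n → ℝ) × (Fin n → ℝ)))
      G.analyticAt_mul.fderiv h1
  exact ((ContinuousLinearMap.apply ℝ (Fin n → ℝ) ((0, v) : (Fin n → ℝ) × (Fin n → ℝ))).analyticAt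
    _).comp h2

/-- Along the left-invariant field of `v`, the action is constant at the points where the
generator of `v` vanishes. -/
theorem FibreSymmetryAction.fderiv_act_leftInvariant (S : FibreSymmetryAction G K x₀ y₀ p₀)
    (v : Fin n → ℝ) :
    ∀ᶠ w : (Fin n → ℝ) × ℝ × ℝ in 𝓝 (0, x₀, y₀), fderiv ℝ S.act (0, w.2) (v, 0) = 0 →
      fderiv ℝ S.act w (G.leftInvariant v w.1, 0) = 0 := by
  have t1 : Tendsto (fun w : (Fin n → ℝ) × ℝ × ℝ => w.1) (𝓝 (0, x₀, y₀)) (𝓝 0) :=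
    continuousAt_fst.tendsto
  have t2 : Tendsto (fun w : (Fin n → ℝ) × ℝ × ℝ => w.2) (𝓝 (0, x₀, y₀)) (𝓝 (x₀, y₀)) :=
    continuousAt_snd.tendsto
  have t3 : Tendsto (fun w : (Fin n → ℝ) × ℝ × ℝ => ((0 : Fin n → ℝ), w.2)) (𝓝 (0, x₀, y₀))
      (𝓝 (0, x₀, y₀)) := (continuousAt_const.prodMk continuousAt_snd).tendsto
  have t4 : Tendsto (fun w : (Fin n → ℝ) × ℝ × ℝ => ((w.1, 0) : (Fin n → ℝ) × (Fin n → ℝ)))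
      (𝓝 (0, x₀, y₀)) (𝓝 (0, 0)) := (continuousAt_fst.prodMk continuousAt_const).tendsto
  have t5 : Tendsto (fun w : (Fin n → ℝ) × ℝ × ℝ =>
      ((w.1, 0, w.2) : (Fin n → ℝ) × (Fin n → ℝ) × ℝ × ℝ)) (𝓝 (0, x₀, y₀)) (𝓝 (0, 0, x₀, y₀)) :=
    (continuousAt_fst.prodMk (continuousAt_const.prodMk continuousAt_snd)).tendsto
  filter_upwards [S.analyticAt_act.eventually_analyticAt,
    t3.eventually S.analyticAt_act.eventually_analyticAt,
    t4.eventually G.analyticAt_mul.eventually_analyticAt, t1.eventually G.mul_one,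
    t2.eventually S.one_act, t5.eventually S.mul_act.eventually_nhds] with ⟨a, z⟩ h1 h2 h3 h4 h5 h6
    hv
  dsimp only at *
  have h5' : S.act (0, z) = z := Prod.ext h5.1 h5.2
  have line : HasDerivAt (fun s : ℝ => s • v) v 0 := by
    simpa using (hasDerivAt_id (0 : ℝ)).smul_const v
  have l1 : HasDerivAt (fun s : ℝ => G.mul a (s • v)) (G.leftInvariant v a) 0 := by
    have hp : HasDerivAt (fun s : ℝ => ((a, s • v) : (Fin n → ℝ) × (Fin n → ℝ))) (0, v) 0 :=
      (hasDerivAt_const 0 a).prodMk line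
    have hm : HasFDerivAt (fun w : (Fin n → ℝ) × (Fin n → ℝ) => G.mul w.1 w.2)
        (fderiv ℝ (fun w : (Fin n → ℝ) × (Fin n → ℝ) => G.mul w.1 w.2) (a, 0))
        (a, (0 : ℝ) • v) := by
      rw [zero_smul]
      exact h3.differentiableAt.hasFDerivAt
    exact hm.comp_hasDerivAt 0 hp
  -- The curve s ↦ (a · sv) z is also s ↦ a (sv z). The second form has derivative 0 at s = 0 when
  -- the generator of v vanishes at z; `l2` and `r2` compare the two.
  have l2 : HasDerivAt (fun s : ℝ => S.act (G.mul a (s • v), z))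
      (fderiv ℝ S.act (a, z) (G.leftInvariant v a, 0)) 0 := by
    have hp : HasDerivAt (fun s : ℝ => (G.mul a (s • v), z)) (G.leftInvariant v a, 0) 0 :=
      l1.prodMk (hasDerivAt_const 0 z)
    have hm : HasFDerivAt S.act (fderiv ℝ S.act (a, z)) (G.mul a ((0 : ℝ) • v), z) := by
      rw [zero_smul, h4]
      exact h1.differentiableAt.hasFDerivAt
    exact hm.comp_hasDerivAt 0 hp
  have r1 : HasDerivAt (fun s : ℝ => S.act (s • v, z)) 0 0 := by
    have hp : HasDerivAt (fun s : ℝ => (s • v, z)) (v, 0) 0 := line.prodMk (hasDerivAt_const 0 z)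
    have hm : HasFDerivAt S.act (fderiv ℝ S.act (0, z)) ((0 : ℝ) • v, z) := by
      rw [zero_smul]
      exact h2.differentiableAt.hasFDerivAt
    have := hm.comp_hasDerivAt 0 hp
    rwa [hv] at this
  have r2 : HasDerivAt (fun s : ℝ => S.act (a, S.act (s • v, z))) 0 0 := by
    have hp : HasDerivAt (fun s : ℝ => (a, S.act (s • v, z))) (0, 0) 0 :=
      (hasDerivAt_const 0 a).prodMk r1
    have hm : HasFDerivAt S.act (fderiv ℝ S.act (a, z)) (a, S.act ((0 : ℝ) • v, z)) := by
      rw [zero_smul, h5']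
      exact h1.differentiableAt.hasFDerivAt
    have := hm.comp_hasDerivAt 0 hp
    rwa [show ((0, 0) : (Fin n → ℝ) × ℝ × ℝ) = 0 from rfl, map_zero] at this
  have t6 : Tendsto (fun s : ℝ => ((a, s • v, z) : (Fin n → ℝ) × (Fin n → ℝ) × ℝ × ℝ)) (𝓝 0)
      (𝓝 (a, 0, z)) := by
    have : Continuous (fun s : ℝ => ((a, s • v, z) : (Fin n → ℝ) × (Fin n → ℝ) × ℝ × ℝ)) := by
      fun_prop
    simpa using this.tendsto 0
  have heq : (fun s : ℝ => S.act (G.mul a (s • v), z)) =ᶠ[𝓝 0]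
      fun s : ℝ => S.act (a, S.act (s • v, z)) :=
    (t6.eventually h6).mono fun s hs => Prod.ext hs.1 hs.2
  exact l2.unique (r2.congr_of_eventuallyEq heq)

/-- A Lie algebra element with zero generator is zero, for a locally effective action. -/
theorem FibreSymmetryAction.eq_zero_of_generator (S : FibreSymmetryAction G K x₀ y₀ p₀)
    {v : Fin n → ℝ} (hv : ∀ᶠ z in 𝓝 (x₀, y₀), fderiv ℝ S.act (0, z) (v, 0) = 0) : v = 0 := by
  -- The integral curve α of the left-invariant field through the identity, with α'(0) = v. Orbits
  -- along α are constant, so effectivity makes α constant. That α is a one-parameter subgroup is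
  -- not needed.
  obtain ⟨α, hα0, ε, hε, hα⟩ :=
    (G.analyticAt_leftInvariant v).contDiffAt.exists_forall_mem_closedBall_exists_eq_forall_mem_Ioo_hasDerivAt₀ 0
  rw [zero_sub, zero_add] at hα
  have hα' := hα 0 ⟨neg_lt_zero.2 hε, hε⟩
  rw [hα0, G.leftInvariant_zero] at hα'
  have hαc : Tendsto α (𝓝 0) (𝓝 0) := by
    have := hα'.continuousAt.tendsto
    rwa [hα0] at this
  have t2 : Tendsto (fun w : (Fin n → ℝ) × ℝ × ℝ => w.2) (𝓝 (0, x₀, y₀)) (𝓝 (x₀, y₀)) :=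
    continuousAt_snd.tendsto
  have key : ∀ᶠ w : (Fin n → ℝ) × ℝ × ℝ in 𝓝 (0, x₀, y₀), AnalyticAt ℝ S.act w ∧
      fderiv ℝ S.act w (G.leftInvariant v w.1, 0) = 0 ∧ S.act (0, w.2) = w.2 := by
    filter_upwards [S.analyticAt_act.eventually_analyticAt, S.fderiv_act_leftInvariant v,
      t2.eventually hv, t2.eventually S.one_act] with w h1 h2 h3 h4
    exact ⟨h1, h2 h3, Prod.ext h4.1 h4.2⟩
  rw [nhds_prod_eq, eventually_prod_iff] at key
  obtain ⟨pa, hpa, pz, hpz, key⟩ := key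
  obtain ⟨δ, hδ, Hδ⟩ := Metric.eventually_nhds_iff_ball.1 (hαc.eventually hpa)
  -- The range of t must not depend on z, since `effective` asks for the identity on a whole
  -- neighbourhood; the product neighbourhood `pa`, `pz` provides this.
  have hfix : ∀ᶠ t in 𝓝 (0 : ℝ), ∀ z, pz z → S.act (α t, z) = z := by
    have hm : 0 < min ε δ := lt_min hε hδ
    filter_upwards [Metric.ball_mem_nhds (0 : ℝ) hm] with t ht z hz
    rw [Real.ball_eq_Ioo, zero_sub, zero_add] at ht
    have hsub : ∀ s ∈ Set.Ioo (-min ε δ) (min ε δ), s ∈ Set.Ioo (-ε) ε ∧ pa (α s) := by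
      intro s hs
      refine ⟨⟨?_, hs.2.trans_le (min_le_left _ _)⟩, Hδ s ?_⟩
      · linarith [hs.1, min_le_left ε δ]
      · rw [Real.ball_eq_Ioo, zero_sub, zero_add]
        exact ⟨by linarith [hs.1, min_le_right ε δ], hs.2.trans_le (min_le_right _ _)⟩
    have hd : ∀ s ∈ Set.Ioo (-min ε δ) (min ε δ),
        HasDerivAt (fun s => S.act (α s, z)) 0 s := by
      intro s hs
      obtain ⟨h1, h2⟩ := hsub s hs
      obtain ⟨k1, k2, k3⟩ := key h2 hz
      have hp : HasDerivAt (fun s => (α s, z)) (G.leftInvariant v (α s), 0) s :=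
        (hα s h1).prodMk (hasDerivAt_const s z)
      have := k1.differentiableAt.hasFDerivAt.comp_hasDerivAt s hp
      rwa [k2] at this
    have h0 : (0 : ℝ) ∈ Set.Ioo (-min ε δ) (min ε δ) := ⟨neg_lt_zero.2 hm, hm⟩
    have hconst := isOpen_Ioo.is_const_of_deriv_eq_zero isPreconnected_Ioo
      (fun s hs => (hd s hs).differentiableAt.differentiableWithinAt)
      (fun s hs => (hd s hs).deriv) ht h0
    have k := (key (hsub 0 h0).2 hz).2.2
    simp only [hα0] at hconst k
    rw [hconst, k]
  have hzero : ∀ᶠ t in 𝓝 (0 : ℝ), α t = 0 := by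
    filter_upwards [hfix, hαc.eventually S.effective] with t h1 h2
    exact h2 (hpz.mono fun z hz =>
      ⟨congrArg Prod.fst (h1 z hz), congrArg Prod.snd (h1 z hz)⟩)
  exact hα'.unique ((hasDerivAt_const (0 : ℝ) (0 : Fin n → ℝ)).congr_of_eventuallyEq hzero)

end Effectivity

/-! ### Generators of the action and the determining equation. -/

section Generators

variable {A : Type*} [NormedAddCommGroup A] [NormedSpace ℝ A]

/-- The derivative at `0` of a family of functions of one variable in the direction `v` of the
parameter space. -/
def gen₁ (φ : A → ℝ → ℝ) (v : A) (x : ℝ) : ℝ := dirDeriv (v, 0) (fam₁ φ) (0, x)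

/-- The derivative at `0` of a family of functions of two variables in the direction `v` of the
parameter space. -/
def gen₂ (ψ : A → ℝ → ℝ → ℝ) (v : A) (x y : ℝ) : ℝ := dirDeriv (v, 0) (fam₂ ψ) (0, x, y)

variable {φ : A → ℝ → ℝ} {ψ : A → ℝ → ℝ → ℝ} {v : A} {x y p : ℝ}

theorem analyticAt_gen₁ (h : AnalyticAt ℝ (fam₁ φ) (0, x)) : AnalyticAt ℝ (gen₁ φ v) x :=
  AnalyticAt.fun_comp (f := fun t : ℝ => ((0 : A), t)) (analyticAt_dirDeriv (v, 0) h)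
    (analyticAt_const.prod analyticAt_id)

theorem analyticAt_gen₂ (h : AnalyticAt ℝ (fam₂ ψ) (0, x, y)) :
    AnalyticAt ℝ (unc₂ (gen₂ ψ v)) (x, y) :=
  AnalyticAt.fun_comp (f := fun t : ℝ × ℝ => ((0 : A), t)) (analyticAt_dirDeriv (v, 0) h)
    (analyticAt_const.prod analyticAt_id)

theorem hasDerivAt_gen₁ (h : AnalyticAt ℝ (fam₁ φ) (0, x)) :
    HasDerivAt (fun t : ℝ => φ (t • v) x) (gen₁ φ v x) 0 := by
  have h1 : HasDerivAt (fun t : ℝ => (t • v, x)) (v, 0) 0 := by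
    simpa using ((hasDerivAt_id (0 : ℝ)).smul_const v).prodMk (hasDerivAt_const 0 x)
  have hm : HasFDerivAt (fam₁ φ) (fderiv ℝ (fam₁ φ) (0, x)) ((0 : ℝ) • v, x) := by
    rw [zero_smul]
    exact h.differentiableAt.hasFDerivAt
  exact hm.comp_hasDerivAt 0 h1

theorem hasDerivAt_gen₂ (h : AnalyticAt ℝ (fam₂ ψ) (0, x, y)) :
    HasDerivAt (fun t : ℝ => ψ (t • v) x y) (gen₂ ψ v x y) 0 := by
  have h1 : HasDerivAt (fun t : ℝ => (t • v, x, y)) (v, 0) 0 := by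
    simpa using ((hasDerivAt_id (0 : ℝ)).smul_const v).prodMk (hasDerivAt_const 0 (x, y))
  have hm : HasFDerivAt (fam₂ ψ) (fderiv ℝ (fam₂ ψ) (0, x, y)) ((0 : ℝ) • v, x, y) := by
    rw [zero_smul]
    exact h.differentiableAt.hasFDerivAt
  exact hm.comp_hasDerivAt 0 h1

/-- Parameter and space derivatives commute, so a derivative of the generator is the parameter
derivative of the differentiated family. -/
theorem deriv_gen₁ (h : AnalyticAt ℝ (fam₁ φ) (0, x)) :
    deriv (gen₁ φ v) x = gen₁ (fun a => deriv (φ a)) v x := by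
  have hd := analyticAt_dirDeriv (v, 0) h
  have h1 : HasDerivAt (fun t : ℝ => ((0 : A), t)) (0, 1) x :=
    (hasDerivAt_const x 0).prodMk (hasDerivAt_id x)
  have h2 : deriv (gen₁ φ v) x = dirDeriv (0, 1) (dirDeriv (v, 0) (fam₁ φ)) (0, x) :=
    (hd.differentiableAt.hasFDerivAt.comp_hasDerivAt x h1).deriv
  rw [h2, dirDeriv_comm _ _ h, gen₁, (dirDeriv_congr _ (fam₁_deriv h)).eq_of_nhds]

theorem dx_gen₂ (h : AnalyticAt ℝ (fam₂ ψ) (0, x, y)) :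
    dx (gen₂ ψ v) x y = gen₂ (fun a => dx (ψ a)) v x y := by
  have hd := analyticAt_dirDeriv (v, 0) h
  have h1 : HasDerivAt (fun t : ℝ => ((0 : A), t, y)) (0, 1, 0) x :=
    (hasDerivAt_const x 0).prodMk ((hasDerivAt_id x).prodMk (hasDerivAt_const x y))
  have h2 : dx (gen₂ ψ v) x y = dirDeriv (0, 1, 0) (dirDeriv (v, 0) (fam₂ ψ)) (0, x, y) :=
    (hd.differentiableAt.hasFDerivAt.comp_hasDerivAt x h1).deriv
  rw [h2, dirDeriv_comm _ _ h, gen₂, (dirDeriv_congr _ (fam₂_dx h)).eq_of_nhds]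

theorem dy_gen₂ (h : AnalyticAt ℝ (fam₂ ψ) (0, x, y)) :
    dy (gen₂ ψ v) x y = gen₂ (fun a => dy (ψ a)) v x y := by
  have hd := analyticAt_dirDeriv (v, 0) h
  have h1 : HasDerivAt (fun t : ℝ => ((0 : A), x, t)) (0, 0, 1) y :=
    (hasDerivAt_const y 0).prodMk ((hasDerivAt_const y x).prodMk (hasDerivAt_id y))
  have h2 : dy (gen₂ ψ v) x y = dirDeriv (0, 0, 1) (dirDeriv (v, 0) (fam₂ ψ)) (0, x, y) :=
    (hd.differentiableAt.hasFDerivAt.comp_hasDerivAt y h1).deriv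
  rw [h2, dirDeriv_comm _ _ h, gen₂, (dirDeriv_congr _ (fam₂_dy h)).eq_of_nhds]

theorem eventually_section {A E : Type*} [TopologicalSpace A] [Zero A] [TopologicalSpace E]
    {P : A × E → Prop} {z : E} (h : ∀ᶠ w in 𝓝 (0, z), P w) : ∀ᶠ w in 𝓝 z, P (0, w) :=
  ((Continuous.prodMk_right (0 : A)).tendsto z).eventually h

theorem deriv_deriv_gen₁ (h : AnalyticAt ℝ (fam₁ φ) (0, x)) :
    deriv (deriv (gen₁ φ v)) x = gen₁ (fun a => deriv (deriv (φ a))) v x := by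
  have : deriv (gen₁ φ v) =ᶠ[𝓝 x] gen₁ (fun a => deriv (φ a)) v :=
    (eventually_section h.eventually_analyticAt).mono fun t ht => deriv_gen₁ ht
  rw [this.deriv_eq, deriv_gen₁ (analyticAt_fam₁_deriv h)]

theorem unc₂_dx_gen₂ (h : AnalyticAt ℝ (fam₂ ψ) (0, x, y)) :
    unc₂ (dx (gen₂ ψ v)) =ᶠ[𝓝 (x, y)] unc₂ (gen₂ (fun a => dx (ψ a)) v) :=
  (eventually_section h.eventually_analyticAt).mono fun _ ht => dx_gen₂ ht

theorem unc₂_dy_gen₂ (h : AnalyticAt ℝ (fam₂ ψ) (0, x, y)) :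
    unc₂ (dy (gen₂ ψ v)) =ᶠ[𝓝 (x, y)] unc₂ (gen₂ (fun a => dy (ψ a)) v) :=
  (eventually_section h.eventually_analyticAt).mono fun _ ht => dy_gen₂ ht

theorem dx_dx_gen₂ (h : AnalyticAt ℝ (fam₂ ψ) (0, x, y)) :
    dx (dx (gen₂ ψ v)) x y = gen₂ (fun a => dx (dx (ψ a))) v x y := by
  rw [dx_congr (unc₂_dx_gen₂ h), dx_gen₂ (analyticAt_fam₂_dx h)]

theorem dx_dy_gen₂ (h : AnalyticAt ℝ (fam₂ ψ) (0, x, y)) :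
    dx (dy (gen₂ ψ v)) x y = gen₂ (fun a => dx (dy (ψ a))) v x y := by
  rw [dx_congr (unc₂_dy_gen₂ h), dx_gen₂ (analyticAt_fam₂_dy h)]

theorem dy_dy_gen₂ (h : AnalyticAt ℝ (fam₂ ψ) (0, x, y)) :
    dy (dy (gen₂ ψ v)) x y = gen₂ (fun a => dy (dy (ψ a))) v x y := by
  rw [dy_congr (unc₂_dy_gen₂ h), dy_gen₂ (analyticAt_fam₂_dy h)]

/-- The chain rule along a curve, for a function of three variables. -/
theorem hasDerivAt_comp_unc₃ {F : ℝ → ℝ → ℝ → ℝ} {a b c : ℝ → ℝ} {a' b' c' t : ℝ}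
    (h : AnalyticAt ℝ (unc₃ F) (a t, b t, c t))
    (ha : HasDerivAt a a' t) (hb : HasDerivAt b b' t) (hc : HasDerivAt c c' t) :
    HasDerivAt (fun s => F (a s) (b s) (c s)) (a' * jetDx F (a t) (b t) (c t)
      + b' * jetDy F (a t) (b t) (c t) + c' * jetDp F (a t) (b t) (c t)) t := by
  have h1 := h.differentiableAt.hasFDerivAt.comp_hasDerivAt t (ha.prodMk (hb.prodMk hc))
  refine h1.congr_deriv ?_
  have e1 : jetDx F (a t) (b t) (c t) = fderiv ℝ (unc₃ F) (a t, b t, c t) (1, 0, 0) :=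
    (hasDerivAt_unc₃_x h.differentiableAt).deriv
  have e2 : jetDy F (a t) (b t) (c t) = fderiv ℝ (unc₃ F) (a t, b t, c t) (0, 1, 0) :=
    (hasDerivAt_unc₃_y h.differentiableAt).deriv
  have e3 : jetDp F (a t) (b t) (c t) = fderiv ℝ (unc₃ F) (a t, b t, c t) (0, 0, 1) :=
    (hasDerivAt_unc₃_p h.differentiableAt).deriv
  have : ((a', b', c') : ℝ × ℝ × ℝ) = a' • (1, 0, 0) + b' • (0, 1, 0) + c' • (0, 0, 1) := by simp
  rw [this, map_add, map_add, map_smul, map_smul, map_smul, e1, e2, e3]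
  simp only [smul_eq_mul]

/-- The determining equation for infinitesimal fibre-preserving symmetries. -/
theorem determining_equation {J : ℝ → ℝ → ℝ → ℝ} (hφ : AnalyticAt ℝ (fam₁ φ) (0, x))
    (hψ : AnalyticAt ℝ (fam₂ ψ) (0, x, y)) (hJ : AnalyticAt ℝ (unc₃ J) (x, y, p))
    (hφ0 : φ 0 =ᶠ[𝓝 x] fun t => t) (hψ0 : unc₂ (ψ 0) =ᶠ[𝓝 (x, y)] unc₂ fun _ t => t)
    (hsym : ∀ᶠ t : ℝ in 𝓝 0, MapsODEAt (φ (t • v)) (ψ (t • v)) J J x y p) :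
    dy (dy (gen₂ ψ v)) x y * (p * p) + (2 * dx (dy (gen₂ ψ v)) x y - deriv (deriv (gen₁ φ v)) x) * p
      + dx (dx (gen₂ ψ v)) x y + (dy (gen₂ ψ v) x y - 2 * deriv (gen₁ φ v) x) * J x y p
      = gen₁ φ v x * jetDx J x y p + gen₂ ψ v x y * jetDy J x y p
        + (dx (gen₂ ψ v) x y + p * (dy (gen₂ ψ v) x y - deriv (gen₁ φ v) x)) * jetDp J x y p := by
  -- At t = 0 the family is the identity. These values linearize the quotient rule and the chain
  -- rule below.
  have a0 : φ ((0 : ℝ) • v) x = x := by rw [zero_smul]; exact hφ0.eq_of_nhds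
  have b0 : ψ ((0 : ℝ) • v) x y = y := by rw [zero_smul]; exact hψ0.eq_of_nhds
  have a1 : deriv (φ ((0 : ℝ) • v)) x = 1 := by rw [zero_smul, hφ0.deriv_eq]; simp
  have a2 : deriv (deriv (φ ((0 : ℝ) • v))) x = 0 := by
    have h : deriv (fun t : ℝ => t) = fun _ => 1 := deriv_id'
    rw [zero_smul, hφ0.deriv.deriv_eq, h]; simp
  have bx : dx (ψ ((0 : ℝ) • v)) x y = 0 := by rw [zero_smul, dx_congr hψ0]; simp [dx]
  have b_y : dy (ψ ((0 : ℝ) • v)) x y = 1 := by rw [zero_smul, dy_congr hψ0]; simp [dy]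
  have bxx : dx (dx (ψ ((0 : ℝ) • v))) x y = 0 := by
    rw [zero_smul, dx_congr (unc₂_dx_congr hψ0)]; simp [dx]
  have bxy : dx (dy (ψ ((0 : ℝ) • v))) x y = 0 := by
    rw [zero_smul, dx_congr (unc₂_dy_congr hψ0)]; simp [dx, dy]
  have byy : dy (dy (ψ ((0 : ℝ) • v))) x y = 0 := by
    rw [zero_smul, dy_congr (unc₂_dy_congr hψ0)]; simp [dy]
  have hP0 : prolongP (φ ((0 : ℝ) • v)) (ψ ((0 : ℝ) • v)) x y p = p := by
    rw [prolongP, bx, b_y, a1]; simp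
  have Hφ := hasDerivAt_gen₁ (v := v) hφ
  have Hφ1 := hasDerivAt_gen₁ (v := v) (analyticAt_fam₁_deriv hφ)
  have Hφ2 := hasDerivAt_gen₁ (v := v) (analyticAt_fam₁_deriv (analyticAt_fam₁_deriv hφ))
  have Hψ := hasDerivAt_gen₂ (v := v) hψ
  have Hx := hasDerivAt_gen₂ (v := v) (analyticAt_fam₂_dx hψ)
  have Hy := hasDerivAt_gen₂ (v := v) (analyticAt_fam₂_dy hψ)
  have Hxx := hasDerivAt_gen₂ (v := v) (analyticAt_fam₂_dx (analyticAt_fam₂_dx hψ))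
  have Hxy := hasDerivAt_gen₂ (v := v) (analyticAt_fam₂_dx (analyticAt_fam₂_dy hψ))
  have Hyy := hasDerivAt_gen₂ (v := v) (analyticAt_fam₂_dy (analyticAt_fam₂_dy hψ))
  rw [← deriv_gen₁ hφ] at Hφ1
  rw [← deriv_deriv_gen₁ hφ] at Hφ2
  rw [← dx_gen₂ hψ] at Hx
  rw [← dy_gen₂ hψ] at Hy
  rw [← dx_dx_gen₂ hψ] at Hxx
  rw [← dx_dy_gen₂ hψ] at Hxy
  rw [← dy_dy_gen₂ hψ] at Hyy
  have HP := (Hx.add (Hy.mul_const p)).div Hφ1 (by rw [a1]; exact one_ne_zero)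
  have HP' : HasDerivAt (fun t : ℝ => prolongP (φ (t • v)) (ψ (t • v)) x y p) _ 0 := HP
  have HJ := hasDerivAt_comp_unc₃ (F := J) (a := fun t : ℝ => φ (t • v) x)
    (b := fun t : ℝ => ψ (t • v) x y) (c := fun t : ℝ => prolongP (φ (t • v)) (ψ (t • v)) x y p)
    (by rw [a0, b0, hP0]; exact hJ) Hφ Hψ HP'
  have HN := ((((((Hφ1.mul Hyy).mul_const (p ^ 2)).add
    (((Hφ1.const_mul 2).mul Hxy).mul_const p)).add (Hφ1.mul Hxx)).add
    ((Hx.neg.sub (Hy.mul_const p)).mul Hφ2)).add ((Hy.mul Hφ1).mul_const (J x y p))).div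
    (Hφ1.pow 3) (by rw [Pi.pow_apply, a1]; norm_num)
  have HQ : HasDerivAt (fun t : ℝ => prolongQ (φ (t • v)) (ψ (t • v)) x y p (J x y p)) _ 0 := HN
  -- Both sides of the symmetry condition are differentiated at t = 0 with the jet (x, y, p) held
  -- fixed.
  have e := (HQ.congr_of_eventuallyEq (EventuallyEq.symm hsym)).unique HJ
  simp only [Pi.add_apply, Pi.mul_apply, Pi.pow_apply, Pi.sub_apply, Pi.neg_apply, a0, b0, a1, a2,
    bx, b_y, bxx, bxy, byy, hP0] at e
  linear_combination e

end Generators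

/-! ### A six-dimensional group forces the invariants to vanish. -/

section InvariantsOfSymmetry

open AnGerm

theorem analyticAt_coordP {q : ℝ × ℝ × ℝ} : AnalyticAt ℝ (unc₃ fun _ _ p => p) q :=
  analyticAt_jet_p

theorem analyticAt_lift₁ {ξ : ℝ → ℝ} {x y p : ℝ} (h : AnalyticAt ℝ ξ x) :
    AnalyticAt ℝ (unc₃ fun x _ _ => ξ x) (x, y, p) :=
  AnalyticAt.fun_comp (f := fun z : ℝ × ℝ × ℝ => z.1) (x := (x, y, p)) h analyticAt_fst

theorem analyticAt_lift₂ {η : ℝ → ℝ → ℝ} {x y p : ℝ} (h : AnalyticAt ℝ (unc₂ η) (x, y)) :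
    AnalyticAt ℝ (unc₃ fun x y _ => η x y) (x, y, p) :=
  AnalyticAt.fun_comp (f := fun z : ℝ × ℝ × ℝ => (z.1, z.2.1)) (x := (x, y, p)) h
    (analyticAt_fst.prod analyticAt_jet_y)

theorem mk_unc₃_eq_zero {F : ℝ → ℝ → ℝ → ℝ} {q : ℝ × ℝ × ℝ} (h : AnalyticAt ℝ (unc₃ F) q)
    (hF : ∀ x y p, F x y p = 0) : mk (unc₃ F) h = 0 :=
  mk_eq_zero.2 (Eventually.of_forall fun _ => hF _ _ _)

variable {ξ : ℝ → ℝ} {η : ℝ → ℝ → ℝ} {J : ℝ → ℝ → ℝ → ℝ} {x y p : ℝ}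

theorem infSymmetry_of_determining_equation (hξ : AnalyticAt ℝ ξ x)
    (hη : AnalyticAt ℝ (unc₂ η) (x, y)) (hJ : AnalyticAt ℝ (unc₃ J) (x, y, p))
    (h : ∀ᶠ z : ℝ × ℝ × ℝ in 𝓝 (x, y, p),
      dy (dy η) z.1 z.2.1 * (z.2.2 * z.2.2)
        + (2 * dx (dy η) z.1 z.2.1 - deriv (deriv ξ) z.1) * z.2.2
        + dx (dx η) z.1 z.2.1 + (dy η z.1 z.2.1 - 2 * deriv ξ z.1) * J z.1 z.2.1 z.2.2
      = ξ z.1 * jetDx J z.1 z.2.1 z.2.2 + η z.1 z.2.1 * jetDy J z.1 z.2.1 z.2.2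
        + (dx η z.1 z.2.1 + z.2.2 * (dy η z.1 z.2.1 - deriv ξ z.1)) *
          jetDp J z.1 z.2.1 z.2.2) :
    InfSymmetry (D ex) (D ey) (D ep) (mk (unc₃ fun _ _ p => p) analyticAt_coordP)
      (mk (unc₃ J) hJ) (mk (unc₃ fun x _ _ => ξ x) (analyticAt_lift₁ (y := y) (p := p) hξ))
      (mk (unc₃ fun x y _ => η x y) (analyticAt_lift₂ (p := p) hη)) where
  yx := D_comm _ _
  px := D_comm _ _
  py := D_comm _ _
  xp := by
    rw [← mk_jetDx]
    exact mk_unc₃_eq_zero _ fun _ _ _ => by simp [jetDx]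
  yp := by
    rw [← mk_jetDy]
    exact mk_unc₃_eq_zero _ fun _ _ _ => by simp [jetDy]
  pp := by
    rw [← mk_jetDp, mk_eq_one]
    exact Eventually.of_forall fun _ => by simp [unc₃, jetDp]
  yξ := by
    rw [← mk_jetDy]
    exact mk_unc₃_eq_zero _ fun _ _ _ => by simp [jetDy]
  pξ := by
    rw [← mk_jetDp]
    exact mk_unc₃_eq_zero _ fun _ _ _ => by simp [jetDp]
  pη := by
    rw [← mk_jetDp]
    exact mk_unc₃_eq_zero _ fun _ _ _ => by simp [jetDp]
  eq := by
    have two : (2 : AnGerm (x, y, p)) = mk (fun _ => 2) analyticAt_const := rfl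
    simp only [← mk_jetDx, ← mk_jetDy, ← mk_jetDp, two, mk_add, mk_mul, sub_eq_add_neg, mk_neg]
    rw [mk_eq_mk]
    filter_upwards [h] with z hz
    simp only [sub_eq_add_neg] at hz
    exact hz

theorem D_mem_of_basis {q : ℝ × ℝ × ℝ} {I : Ideal (AnGerm q)} {a : AnGerm q} (hx : D ex a ∈ I)
    (hy : D ey a ∈ I) (hp : D ep a ∈ I) (v : ℝ × ℝ × ℝ) : D v a ∈ I := by
  have hv : v = v.1 • ex + v.2.1 • ey + v.2.2 • ep := by ext <;> simp
  rw [hv, D_add_left, D_add_left, D_smul_left, D_smul_left, D_smul_left]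
  exact add_mem (add_mem (Ideal.mul_mem_left _ _ hx) (Ideal.mul_mem_left _ _ hy))
    (Ideal.mul_mem_left _ _ hp)

/-- An infinitesimal fibre-preserving symmetry is determined by six of its derivatives at a
point. -/
theorem infSymmetry_eq_zero {q : ℝ × ℝ × ℝ} {P K ξ η : AnGerm q}
    (h : InfSymmetry (D ex) (D ey) (D ep) P K ξ η) (h₁ : ev q ξ = 0) (h₂ : ev q (D ex ξ) = 0)
    (h₃ : ev q (D ex (D ex ξ)) = 0) (h₄ : ev q η = 0) (h₅ : ev q (D ex η) = 0)
    (h₆ : ev q (D ey η) = 0) : ξ = 0 ∧ η = 0 := by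
  set s : Set (AnGerm q) := {ξ, D ex ξ, D ex (D ex ξ), η, D ex η, D ey η} with hs
  let _ : Invertible (2 : AnGerm q) := (isUnit_of_ev_ne_zero
    (by rw [map_ofNat]; norm_num)).invertible
  have mem : ∀ a ∈ s, a ∈ Ideal.span s := fun a ha => Ideal.subset_span ha
  have m₁ := mem ξ (by simp [hs])
  have m₂ := mem (D ex ξ) (by simp [hs])
  have m₃ := mem (D ex (D ex ξ)) (by simp [hs])
  have m₄ := mem η (by simp [hs])
  have m₅ := mem (D ex η) (by simp [hs])
  have m₆ := mem (D ey η) (by simp [hs])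
  obtain ⟨k₁, k₂, k₃, k₄⟩ := h.mem_ideal _ m₁ m₂ m₃ m₄ m₅ m₆
  have hev : ∀ a ∈ s, ev q a = 0 := by
    intro a ha
    simp only [hs, Set.mem_insert_iff, Set.mem_singleton_iff] at ha
    rcases ha with rfl | rfl | rfl | rfl | rfl | rfl <;> assumption
  have hD : ∀ v, ∀ a ∈ s, D v a ∈ Ideal.span s := by
    intro v a ha
    simp only [hs, Set.mem_insert_iff, Set.mem_singleton_iff] at ha
    rcases ha with rfl | rfl | rfl | rfl | rfl | rfl <;> refine D_mem_of_basis ?_ ?_ ?_ v <;>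
      first
      | assumption
      | (simp only [h.yx, h.px, h.py, h.yξ, h.pξ, h.pη, map_zero, zero_mem]; done)
      | (simp only [h.yx]; assumption)
  exact ⟨eq_zero_of_mem_span s hev hD m₁, eq_zero_of_mem_span s hev hD m₄⟩

/-- The linear functional `v ↦ ∂_v f (0, z)` of the parameter. -/
def paramDeriv {A E : Type*} [NormedAddCommGroup A] [NormedSpace ℝ A] [NormedAddCommGroup E]
    [NormedSpace ℝ E] (f : A × E → ℝ) (z : E) : A →ₗ[ℝ] ℝ :=
  (fderiv ℝ f (0, z)).toLinearMap ∘ₗ LinearMap.inl ℝ A E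

section

variable {n : ℕ} (φ : (Fin n → ℝ) → ℝ → ℝ) (ψ : (Fin n → ℝ) → ℝ → ℝ → ℝ)

/-- The six numbers that determine the infinitesimal symmetry of a Lie algebra element. -/
def generatorJet (x y : ℝ) : (Fin n → ℝ) →ₗ[ℝ] (Fin 6 → ℝ) :=
  LinearMap.pi ![paramDeriv (fam₁ φ) x, paramDeriv (fam₁ fun a => deriv (φ a)) x,
    paramDeriv (fam₁ fun a => deriv (deriv (φ a))) x, paramDeriv (fam₂ ψ) (x, y),
    paramDeriv (fam₂ fun a => dx (ψ a)) (x, y), paramDeriv (fam₂ fun a => dy (ψ a)) (x, y)]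

variable {φ ψ}

theorem generatorJet_apply (hφ : AnalyticAt ℝ (fam₁ φ) (0, x))
    (hψ : AnalyticAt ℝ (fam₂ ψ) (0, x, y)) (v : Fin n → ℝ) :
    generatorJet φ ψ x y v = ![gen₁ φ v x, deriv (gen₁ φ v) x, deriv (deriv (gen₁ φ v)) x,
      gen₂ ψ v x y, dx (gen₂ ψ v) x y, dy (gen₂ ψ v) x y] := by
  rw [deriv_deriv_gen₁ hφ, deriv_gen₁ hφ, dx_gen₂ hψ, dy_gen₂ hψ]
  ext i
  fin_cases i <;> rfl

end

/-- If an equation admits a six-dimensional group, then at every jet near the base jet there is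
an infinitesimal symmetry that fixes the jet and scales the fibre. -/
theorem exists_vertical_symmetry {x₀ y₀ p₀ : ℝ} (hJ : IsAnalyticODE J x₀ y₀ p₀)
    (h : AdmitsSymmetryGroup 6 J x₀ y₀ p₀) :
    ∀ᶠ q in 𝓝 (x₀, y₀, p₀), ∃ (hq : AnalyticAt ℝ (unc₃ J) q) (P ξ η : AnGerm q),
      InfSymmetry (D ex) (D ey) (D ep) P (mk (unc₃ J) hq) ξ η ∧
        InfSymmetry.IsVertical (ev q) (D ex) (D ey) P ξ η ∧
        P = mk (unc₃ fun _ _ p => p) analyticAt_coordP := by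
  obtain ⟨G, ⟨S⟩⟩ := h
  change AnalyticAt ℝ (unc₃ J) (x₀, y₀, p₀) at hJ
  have hfφ : AnalyticAt ℝ (fam₁ S.φ) (0, x₀) := S.analyticAt_φ
  have hfψ : AnalyticAt ℝ (fam₂ S.ψ) (0, x₀, y₀) := S.analyticAt_ψ
  have c1 : ContinuousAt (fun z : ℝ × ℝ => z.1) (x₀, y₀) := continuousAt_fst
  have base : ∀ᶠ z : ℝ × ℝ in 𝓝 (x₀, y₀), AnalyticAt ℝ (fam₁ S.φ) (0, z.1) ∧
      AnalyticAt ℝ (fam₂ S.ψ) (0, z) :=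
    (c1.eventually (eventually_section hfφ.eventually_analyticAt)).and
      (eventually_section hfψ.eventually_analyticAt)
  have hone : ∀ᶠ z : ℝ × ℝ in 𝓝 (x₀, y₀), S.φ 0 =ᶠ[𝓝 z.1] (fun t => t) ∧
      unc₂ (S.ψ 0) =ᶠ[𝓝 z] unc₂ fun _ t => t := by
    filter_upwards [S.one_act.eventually_nhds] with z hz
    refine ⟨?_, hz.mono fun w hw => hw.2⟩
    have : Tendsto (fun t : ℝ => (t, z.2)) (𝓝 z.1) (𝓝 z) := (Continuous.prodMk_left z.2).tendsto z.1
    exact (this.eventually hz).mono fun t ht => ht.1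
  -- One ball serves all nearby jets: a generator that vanishes near some point of it vanishes on
  -- the whole ball, in particular near (x₀, y₀), where effectivity is assumed.
  obtain ⟨r, hr, Hr⟩ := Metric.eventually_nhds_iff_ball.1 base
  have hsym : ∀ᶠ q : ℝ × ℝ × ℝ in 𝓝 (x₀, y₀, p₀), ∀ᶠ a in 𝓝 (0 : Fin 6 → ℝ),
      MapsODEAt (S.φ a) (S.ψ a) J J q.1 q.2.1 q.2.2 := by
    have := S.symmetry
    rw [nhds_prod_eq, eventually_swap_iff] at this
    exact this.curry
  -- The neighbourhood is uniform in v, because v is chosen only after the jet.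
  have hdet : ∀ᶠ z : ℝ × ℝ × ℝ in 𝓝 (x₀, y₀, p₀), ∀ v : Fin 6 → ℝ,
      dy (dy (gen₂ S.ψ v)) z.1 z.2.1 * (z.2.2 * z.2.2)
        + (2 * dx (dy (gen₂ S.ψ v)) z.1 z.2.1 - deriv (deriv (gen₁ S.φ v)) z.1) * z.2.2
        + dx (dx (gen₂ S.ψ v)) z.1 z.2.1
        + (dy (gen₂ S.ψ v) z.1 z.2.1 - 2 * deriv (gen₁ S.φ v) z.1) * J z.1 z.2.1 z.2.2
      = gen₁ S.φ v z.1 * jetDx J z.1 z.2.1 z.2.2 + gen₂ S.ψ v z.1 z.2.1 * jetDy J z.1 z.2.1 z.2.2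
        + (dx (gen₂ S.ψ v) z.1 z.2.1 + z.2.2 * (dy (gen₂ S.ψ v) z.1 z.2.1
          - deriv (gen₁ S.φ v) z.1)) * jetDp J z.1 z.2.1 z.2.2 := by
    filter_upwards [eventually_jet base p₀, eventually_jet hone p₀, hJ.eventually_analyticAt, hsym]
      with z h1 h2 h3 h4 v
    have t : Tendsto (fun t : ℝ => t • v) (𝓝 0) (𝓝 0) := by
      have : Continuous fun t : ℝ => t • v := by fun_prop
      simpa using this.tendsto 0
    exact determining_equation h1.1 h1.2 h3 h2.1 h2.2 (t.eventually h4)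
  filter_upwards [hdet.eventually_nhds, hJ.eventually_analyticAt,
    eventually_jet (Metric.ball_mem_nhds (x₀, y₀) hr) p₀] with ⟨x, y, p⟩ hd hq hball
  obtain ⟨aφ, aψ⟩ := Hr _ hball
  dsimp only at aφ aψ
  have inf := fun v : Fin 6 → ℝ => infSymmetry_of_determining_equation
    (analyticAt_gen₁ (v := v) aφ) (analyticAt_gen₂ (v := v) aψ) hq (hd.mono fun z hz => hz v)
  have hinj : Function.Injective (generatorJet S.φ S.ψ x y) := by
    rw [← LinearMap.ker_eq_bot, LinearMap.ker_eq_bot']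
    intro v hv
    rw [generatorJet_apply aφ aψ] at hv
    have z0 := congrFun hv 0
    have z1 := congrFun hv 1
    have z2 := congrFun hv 2
    have z3 := congrFun hv 3
    have z4 := congrFun hv 4
    have z5 := congrFun hv 5
    obtain ⟨e1, e2⟩ := infSymmetry_eq_zero (inf v) z0 (by rw [← mk_jetDx]; exact z1)
      (by rw [← mk_jetDx, ← mk_jetDx]; exact z2) z3 (by rw [← mk_jetDx]; exact z4)
      (by rw [← mk_jetDy]; exact z5)
    rw [mk_eq_zero] at e1 e2
    have slice : Tendsto (fun w : ℝ × ℝ => (w.1, w.2, p)) (𝓝 (x, y)) (𝓝 (x, y, p)) := by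
      have : Continuous fun w : ℝ × ℝ => (w.1, w.2, p) := by fun_prop
      exact this.tendsto (x, y)
    have f1 : ∀ᶠ w : ℝ × ℝ in 𝓝 (x, y), gen₁ S.φ v w.1 = 0 := slice.eventually e1
    have f2 : ∀ᶠ w : ℝ × ℝ in 𝓝 (x, y), unc₂ (gen₂ S.ψ v) w = 0 := slice.eventually e2
    have hpre : IsPreconnected (Metric.ball ((x₀, y₀) : ℝ × ℝ) r) :=
      (convex_ball _ _).isPreconnected
    have an1 : AnalyticOnNhd ℝ (fun w : ℝ × ℝ => gen₁ S.φ v w.1) (Metric.ball (x₀, y₀) r) :=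
      fun w hw => analyticAt_base (analyticAt_gen₁ (Hr w hw).1)
    have an2 : AnalyticOnNhd ℝ (unc₂ (gen₂ S.ψ v)) (Metric.ball (x₀, y₀) r) :=
      fun w hw => analyticAt_gen₂ (Hr w hw).2
    have g1 := an1.eqOn_zero_of_preconnected_of_eventuallyEq_zero hpre hball f1
    have g2 := an2.eqOn_zero_of_preconnected_of_eventuallyEq_zero hpre hball f2
    refine S.eq_zero_of_generator ?_
    filter_upwards [Metric.ball_mem_nhds (x₀, y₀) hr,
      eventually_section S.analyticAt_act.eventually_analyticAt] with w hw hw'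
    have k1 := hasDerivAt_gen₁ (v := v) (Hr w hw).1
    have k2 := hasDerivAt_gen₂ (v := v) (x := w.1) (y := w.2) (Hr w hw).2
    have k3 : gen₁ S.φ v w.1 = 0 := g1 hw
    have k4 : gen₂ S.ψ v w.1 w.2 = 0 := g2 hw
    rw [k3] at k1
    rw [k4] at k2
    have hp : HasDerivAt (fun t : ℝ => (t • v, w)) (v, 0) 0 := by
      simpa using ((hasDerivAt_id (0 : ℝ)).smul_const v).prodMk (hasDerivAt_const 0 w)
    have hm : HasFDerivAt S.act (fderiv ℝ S.act (0, w)) ((0 : ℝ) • v, w) := by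
      rw [zero_smul]
      exact hw'.differentiableAt.hasFDerivAt
    have k5 : HasDerivAt (fun t : ℝ => S.act (t • v, w)) ((0 : ℝ), (0 : ℝ)) 0 := k1.prodMk k2
    have k6 : HasDerivAt (fun t : ℝ => S.act (t • v, w)) (fderiv ℝ S.act (0, w) (v, 0)) 0 :=
      HasFDerivAt.comp_hasDerivAt (f := fun t : ℝ => (t • v, w)) 0 hm hp
    exact k6.unique k5
  -- Dimension six enters here. With η_x = -p and η_y = 1 the p-component η_x + p(η_y - ξ_x) of the
  -- prolonged field vanishes, so the jet is fixed.
  obtain ⟨v, hv⟩ := LinearMap.injective_iff_surjective.1 hinj ![0, 0, 0, 0, -p, 1]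
  rw [generatorJet_apply aφ aψ] at hv
  refine ⟨hq, _, _, _, inf v, ⟨?_, ?_, ?_, ?_, ?_, ?_⟩, rfl⟩
  · exact congrFun hv 0
  · rw [← mk_jetDx]; exact congrFun hv 1
  · rw [← mk_jetDx, ← mk_jetDx]; exact congrFun hv 2
  · exact congrFun hv 3
  · rw [← mk_jetDx]; exact congrFun hv 4
  · rw [← mk_jetDy]; exact congrFun hv 5

theorem invariantsVanish_of_admitsSymmetryGroup {x₀ y₀ p₀ : ℝ} (hJ : IsAnalyticODE J x₀ y₀ p₀)
    (h : AdmitsSymmetryGroup 6 J x₀ y₀ p₀) : InvariantsVanish J x₀ y₀ p₀ := by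
  have H := exists_vertical_symmetry hJ h
  have h3 : ∀ᶠ q : ℝ × ℝ × ℝ in 𝓝 (x₀, y₀, p₀), jetDp (jetDp (jetDp J)) q.1 q.2.1 q.2.2 = 0 := by
    filter_upwards [H] with q hq
    obtain ⟨hq, P, ξ, η, hs, hv, -⟩ := hq
    have := hs.eval_ppp hv
    rwa [← mk_jetDp, ← mk_jetDp, ← mk_jetDp] at this
  have h2 : ∀ᶠ q : ℝ × ℝ × ℝ in 𝓝 (x₀, y₀, p₀),
      totalD J (jetDp (jetDp J)) q.1 q.2.1 q.2.2 - jetDy (jetDp J) q.1 q.2.1 q.2.2 = 0 := by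
    -- A vertical symmetry is available at every nearby jet, so each invariant vanishes on a
    -- neighbourhood and may be differentiated when the next is treated.
    filter_upwards [H, h3.eventually_nhds] with q hq hq3
    obtain ⟨hq, P, ξ, η, hs, hv, hP⟩ := hq
    have e3 : D ep (D ep (D ep (mk (unc₃ J) hq))) = 0 := by
      rw [← mk_jetDp, ← mk_jetDp, ← mk_jetDp, mk_eq_zero]
      exact hq3
    have := hs.eval_second hv e3
    rw [hP] at this
    simp only [← mk_jetDp, ← mk_jetDx, ← mk_jetDy, map_add, map_sub, map_mul, ev_mk] at this
    exact this
  filter_upwards [H, h3.eventually_nhds, h2.eventually_nhds] with q hq hq3 hq2 A B C hA hB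
  obtain ⟨hq, P, ξ, η, hs, hv, hP⟩ := hq
  have e3 : D ep (D ep (D ep (mk (unc₃ J) hq))) = 0 := by
    rw [← mk_jetDp, ← mk_jetDp, ← mk_jetDp, mk_eq_zero]
    exact hq3
  have e2 : D ex (D ep (D ep (mk (unc₃ J) hq))) + P * D ey (D ep (D ep (mk (unc₃ J) hq)))
      + mk (unc₃ J) hq * D ep (D ep (D ep (mk (unc₃ J) hq))) - D ey (D ep (mk (unc₃ J) hq)) = 0 := by
    rw [hP]
    simp only [← mk_jetDp, ← mk_jetDx, ← mk_jetDy, mk_add, mk_mul, mk_neg, sub_eq_add_neg]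
    rw [mk_eq_zero]
    simp only [sub_eq_add_neg] at hq2
    exact hq2
  have := hs.eval_third hv e3 e2
  rw [hP] at this
  simp only [← mk_jetDp, ← mk_jetDx, ← mk_jetDy, map_add, map_sub, map_mul, ev_mk,
    map_ofNat] at this
  have i2 : invI2 J A B C q.1 q.2.1 q.2.2 = 0 := by
    rw [invI2, hq2.self_of_nhds, mul_zero]
  refine ⟨?_, i2, ?_⟩
  · rw [invI1, hq3.self_of_nhds, mul_zero]
  · rw [invI3, i2, mul_zero, zero_add]
    exact mul_eq_zero_of_right _ this

end InvariantsOfSymmetry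

/-! ### Analytic primitives, with parameters. -/

section Primitive

variable {E : Type*} [NormedAddCommGroup E] [NormedSpace ℝ E]

theorem continuous_compContinuousLinearMap_const {n : ℕ} (g : E [×n]→L[ℝ] ℝ) {A : ℝ → E →L[ℝ] E}
    (hA : Continuous A) : Continuous fun s => g.compContinuousLinearMap fun _ : Fin n => A s := by
  have h := (ContinuousMultilinearMap.compContinuousLinearMapContinuousMultilinear ℝ
    (fun _ : Fin n => E) (fun _ : Fin n => E) ℝ).cont
  exact (h.comp (continuous_pi fun _ : Fin n => hA)).clm_apply continuous_const

/-- The average of an analytic function along a family of contractions is analytic. -/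
theorem analyticAt_integral_comp {f : E → ℝ} {z : E} (hf : AnalyticAt ℝ f z) {A : ℝ → E →L[ℝ] E}
    (hA : Continuous A) (hA1 : ∀ s ∈ Set.uIoc (0 : ℝ) 1, ‖A s‖ ≤ 1) :
    AnalyticAt ℝ (fun w => ∫ s in (0 : ℝ)..1, f (z + A s (w - z))) z := by
  obtain ⟨p, r, hp⟩ := hf
  -- The power series is integrated term by term. As the A s are contractions, no coefficient grows
  -- in norm and the radius does not shrink.
  let q : FormalMultilinearSeries ℝ E ℝ := fun n =>
    ∫ s in (0 : ℝ)..1, (p n).compContinuousLinearMap fun _ => A s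
  have hc := fun n => continuous_compContinuousLinearMap_const (p n) hA
  have hnorm : ∀ n, ‖q n‖ ≤ ‖p n‖ := by
    intro n
    have := intervalIntegral.norm_integral_le_of_norm_le_const (a := (0 : ℝ)) (b := 1)
      (f := fun s => (p n).compContinuousLinearMap fun _ => A s) (C := ‖p n‖) fun s hs => by
        refine (ContinuousMultilinearMap.norm_compContinuousLinearMap_le _ _).trans ?_
        refine mul_le_of_le_one_right (norm_nonneg _) ?_
        exact Finset.prod_le_one (fun _ _ => norm_nonneg _) fun _ _ => hA1 s hs
    simpa using this
  refine ⟨q, r, hp.r_le.trans (FormalMultilinearSeries.radius_le_of_le hnorm), hp.r_pos, ?_⟩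
  intro w hw
  have hqw : ∀ n, q n (fun _ => w) = ∫ s in (0 : ℝ)..1, p n fun _ => A s w := by
    intro n
    have := (ContinuousMultilinearMap.apply ℝ (fun _ : Fin n => E) ℝ
      (fun _ => w)).intervalIntegral_comp_comm ((hc n).intervalIntegrable (μ := MeasureTheory.volume) 0 1)
    simpa using this.symm
  simp only [hqw, add_sub_cancel_left]
  have hw' : (‖w‖₊ : ENNReal) < r := by
    simpa [edist_zero_right, enorm_eq_nnnorm] using hw
  have hsum : Summable fun n => ‖p n‖ * ‖w‖ ^ n := by
    have := p.summable_norm_mul_pow (r := ‖w‖₊) (hw'.trans_le hp.r_le)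
    simpa using this
  have hle : ∀ s ∈ Set.uIoc (0 : ℝ) 1, ‖A s w‖ ≤ ‖w‖ := fun s hs =>
    ((A s).le_opNorm w).trans (mul_le_of_le_one_left (norm_nonneg _) (hA1 s hs))
  refine intervalIntegral.hasSum_integral_of_dominated_convergence
    (fun n _ => ‖p n‖ * ‖w‖ ^ n) (fun n => ?_) (fun n => ?_) ?_ ?_ ?_
  · have : Continuous fun s => p n fun _ => A s w :=
      (p n).cont.comp (continuous_pi fun _ => hA.clm_apply continuous_const)
    exact this.aestronglyMeasurable
  · refine Eventually.of_forall fun s hs => ((p n).le_opNorm _).trans ?_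
    rw [Finset.prod_const, Finset.card_univ, Fintype.card_fin]
    gcongr
    exact hle s hs
  · exact Eventually.of_forall fun _ _ => hsum
  · exact intervalIntegrable_const
  · refine Eventually.of_forall fun s hs => hp.hasSum ?_
    have : ‖A s w‖₊ ≤ ‖w‖₊ := hle s hs
    simpa [edist_zero_right, enorm_eq_nnnorm] using
      (ENNReal.coe_le_coe.2 this).trans_lt hw'

/-- An analytic function of two variables has an analytic primitive in the second variable. -/
theorem exists_primitive_snd {f : ℝ → ℝ → ℝ} {x₀ y₀ : ℝ} (hf : AnalyticAt ℝ (unc₂ f) (x₀, y₀)) :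
    ∃ F : ℝ → ℝ → ℝ, AnalyticAt ℝ (unc₂ F) (x₀, y₀) ∧ (∀ x, F x y₀ = 0) ∧
      ∀ᶠ z : ℝ × ℝ in 𝓝 (x₀, y₀), dy F z.1 z.2 = f z.1 z.2 := by
  refine ⟨fun x y => ∫ t in y₀..y, f x t, ?_, fun x => intervalIntegral.integral_same, ?_⟩
  -- The substitution t = y₀ + s(y - y₀) turns the primitive into y - y₀ times an average over the
  -- contractions (u, v) ↦ (u, sv).
  · let A : ℝ → ℝ × ℝ →L[ℝ] ℝ × ℝ := fun s =>
      (ContinuousLinearMap.fst ℝ ℝ ℝ).prod (s • ContinuousLinearMap.snd ℝ ℝ ℝ)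
    have hA : Continuous A := by
      have : A = fun s => (ContinuousLinearMap.fst ℝ ℝ ℝ).prod 0 +
          s • (0 : ℝ × ℝ →L[ℝ] ℝ).prod (ContinuousLinearMap.snd ℝ ℝ ℝ) := by
        funext s
        ext <;> simp [A]
      rw [this]
      fun_prop
    have hA1 : ∀ s ∈ Set.uIoc (0 : ℝ) 1, ‖A s‖ ≤ 1 := by
      intro s hs
      rw [Set.uIoc_of_le zero_le_one] at hs
      refine ContinuousLinearMap.opNorm_le_bound _ zero_le_one fun w => ?_
      rw [one_mul]
      refine max_le (norm_fst_le w) ?_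
      change ‖s • w.2‖ ≤ ‖w‖
      rw [norm_smul, Real.norm_of_nonneg hs.1.le]
      exact (mul_le_of_le_one_left (norm_nonneg _) hs.2).trans (norm_snd_le w)
    have h := analyticAt_integral_comp hf hA hA1
    have h2 : AnalyticAt ℝ (fun w : ℝ × ℝ => w.2 - y₀) (x₀, y₀) :=
      analyticAt_snd.sub analyticAt_const
    refine (h2.mul h).congr (Eventually.of_forall fun w => ?_)
    have := intervalIntegral.smul_integral_comp_add_mul (a := (0 : ℝ)) (b := 1) (f w.1)
      (w.2 - y₀) y₀
    simp only [mul_zero, add_zero, mul_one, add_sub_cancel, smul_eq_mul] at this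
    rw [unc₂, ← this]
    simp only [Pi.mul_apply]
    congr 1
    refine intervalIntegral.integral_congr fun s _ => ?_
    simp [unc₂, A, mul_comm]
  · obtain ⟨r, hr, H⟩ := Metric.eventually_nhds_iff_ball.1 hf.eventually_analyticAt
    filter_upwards [Metric.ball_mem_nhds (x₀, y₀) hr] with ⟨x, y⟩ hz
    rw [← ball_prod_same] at hz H
    have hcont : ContinuousOn (f x) (Metric.ball y₀ r) := fun t ht =>
      ((hasDerivAt_dy (H (x, t) ⟨hz.1, ht⟩)).continuousAt).continuousWithinAt
    have hsub : Set.uIcc y₀ y ⊆ Metric.ball y₀ r :=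
      (convex_ball y₀ r).ordConnected.uIcc_subset (Metric.mem_ball_self hr) hz.2
    exact (intervalIntegral.integral_hasDerivAt_right
      (hcont.mono hsub).intervalIntegrable
      (hcont.stronglyMeasurableAtFilter Metric.isOpen_ball y hz.2)
      (hcont.continuousAt (Metric.isOpen_ball.mem_nhds hz.2))).deriv

/-- An analytic function of one variable has an analytic primitive. -/
theorem exists_primitive {g : ℝ → ℝ} {x₀ : ℝ} (hg : AnalyticAt ℝ g x₀) (c : ℝ) :
    ∃ F : ℝ → ℝ, AnalyticAt ℝ F x₀ ∧ F x₀ = c ∧ ∀ᶠ x in 𝓝 x₀, deriv F x = g x := by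
  have hf : AnalyticAt ℝ (unc₂ fun _ y => g y) (0, x₀) :=
    AnalyticAt.fun_comp (f := fun z : ℝ × ℝ => z.2) (x := (0, x₀)) hg analyticAt_snd
  obtain ⟨F, hF, hF0, hF'⟩ := exists_primitive_snd hf
  have hi : AnalyticAt ℝ (fun x : ℝ => ((0 : ℝ), x)) x₀ := analyticAt_const.prod analyticAt_id
  refine ⟨fun x => c + F 0 x, analyticAt_const.add
    (AnalyticAt.fun_comp (f := fun x : ℝ => ((0 : ℝ), x)) hF hi), by simp [hF0], ?_⟩
  filter_upwards [(hi.continuousAt.tendsto.eventually hF')] with x hx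
  rw [deriv_const_add]
  exact hx

end Primitive

/-! ### Analytic solutions of u'' = q u by power series. -/

section LinearODE

/-- The derivatives at the base point of the solution of `u'' = q u`, `u = 1`, `u' = 0`, in terms
of those of `q`. -/
def linearODEDeriv (q : ℕ → ℝ) : ℕ → ℝ
  | 0 => 1
  | 1 => 0
  | n + 2 => ∑ k : Fin (n + 1), n.choose k * q k * linearODEDeriv q (n - k)

/-- A majorant estimate. Since M ≤ B², each of the n + 1 terms of the recursion is at most n!
B^(n+2), because the binomial coefficient cancels the two factorials; and (n + 1) n! ≤ (n + 2)!. -/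
theorem linearODEDeriv_bound {q : ℕ → ℝ} {M R B : ℝ} (hR : 0 ≤ R) (hB : 1 ≤ B)
    (hRB : R ≤ B) (hMB : M ≤ B) (hq : ∀ n, |q n| ≤ n.factorial * (M * R ^ n)) (n : ℕ) :
    |linearODEDeriv q n| ≤ n.factorial * B ^ n := by
  induction n using Nat.strong_induction_on with
  | _ n ih =>
    match n with
    | 0 => simp [linearODEDeriv]
    | 1 => simp [linearODEDeriv]; linarith
    | n + 2 =>
      rw [linearODEDeriv]
      refine (Finset.abs_sum_le_sum_abs _ _).trans ?_
      have key : ∀ k : Fin (n + 1), |(n.choose k : ℝ) * q k * linearODEDeriv q (n - k)|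
          ≤ n.factorial * B ^ (n + 2) := by
        intro k
        have hk : (k : ℕ) ≤ n := Nat.lt_succ_iff.1 k.2
        have e : (n.choose k : ℝ) * k.1.factorial * (n - k.1).factorial = n.factorial := by
          exact_mod_cast Nat.choose_mul_factorial_mul_factorial hk
        have h1 := ih (n - k) (by omega)
        have h2 : M * R ^ (k : ℕ) ≤ B ^ 2 * B ^ (k : ℕ) := by
          gcongr
          nlinarith
        rw [abs_mul, abs_mul, Nat.abs_cast]
        calc (n.choose k : ℝ) * |q k| * |linearODEDeriv q (n - k)|
            ≤ n.choose k * (k.1.factorial * (B ^ 2 * B ^ (k : ℕ))) *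
              ((n - k.1).factorial * B ^ (n - k.1)) := by
              gcongr
              exact (hq k).trans (by gcongr)
          _ = ((n.choose k : ℝ) * k.1.factorial * (n - k.1).factorial) *
              (B ^ 2 * (B ^ (k : ℕ) * B ^ (n - k.1))) := by ring
          _ = n.factorial * B ^ (n + 2) := by
              rw [e, ← pow_add, Nat.add_sub_cancel' hk]
              ring
      refine (Finset.sum_le_sum fun k _ => key k).trans ?_
      rw [Finset.sum_const, Finset.card_univ, Fintype.card_fin, nsmul_eq_mul, ← mul_assoc]
      gcongr
      rw [← Nat.cast_mul, ← Nat.factorial_succ]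
      exact_mod_cast Nat.factorial_le (by omega)

theorem exists_bound_iteratedDeriv {q : ℝ → ℝ} {x₀ : ℝ} (hq : AnalyticAt ℝ q x₀) :
    ∃ M R : ℝ, 0 < M ∧ 0 < R ∧ ∀ n, |iteratedDeriv n q x₀| ≤ n.factorial * (M * R ^ n) := by
  obtain ⟨M, R, hM, hR, h⟩ :=
    FormalMultilinearSeries.le_mul_pow_of_radius_pos _ hq.hasFPowerSeriesAt.radius_pos
  refine ⟨M, R, hM, hR, fun n => ?_⟩
  have := h n
  rw [FormalMultilinearSeries.ofScalars_norm, norm_div, Real.norm_natCast, Real.norm_eq_abs,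
    div_le_iff₀ (by positivity)] at this
  rwa [mul_comm]

/-- Coefficients of at most geometric growth are the derivatives of an analytic function. -/
theorem exists_analyticAt_iteratedDeriv {d : ℕ → ℝ} {B : ℝ} (hB : 0 < B)
    (hd : ∀ n, |d n| ≤ n.factorial * B ^ n) (x₀ : ℝ) :
    ∃ u : ℝ → ℝ, AnalyticAt ℝ u x₀ ∧ ∀ n, iteratedDeriv n u x₀ = d n := by
  let p := FormalMultilinearSeries.ofScalars ℝ fun n => d n / n.factorial
  have hr : 0 < p.radius := by
    refine lt_of_lt_of_le ?_ (p.le_radius_of_bound 1 (r := ⟨B⁻¹, by positivity⟩) fun n => ?_)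
    · exact ENNReal.coe_pos.2 (by exact_mod_cast inv_pos.2 hB)
    · rw [FormalMultilinearSeries.ofScalars_norm, norm_div, Real.norm_natCast, Real.norm_eq_abs]
      change |d n| / n.factorial * B⁻¹ ^ n ≤ 1
      rw [inv_pow, ← div_eq_mul_inv, div_div, div_le_one (by positivity)]
      exact hd n
  have hp : HasFPowerSeriesAt (fun x => p.sum (x - x₀)) p x₀ := by
    have := (p.hasFPowerSeriesOnBall hr).comp_sub x₀
    rw [zero_add] at this
    exact this.hasFPowerSeriesAt
  refine ⟨_, hp.analyticAt, fun n => ?_⟩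
  have h1 := hp.eq_formalMultilinearSeries hp.analyticAt.hasFPowerSeriesAt
  have h2 := congrArg (fun P => P.coeff n) h1
  simp only [p, FormalMultilinearSeries.coeff_ofScalars] at h2
  have : (n.factorial : ℝ) ≠ 0 := by positivity
  exact ((div_left_inj' this).1 h2).symm

theorem exists_linearODE {q : ℝ → ℝ} {x₀ : ℝ} (hq : AnalyticAt ℝ q x₀) :
    ∃ u : ℝ → ℝ, AnalyticAt ℝ u x₀ ∧ u x₀ = 1 ∧
      ∀ᶠ x in 𝓝 x₀, deriv (deriv u) x = q x * u x := by
  obtain ⟨M, R, hM, hR, h⟩ := exists_bound_iteratedDeriv hq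
  have hd := linearODEDeriv_bound (B := max 1 (max R M)) hR.le (le_max_left _ _)
    ((le_max_left _ _).trans (le_max_right _ _)) ((le_max_right _ _).trans (le_max_right _ _)) h
  obtain ⟨u, hu, hud⟩ := exists_analyticAt_iteratedDeriv
    (lt_of_lt_of_le one_pos (le_max_left _ _)) hd x₀
  refine ⟨u, hu, by simpa [linearODEDeriv] using hud 0, ?_⟩
  -- The recursion is the Leibniz rule for q u, so all Taylor coefficients of u'' - q u are zero.
  have hg : AnalyticAt ℝ (deriv (deriv u) - q * u) x₀ := hu.deriv.deriv.sub (hq.mul hu)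
  refine (eventually_eq_zero_of_iteratedDeriv hg fun n => ?_).mono fun x hx => by
    simpa [sub_eq_zero] using hx
  rw [iteratedDeriv_sub hu.deriv.deriv.contDiffAt (hq.mul hu).contDiffAt,
    iteratedDeriv_mul hq.contDiffAt hu.contDiffAt, ← iteratedDeriv_succ', ← iteratedDeriv_succ',
    hud, linearODEDeriv, ← Fin.sum_univ_eq_sum_range (fun k => (n.choose k : ℝ) *
      iteratedDeriv k q x₀ * iteratedDeriv (n - k) u x₀)]
  simp [hud]

end LinearODE

/-! ### The invariants of an equation quadratic in p. -/

section QuadraticAlgebra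

variable {R : Type*} [CommRing R] {X Y P : Derivation ℤ R R}

/-- The second invariant expression reduces to 2a_x - b_y. In the third the p² terms cancel
identically and the coefficient of p is ∂_y of 2a_x - b_y, so only the term free of p is new. -/
theorem relations_of_quadratic (yx : ∀ f, Y (X f) = X (Y f)) (py : ∀ f, P (Y f) = Y (P f))
    {a b c p : R} (xp : X p = 0) (yp : Y p = 0) (pp : P p = 1) (pa : P a = 0) (pb : P b = 0)
    (pc : P c = 0) {K : R} (hK : K = a * (p * p) + b * p + c)
    (e₂ : X (P (P K)) + p * Y (P (P K)) + K * P (P (P K)) - Y (P K) = 0)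
    (e₃ : X (Y (P K)) + p * Y (Y (P K)) + K * P (Y (P K)) + P (P K) * Y K - Y (P K) * P K
      - 2 * Y (Y K) = 0) :
    2 * X a = Y b ∧ X (Y b) + 2 * (c * Y a + a * Y c) - b * Y b - 2 * Y (Y c) = 0 := by
  have h₁ : P K = 2 * a * p + b := by
    rw [hK]
    simp only [map_add, Derivation.leibniz, smul_eq_mul, pp, pa, pb, pc]
    ring
  have h₂ : P (P K) = 2 * a := by
    rw [h₁]
    simp only [map_add, Derivation.leibniz, smul_eq_mul, derivation_two, pp, pa, pb]
    ring
  have h₃ : P (P (P K)) = 0 := by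
    rw [h₂]
    simp only [Derivation.leibniz, smul_eq_mul, derivation_two, pa]
    ring
  have l : 2 * X a = Y b := by
    rw [h₃, h₂, h₁] at e₂
    simp only [map_add, Derivation.leibniz, smul_eq_mul, derivation_two, yp] at e₂
    linear_combination e₂
  refine ⟨l, ?_⟩
  have l' := congrArg Y l
  simp only [Derivation.leibniz, smul_eq_mul, derivation_two, yx] at l'
  rw [py, h₂, h₁, hK] at e₃
  simp only [map_add, Derivation.leibniz, smul_eq_mul, derivation_two, yp, xp, map_zero] at e₃
  linear_combination e₃ - p * l'

end QuadraticAlgebra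

/-! ### From vanishing invariants to quadratic equations and their relations. -/

section Quadratic

open AnGerm

variable {J : ℝ → ℝ → ℝ → ℝ} {x₀ y₀ p₀ : ℝ}

theorem InvariantsVanish.jetDp_eq_zero (h : InvariantsVanish J x₀ y₀ p₀) :
    ∀ᶠ z : ℝ × ℝ × ℝ in 𝓝 (x₀, y₀, p₀), jetDp (jetDp (jetDp J)) z.1 z.2.1 z.2.2 = 0 := by
  filter_upwards [h] with z hz
  have := (hz 1 1 0 one_ne_zero one_ne_zero).1
  rw [invI1] at this
  linarith

theorem eventually_eq_of_jetDp_eq_zero {F : ℝ → ℝ → ℝ → ℝ}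
    (hF : AnalyticAt ℝ (unc₃ F) (x₀, y₀, p₀))
    (h : ∀ᶠ z : ℝ × ℝ × ℝ in 𝓝 (x₀, y₀, p₀), jetDp F z.1 z.2.1 z.2.2 = 0) :
    ∀ᶠ z : ℝ × ℝ × ℝ in 𝓝 (x₀, y₀, p₀), F z.1 z.2.1 z.2.2 = F z.1 z.2.1 p₀ := by
  obtain ⟨r, hr, H⟩ := Metric.eventually_nhds_iff_ball.1 (hF.eventually_analyticAt.and h)
  filter_upwards [Metric.ball_mem_nhds _ hr] with ⟨x, y, p⟩ hz
  rw [← ball_prod_same, ← ball_prod_same] at hz H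
  have hd : ∀ t ∈ Metric.ball p₀ r, HasDerivAt (F x y) 0 t := by
    intro t ht
    obtain ⟨h1, h2⟩ := H (x, y, t) ⟨hz.1, hz.2.1, ht⟩
    have := hasDerivAt_jetDp h1
    rwa [h2] at this
  exact Metric.isOpen_ball.is_const_of_deriv_eq_zero (convex_ball p₀ r).isPreconnected
    (fun t ht => (hd t ht).differentiableAt.differentiableWithinAt) (fun t ht => (hd t ht).deriv)
    hz.2.2 (Metric.mem_ball_self hr)

theorem eventually_eq_of_dy_eq_zero {f : ℝ → ℝ → ℝ} (hf : AnalyticAt ℝ (unc₂ f) (x₀, y₀))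
    (h : ∀ᶠ z : ℝ × ℝ in 𝓝 (x₀, y₀), dy f z.1 z.2 = 0) :
    ∀ᶠ z : ℝ × ℝ in 𝓝 (x₀, y₀), f z.1 z.2 = f z.1 y₀ := by
  obtain ⟨r, hr, H⟩ := Metric.eventually_nhds_iff_ball.1 (hf.eventually_analyticAt.and h)
  filter_upwards [Metric.ball_mem_nhds _ hr] with ⟨x, y⟩ hz
  rw [← ball_prod_same] at hz H
  have hd : ∀ t ∈ Metric.ball y₀ r, HasDerivAt (f x) 0 t := by
    intro t ht
    obtain ⟨h1, h2⟩ := H (x, t) ⟨hz.1, ht⟩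
    have := hasDerivAt_dy h1
    rwa [h2] at this
  exact Metric.isOpen_ball.is_const_of_deriv_eq_zero (convex_ball y₀ r).isPreconnected
    (fun t ht => (hd t ht).differentiableAt.differentiableWithinAt) (fun t ht => (hd t ht).deriv)
    hz.2 (Metric.mem_ball_self hr)

theorem eventually_eq_of_dx_eq_zero {f : ℝ → ℝ → ℝ} (hf : AnalyticAt ℝ (unc₂ f) (x₀, y₀))
    (h : ∀ᶠ z : ℝ × ℝ in 𝓝 (x₀, y₀), dx f z.1 z.2 = 0) :
    ∀ᶠ z : ℝ × ℝ in 𝓝 (x₀, y₀), f z.1 z.2 = f x₀ z.2 := by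
  obtain ⟨r, hr, H⟩ := Metric.eventually_nhds_iff_ball.1 (hf.eventually_analyticAt.and h)
  filter_upwards [Metric.ball_mem_nhds _ hr] with ⟨x, y⟩ hz
  rw [← ball_prod_same] at hz H
  have hd : ∀ t ∈ Metric.ball x₀ r, HasDerivAt (fun s => f s y) 0 t := by
    intro t ht
    obtain ⟨h1, h2⟩ := H (t, y) ⟨ht, hz.2⟩
    have := hasDerivAt_dx h1
    rwa [h2] at this
  exact Metric.isOpen_ball.is_const_of_deriv_eq_zero (convex_ball x₀ r).isPreconnected
    (fun t ht => (hd t ht).differentiableAt.differentiableWithinAt) (fun t ht => (hd t ht).deriv)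
    hz.1 (Metric.mem_ball_self hr)

theorem analyticAt_slice {F : ℝ → ℝ → ℝ → ℝ} (hF : AnalyticAt ℝ (unc₃ F) (x₀, y₀, p₀)) :
    AnalyticAt ℝ (unc₂ fun x y => F x y p₀) (x₀, y₀) :=
  AnalyticAt.fun_comp (f := fun z : ℝ × ℝ => (z.1, z.2, p₀)) (x := (x₀, y₀)) hF
    (analyticAt_fst.prod (analyticAt_snd.prod analyticAt_const))

theorem eventually_slice {Q : ℝ × ℝ × ℝ → Prop} (h : ∀ᶠ z in 𝓝 (x₀, y₀, p₀), Q z) :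
    ∀ᶠ z : ℝ × ℝ in 𝓝 (x₀, y₀), Q (z.1, z.2, p₀) := by
  have : Continuous fun z : ℝ × ℝ => (z.1, z.2, p₀) := by fun_prop
  exact (this.tendsto (x₀, y₀)).eventually h

/-- If `J_ppp = 0`, then `J` is a quadratic polynomial in `p` with analytic coefficients. -/
theorem exists_quadratic (hJ : IsAnalyticODE J x₀ y₀ p₀)
    (h : ∀ᶠ z : ℝ × ℝ × ℝ in 𝓝 (x₀, y₀, p₀), jetDp (jetDp (jetDp J)) z.1 z.2.1 z.2.2 = 0) :
    ∃ a b c : ℝ → ℝ → ℝ, AnalyticAt ℝ (unc₂ a) (x₀, y₀) ∧ AnalyticAt ℝ (unc₂ b) (x₀, y₀) ∧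
      AnalyticAt ℝ (unc₂ c) (x₀, y₀) ∧ ∀ᶠ z : ℝ × ℝ × ℝ in 𝓝 (x₀, y₀, p₀),
        J z.1 z.2.1 z.2.2 = a z.1 z.2.1 * (z.2.2 * z.2.2) + b z.1 z.2.1 * z.2.2 + c z.1 z.2.1 := by
  have h0 : AnalyticAt ℝ (unc₃ J) (x₀, y₀, p₀) := hJ
  have h1 := analyticAt_jetDp h0
  have h2 := analyticAt_jetDp h1
  set α : ℝ → ℝ → ℝ := fun x y => jetDp (jetDp J) x y p₀ / 2 with hα
  set β : ℝ → ℝ → ℝ := fun x y => jetDp J x y p₀ with hβ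
  set γ : ℝ → ℝ → ℝ := fun x y => J x y p₀ with hγ
  have aα : AnalyticAt ℝ (unc₂ α) (x₀, y₀) := (analyticAt_slice h2).div_const
  have aβ : AnalyticAt ℝ (unc₂ β) (x₀, y₀) := analyticAt_slice h1
  have aγ : AnalyticAt ℝ (unc₂ γ) (x₀, y₀) := analyticAt_slice h0
  have ap : AnalyticAt ℝ (fun z : ℝ × ℝ × ℝ => z.2.2 - p₀) (x₀, y₀, p₀) :=
    analyticAt_jet_p.sub analyticAt_const
  have lα := analyticAt_lift₂ (p := p₀) aα
  have lβ := analyticAt_lift₂ (p := p₀) aβ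
  have q2 := eventually_eq_of_jetDp_eq_zero h2 h
  have q1 : ∀ᶠ z : ℝ × ℝ × ℝ in 𝓝 (x₀, y₀, p₀),
      jetDp J z.1 z.2.1 z.2.2 - 2 * α z.1 z.2.1 * (z.2.2 - p₀) = β z.1 z.2.1 := by
    have := eventually_eq_of_jetDp_eq_zero
      (F := fun x y p => jetDp J x y p - 2 * α x y * (p - p₀)) (x₀ := x₀) (y₀ := y₀) (p₀ := p₀)
      (h1.sub ((analyticAt_const.mul lα).mul ap)) (by
        filter_upwards [h1.eventually_analyticAt, q2] with ⟨x, y, p⟩ a1 a2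
        have d := (hasDerivAt_jetDp a1).sub
          (((hasDerivAt_id p).sub_const p₀).const_mul (2 * α x y))
        refine d.deriv.trans ?_
        dsimp only at a2
        rw [a2, hα]
        ring)
    filter_upwards [this] with z hz
    rw [hz]
    simp [hβ]
  have q0 : ∀ᶠ z : ℝ × ℝ × ℝ in 𝓝 (x₀, y₀, p₀),
      J z.1 z.2.1 z.2.2 - (α z.1 z.2.1 * ((z.2.2 - p₀) * (z.2.2 - p₀))
        + β z.1 z.2.1 * (z.2.2 - p₀)) = γ z.1 z.2.1 := by
    have := eventually_eq_of_jetDp_eq_zero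
      (F := fun x y p => J x y p - (α x y * ((p - p₀) * (p - p₀)) + β x y * (p - p₀)))
      (x₀ := x₀) (y₀ := y₀) (p₀ := p₀)
      (h0.sub ((lα.mul (ap.mul ap)).add (lβ.mul ap))) (by
        filter_upwards [h0.eventually_analyticAt, q1] with ⟨x, y, p⟩ a1 a2
        have e := (hasDerivAt_id p).sub_const p₀
        have d := (hasDerivAt_jetDp a1).sub
          (((e.mul e).const_mul (α x y)).add (e.const_mul (β x y)))
        refine d.deriv.trans ?_
        dsimp only [id] at a2 ⊢
        linear_combination a2)
    filter_upwards [this] with z hz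
    rw [hz]
    simp [hγ]
  have c2 : AnalyticAt ℝ (fun _ : ℝ × ℝ => 2 * p₀) (x₀, y₀) := analyticAt_const
  have c1 : AnalyticAt ℝ (fun _ : ℝ × ℝ => p₀) (x₀, y₀) := analyticAt_const
  -- The expansion about p₀ is rewritten in powers of p.
  refine ⟨α, fun x y => β x y - α x y * (2 * p₀), fun x y => γ x y - β x y * p₀ + α x y * p₀ * p₀,
    aα, aβ.sub (aα.mul c2), (aγ.sub (aβ.mul c1)).add ((aα.mul c1).mul c1), ?_⟩
  filter_upwards [q0] with z hz
  linear_combination hz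

/-- A quadratic equation with vanishing invariants satisfies two relations between its
coefficients. -/
theorem relations_of_invariantsVanish {a b c : ℝ → ℝ → ℝ} (hJ : IsAnalyticODE J x₀ y₀ p₀)
    (ha : AnalyticAt ℝ (unc₂ a) (x₀, y₀)) (hb : AnalyticAt ℝ (unc₂ b) (x₀, y₀))
    (hc : AnalyticAt ℝ (unc₂ c) (x₀, y₀))
    (hq : ∀ᶠ z : ℝ × ℝ × ℝ in 𝓝 (x₀, y₀, p₀),
      J z.1 z.2.1 z.2.2 = a z.1 z.2.1 * (z.2.2 * z.2.2) + b z.1 z.2.1 * z.2.2 + c z.1 z.2.1)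
    (h : InvariantsVanish J x₀ y₀ p₀) :
    ∀ᶠ z : ℝ × ℝ in 𝓝 (x₀, y₀), 2 * dx a z.1 z.2 = dy b z.1 z.2 ∧
      dx (dy b) z.1 z.2 + 2 * (c z.1 z.2 * dy a z.1 z.2 + a z.1 z.2 * dy c z.1 z.2)
        - b z.1 z.2 * dy b z.1 z.2 - 2 * dy (dy c) z.1 z.2 = 0 := by
  have hJ' : AnalyticAt ℝ (unc₃ J) (x₀, y₀, p₀) := hJ
  have la := analyticAt_lift₂ (p := p₀) ha
  have lb := analyticAt_lift₂ (p := p₀) hb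
  have lc := analyticAt_lift₂ (p := p₀) hc
  have two : (2 : AnGerm (x₀, y₀, p₀)) = mk (fun _ => 2) analyticAt_const := rfl
  have key := relations_of_quadratic (X := D ex) (Y := D ey) (P := D ep)
    (D_comm _ _) (D_comm _ _)
    (p := mk (unc₃ fun _ _ p => p) (analyticAt_coordP (q := (x₀, y₀, p₀))))
    (a := mk _ la) (b := mk _ lb) (c := mk _ lc) (K := mk _ hJ')
    (by rw [← mk_jetDx]; exact mk_unc₃_eq_zero _ fun _ _ _ => by simp [jetDx])
    (by rw [← mk_jetDy]; exact mk_unc₃_eq_zero _ fun _ _ _ => by simp [jetDy])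
    (by
      rw [← mk_jetDp, mk_eq_one]
      exact Eventually.of_forall fun _ => by simp [unc₃, jetDp])
    (by rw [← mk_jetDp]; exact mk_unc₃_eq_zero _ fun _ _ _ => by simp [jetDp])
    (by rw [← mk_jetDp]; exact mk_unc₃_eq_zero _ fun _ _ _ => by simp [jetDp])
    (by rw [← mk_jetDp]; exact mk_unc₃_eq_zero _ fun _ _ _ => by simp [jetDp])
    (by
      simp only [mk_mul, mk_add]
      rw [mk_eq_mk]
      exact hq)
    (by
      simp only [← mk_jetDp, ← mk_jetDx, ← mk_jetDy, mk_add, mk_mul, mk_neg, sub_eq_add_neg]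
      rw [mk_eq_zero]
      filter_upwards [h] with z hz
      have := (hz 1 1 0 one_ne_zero one_ne_zero).2.1
      simp only [invI2, totalD] at this
      simp only [Pi.add_apply, Pi.mul_apply, Pi.neg_apply, unc₃]
      linarith)
    (by
      simp only [← mk_jetDp, ← mk_jetDx, ← mk_jetDy, two, mk_add, mk_mul, mk_neg, sub_eq_add_neg]
      rw [mk_eq_zero]
      filter_upwards [h] with z hz
      have := (hz 1 1 0 one_ne_zero one_ne_zero).2.2
      simp only [invI3, totalD] at this
      simp only [Pi.add_apply, Pi.mul_apply, Pi.neg_apply, unc₃]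
      linarith)
  simp only [← mk_jetDx, ← mk_jetDy, two, mk_add, mk_mul, mk_neg, sub_eq_add_neg] at key
  -- The relations are germs on jet space but do not involve p, so restriction to p = p₀ brings them
  -- to the plane.
  have k1 := eventually_slice (mk_eq_mk.1 key.1)
  have k2 := eventually_slice (mk_eq_zero.1 key.2)
  filter_upwards [k1, k2] with z h1 h2
  simp only [sub_eq_add_neg]
  exact ⟨h1, h2⟩

end Quadratic

/-! ### Integration of the linearizing system. -/

section Linearization

open AnGerm

variable {x₀ y₀ : ℝ}

theorem analyticAt_unc₂_base {f : ℝ → ℝ} (hf : AnalyticAt ℝ f x₀) :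
    AnalyticAt ℝ (unc₂ fun x _ => f x) (x₀, y₀) := analyticAt_base hf

theorem analyticAt_unc₂_exp {θ : ℝ → ℝ → ℝ} (hθ : AnalyticAt ℝ (unc₂ θ) (x₀, y₀)) :
    AnalyticAt ℝ (unc₂ fun x y => Real.exp (θ x y)) (x₀, y₀) := hθ.rexp'

theorem AnGerm.D_unc₂_base_snd {f : ℝ → ℝ} (hf : AnalyticAt ℝ f x₀) :
    D (0, 1) (mk _ (analyticAt_unc₂_base (y₀ := y₀) hf)) = 0 := by
  rw [← mk_dy, mk_eq_zero]
  exact Eventually.of_forall fun _ => by simp [unc₂, dy]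

theorem AnGerm.D_unc₂_base_fst {f : ℝ → ℝ} (hf : AnalyticAt ℝ f x₀) :
    D (1, 0) (mk _ (analyticAt_unc₂_base (y₀ := y₀) hf)) =
      mk _ (analyticAt_unc₂_base hf.deriv) := by
  rw [← mk_dx]
  rfl

theorem AnGerm.D_unc₂_exp {θ : ℝ → ℝ → ℝ} (hθ : AnalyticAt ℝ (unc₂ θ) (x₀, y₀)) (v : ℝ × ℝ) :
    D v (mk _ (analyticAt_unc₂_exp hθ)) = mk _ (analyticAt_unc₂_exp hθ) * D v (mk _ hθ) := by
  rw [D_mk, D_mk, mk_mul, mk_eq_mk]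
  filter_upwards [hθ.eventually_analyticAt] with z hz
  have := hz.differentiableAt.hasFDerivAt.exp.fderiv
  change fderiv ℝ (fun w => Real.exp (unc₂ θ w)) z v = _
  rw [this]
  rfl

/-- A germ that is constant along the fibres is determined by its values on a section. -/
theorem AnGerm.mk_eq_zero_of_section {f : ℝ → ℝ → ℝ} (hf : AnalyticAt ℝ (unc₂ f) (x₀, y₀))
    (h : D (0, 1) (mk _ hf) = 0) (h0 : ∀ᶠ x in 𝓝 x₀, f x y₀ = 0) : mk _ hf = 0 := by
  rw [← mk_dy, mk_eq_zero] at h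
  rw [mk_eq_zero]
  have c1 : ContinuousAt (fun z : ℝ × ℝ => z.1) (x₀, y₀) := continuousAt_fst
  filter_upwards [eventually_eq_of_dy_eq_zero hf h, c1.eventually h0] with z h1 h2
  exact h1.trans h2

/-- The Riccati equation h' = h²/2 + s is linearized by h = -2u'/u with u'' = -(s/2)u; then φ' =
1/u² has φ''/φ' = h, so φ has Schwarzian derivative s. -/
theorem exists_baseChange {s : ℝ → ℝ} (hs : AnalyticAt ℝ s x₀) :
    ∃ φ h : ℝ → ℝ, AnalyticAt ℝ φ x₀ ∧ AnalyticAt ℝ h x₀ ∧ φ x₀ = 0 ∧ deriv φ x₀ = 1 ∧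
      (∀ᶠ x in 𝓝 x₀, deriv (deriv φ) x = h x * deriv φ x) ∧
      ∀ᶠ x in 𝓝 x₀, 2 * deriv h x = h x ^ 2 + 2 * s x := by
  obtain ⟨u, hu, hu0, hu2⟩ := exists_linearODE (q := fun x => -(s x / 2)) hs.div_const.neg
  have hne : u x₀ ≠ 0 := by simp [hu0]
  obtain ⟨φ, hφ, hφ0, hφ1⟩ := exists_primitive ((hu.pow 2).inv (by simp [hu0])) 0
  have aux : ∀ᶠ x in 𝓝 x₀, u x ≠ 0 ∧ HasDerivAt u (deriv u x) x ∧
      HasDerivAt (deriv u) (deriv (deriv u) x) x := by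
    filter_upwards [hu.continuousAt.eventually_ne hne, hu.eventually_analyticAt] with x h1 h2
    exact ⟨h1, hasDerivAt_deriv h2, hasDerivAt_deriv h2.deriv⟩
  refine ⟨φ, fun x => -2 * deriv u x / u x, hφ, (analyticAt_const.mul hu.deriv).div hu hne, hφ0,
    by simpa [hu0] using hφ1.self_of_nhds, ?_, ?_⟩
  · filter_upwards [aux, hφ1.eventually_nhds] with x ⟨h1, h2, h3⟩ h4
    have h5 : deriv φ =ᶠ[𝓝 x] (u ^ 2)⁻¹ := h4
    have d := ((h2.pow 2).inv (pow_ne_zero 2 h1)).deriv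
    rw [h5.deriv_eq, d, h4.self_of_nhds]
    simp only [Pi.inv_apply, Pi.pow_apply]
    field_simp
    norm_num
    ring
  · filter_upwards [aux, hu2] with x ⟨h1, h2, h3⟩ h4
    have d := ((h3.const_mul (-2)).div h2 h1).deriv
    refine (congrArg (2 * ·) d).trans ?_
    rw [h4]
    field_simp
    ring

/-- The differential algebra behind the integration of the system for `ψ`. -/
theorem linearization_identity {R : Type*} [CommRing R] {X Y : Derivation ℤ R R}
    (yx : ∀ f, Y (X f) = X (Y f)) {a b c h s w θ ψ : R} (hY : Y h = 0)
    (hX : 2 * X h = h * h + 2 * s) (hs : 2 * X b - b * b - 4 * Y c + 4 * (a * c) = 2 * s)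
    (wx : X w = w * X θ)
    (wy : Y w = w * Y θ) (θx : 2 * X θ = h - b) (θy : Y θ = -a) (ψy : Y ψ = w) :
    4 * Y (X (X ψ) - h * X ψ + c * w) = 0 := by
  have e := congrArg X θx
  simp only [map_sub, Derivation.leibniz, smul_eq_mul, derivation_two] at e
  simp only [map_add, map_sub, Derivation.leibniz, smul_eq_mul, yx, ψy, hY, wx, wy, θy]
  linear_combination 2 * w * e + w * hX - w * hs + (w * (2 * X θ + h - b) - 2 * h * w) * θx

/-- The coefficients of a quadratic equation that satisfy the two relations are those of an
equation obtained from `Y'' = 0` by a fibre-preserving transformation. -/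
theorem exists_linearizing {a b c : ℝ → ℝ → ℝ} (ha : AnalyticAt ℝ (unc₂ a) (x₀, y₀))
    (hb : AnalyticAt ℝ (unc₂ b) (x₀, y₀)) (hc : AnalyticAt ℝ (unc₂ c) (x₀, y₀))
    (hrel : ∀ᶠ z : ℝ × ℝ in 𝓝 (x₀, y₀), 2 * dx a z.1 z.2 = dy b z.1 z.2 ∧
      dx (dy b) z.1 z.2 + 2 * (c z.1 z.2 * dy a z.1 z.2 + a z.1 z.2 * dy c z.1 z.2)
        - b z.1 z.2 * dy b z.1 z.2 - 2 * dy (dy c) z.1 z.2 = 0) (p₀ : ℝ) :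
    ∃ (φ h : ℝ → ℝ) (ψ : ℝ → ℝ → ℝ), AnalyticAt ℝ φ x₀ ∧ AnalyticAt ℝ (unc₂ ψ) (x₀, y₀) ∧
      φ x₀ = 0 ∧ deriv φ x₀ = 1 ∧ ψ x₀ y₀ = 0 ∧ dy ψ x₀ y₀ ≠ 0 ∧
      dx ψ x₀ y₀ + dy ψ x₀ y₀ * p₀ = 0 ∧ (∀ᶠ x in 𝓝 x₀, deriv (deriv φ) x = h x * deriv φ x) ∧
      ∀ᶠ z : ℝ × ℝ in 𝓝 (x₀, y₀), dy (dy ψ) z.1 z.2 = -a z.1 z.2 * dy ψ z.1 z.2 ∧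
        2 * dx (dy ψ) z.1 z.2 = (h z.1 - b z.1 z.2) * dy ψ z.1 z.2 ∧
        dx (dx ψ) z.1 z.2 = h z.1 * dx ψ z.1 z.2 - c z.1 z.2 * dy ψ z.1 z.2 := by
  have two : (2 : AnGerm (x₀, y₀)) = mk (fun _ => 2) analyticAt_const := rfl
  have four : (4 : AnGerm (x₀, y₀)) = mk (fun _ => 4) analyticAt_const := rfl
  have yx := fun f : AnGerm (x₀, y₀) => D_comm (0, 1) (1, 0) f
  have hl : 2 * D (1, 0) (mk _ ha) = D (0, 1) (mk _ hb) := by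
    rw [← mk_dx, ← mk_dy, two, mk_mul, mk_eq_mk]
    exact hrel.mono fun z hz => hz.1
  have hw : D (1, 0) (D (0, 1) (mk _ hb)) + 2 * (mk _ hc * D (0, 1) (mk _ ha)
      + mk _ ha * D (0, 1) (mk _ hc)) - mk _ hb * D (0, 1) (mk _ hb)
      - 2 * D (0, 1) (D (0, 1) (mk _ hc)) = 0 := by
    simp only [← mk_dx, ← mk_dy, two, mk_mul, mk_add, mk_neg, sub_eq_add_neg]
    rw [mk_eq_zero]
    filter_upwards [hrel] with z hz
    have := hz.2
    simp only [sub_eq_add_neg] at this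
    exact this
  -- the function `2 s` of the Schwarzian equation for `φ`
  set T : ℝ → ℝ → ℝ := fun x y => 2 * dx b x y + -(b x y * b x y) + -(4 * dy c x y)
    + 4 * (a x y * c x y) with hT
  have aT : AnalyticAt ℝ (unc₂ T) (x₀, y₀) :=
    (((analyticAt_const.mul (analyticAt_dx hb)).add (hb.mul hb).neg).add
      (analyticAt_const.mul (analyticAt_dy hc)).neg).add (analyticAt_const.mul (ha.mul hc))
  have eT : mk _ aT = 2 * D (1, 0) (mk _ hb) - mk _ hb * mk _ hb - 4 * D (0, 1) (mk _ hc)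
      + 4 * (mk _ ha * mk _ hc) := by
    simp only [← mk_dx, ← mk_dy, two, four, mk_mul, mk_add, mk_neg, sub_eq_add_neg]
    rfl
  have yT : D (0, 1) (mk _ aT) = 0 := by
    have d4 : D (0, 1) (4 : AnGerm (x₀, y₀)) = 0 := by
      simpa using (D ((0 : ℝ), (1 : ℝ)) (z := (x₀, y₀))).map_natCast 4
    rw [eT]
    simp only [map_add, map_sub, Derivation.leibniz, smul_eq_mul, yx, derivation_two, d4]
    linear_combination 2 * hw
  have hTs : ∀ᶠ z : ℝ × ℝ in 𝓝 (x₀, y₀), T z.1 z.2 = T z.1 y₀ := by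
    rw [← mk_dy, mk_eq_zero] at yT
    exact eventually_eq_of_dy_eq_zero aT yT
  have hι : AnalyticAt ℝ (fun x : ℝ => (x, y₀)) x₀ := analyticAt_id.prod analyticAt_const
  have section_an : ∀ {f : ℝ → ℝ → ℝ}, AnalyticAt ℝ (unc₂ f) (x₀, y₀) →
      AnalyticAt ℝ (fun x => f x y₀) x₀ := fun hf =>
    AnalyticAt.fun_comp (f := fun x : ℝ => (x, y₀)) hf hι
  obtain ⟨φ, h, hφ, hh, hφ0, hφ1, hφh, hhs⟩ :=
    exists_baseChange (s := fun x => T x y₀ / 2) (section_an aT).div_const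
  have lh := analyticAt_unc₂_base (y₀ := y₀) hh
  have ls := analyticAt_unc₂_base (y₀ := y₀)
    (f := fun x => T x y₀ / 2) (section_an aT).div_const
  -- the logarithm of `ψ_y`
  obtain ⟨Θ, hΘ, hΘ0, hΘy⟩ := exists_primitive_snd (f := fun x y => -a x y) ha.neg
  obtain ⟨g, hg, -, hg'⟩ := exists_primitive
    (g := fun x => (h x - b x y₀) / 2) (hh.sub (section_an hb)).div_const 0
  set θ : ℝ → ℝ → ℝ := fun x y => Θ x y + g x with hθdef
  have hθ : AnalyticAt ℝ (unc₂ θ) (x₀, y₀) := hΘ.add (analyticAt_unc₂_base hg)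
  have θy : D (0, 1) (mk _ hθ) = -mk _ ha := by
    rw [← mk_dy, mk_neg, mk_eq_mk]
    filter_upwards [hΘy] with z hz
    rw [unc₂, dy, hθdef]
    simp only [deriv_add_const]
    exact hz
  have θx : 2 * D (1, 0) (mk _ hθ) = mk _ lh - mk _ hb := by
    have aF : AnalyticAt ℝ (unc₂ fun x y => 2 * dx θ x y + -(h x + -b x y)) (x₀, y₀) :=
      (analyticAt_const.mul (analyticAt_dx hθ)).add (lh.add hb.neg).neg
    have eF : mk _ aF = 2 * D (1, 0) (mk _ hθ) - (mk _ lh - mk _ hb) := by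
      simp only [← mk_dx, two, mk_mul, mk_add, mk_neg, sub_eq_add_neg]
      rfl
    rw [← sub_eq_zero, ← eF]
    refine mk_eq_zero_of_section aF ?_ ?_
    · rw [eF]
      simp only [map_sub, Derivation.leibniz, smul_eq_mul, derivation_two, yx, θy, map_neg,
        D_unc₂_base_snd hh]
      linear_combination -hl
    · filter_upwards [hg'] with x hx
      have : dx θ x y₀ = (h x - b x y₀) / 2 := by
        rw [dx, hθdef, ← hx]
        simp only [hΘ0, zero_add]
      rw [this]
      ring
  set w : ℝ → ℝ → ℝ := fun x y => Real.exp (θ x y) with hwdef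
  have aw : AnalyticAt ℝ (unc₂ w) (x₀, y₀) := analyticAt_unc₂_exp hθ
  have wD : ∀ v, D v (mk _ aw) = mk _ aw * D v (mk _ hθ) := D_unc₂_exp hθ
  -- the function `ψ`
  obtain ⟨W, hW, hW0, hWy⟩ := exists_primitive_snd aw
  -- Variation of constants: k' = φ'ℓ with ℓ' = -cw/φ' gives k'' = hk' - cw, the third equation on y
  -- = y₀. The initial value -w p₀ makes the prolongation send p₀ to 0.
  obtain ⟨ℓ, hℓ, hℓ0, hℓ'⟩ := exists_primitive (g := fun x => -(c x y₀ * w x y₀) / deriv φ x)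
    (((section_an hc).mul (section_an aw)).neg.div hφ.deriv (by simp [hφ1])) (-(w x₀ y₀ * p₀))
  obtain ⟨k, hk, hk0, hk'⟩ := exists_primitive (hφ.deriv.mul hℓ) 0
  set ψ : ℝ → ℝ → ℝ := fun x y => W x y + k x with hψdef
  have hψ : AnalyticAt ℝ (unc₂ ψ) (x₀, y₀) := hW.add (analyticAt_unc₂_base hk)
  have ψ0 : ∀ x, ψ x y₀ = k x := fun x => by simp [hψdef, hW0]
  have ψx0 : ∀ x, dx ψ x y₀ = deriv k x := fun x => by simp only [dx, ψ0]
  have ψxx0 : ∀ x, dx (dx ψ) x y₀ = deriv (deriv k) x := fun x => by rw [dx]; simp only [ψx0]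
  have ψy' : ∀ᶠ z : ℝ × ℝ in 𝓝 (x₀, y₀), dy ψ z.1 z.2 = w z.1 z.2 := by
    filter_upwards [hWy] with z hz
    rw [dy, hψdef]
    simp only [deriv_add_const]
    exact hz
  have ψy : D (0, 1) (mk _ hψ) = mk _ aw := by
    rw [← mk_dy, mk_eq_mk]
    exact ψy'
  -- The residual of the third equation is constant in y by `linearization_identity`, where the
  -- Riccati equation for h enters, and is zero on y = y₀ by the choice of k.
  have ψxx : D (1, 0) (D (1, 0) (mk _ hψ)) - mk _ lh * D (1, 0) (mk _ hψ)
      + mk _ hc * mk _ aw = 0 := by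
    have aR : AnalyticAt ℝ (unc₂ fun x y => dx (dx ψ) x y + -(h x * dx ψ x y) + c x y * w x y)
        (x₀, y₀) :=
      ((analyticAt_dx (analyticAt_dx hψ)).add (lh.mul (analyticAt_dx hψ)).neg).add (hc.mul aw)
    have eR : mk _ aR = D (1, 0) (D (1, 0) (mk _ hψ)) - mk _ lh * D (1, 0) (mk _ hψ)
        + mk _ hc * mk _ aw := by
      simp only [← mk_dx, mk_mul, mk_add, mk_neg, sub_eq_add_neg]
      rfl
    rw [← eR]
    refine mk_eq_zero_of_section aR ?_ ?_
    · rw [eR]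
      have u4 : IsUnit (4 : AnGerm (x₀, y₀)) := isUnit_of_ev_ne_zero (by rw [map_ofNat]; norm_num)
      refine u4.mul_right_eq_zero.1 (linearization_identity yx (s := mk _ ls)
        (D_unc₂_base_snd hh) ?_ ?_ (wD _) (wD _) θx θy ψy)
      · rw [D_unc₂_base_fst hh, two]
        simp only [mk_mul, mk_add]
        rw [mk_eq_mk]
        have c1 : ContinuousAt (fun z : ℝ × ℝ => z.1) (x₀, y₀) := continuousAt_fst
        filter_upwards [c1.eventually hhs] with z hz
        simp only [Pi.add_apply, Pi.mul_apply, unc₂]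
        rw [hz]
        ring
      · rw [← eT, two, mk_mul, mk_eq_mk]
        filter_upwards [hTs] with z hz
        simp only [Pi.mul_apply, unc₂]
        rw [hz]
        ring
    · filter_upwards [hk'.eventually_nhds, hℓ', hφh, hφ.eventually_analyticAt,
        hℓ.eventually_analyticAt, hφ.deriv.continuousAt.eventually_ne (hφ1.trans_ne one_ne_zero)]
        with x h1 h2 h3 h4 h5 h6
      have e1 : deriv k =ᶠ[𝓝 x] deriv φ * ℓ := h1
      have e2 : deriv (deriv k) x = deriv (deriv φ) x * ℓ x + deriv φ x * deriv ℓ x := by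
        rw [e1.deriv_eq]
        exact ((hasDerivAt_deriv h4.deriv).mul (hasDerivAt_deriv h5)).deriv
      rw [ψxx0, ψx0, e2, e1.self_of_nhds, h2, h3, Pi.mul_apply]
      field_simp
      ring
  have ψy0 : dy ψ x₀ y₀ = w x₀ y₀ := ψy'.self_of_nhds
  refine ⟨φ, h, ψ, hφ, hψ, hφ0, hφ1, by rw [ψ0, hk0], ?_, ?_, hφh, ?_⟩
  · rw [ψy0]
    exact Real.exp_ne_zero _
  · rw [ψy0, ψx0, hk'.self_of_nhds, Pi.mul_apply, hφ1, hℓ0]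
    ring
  · have e1 : D (0, 1) (D (0, 1) (mk _ hψ)) = -mk _ ha * D (0, 1) (mk _ hψ) := by
      rw [ψy, wD, θy, mul_comm]
    have e2 : 2 * D (1, 0) (D (0, 1) (mk _ hψ)) = (mk _ lh - mk _ hb) * D (0, 1) (mk _ hψ) := by
      rw [ψy, wD]
      linear_combination mk _ aw * θx
    have e3 : D (1, 0) (D (1, 0) (mk _ hψ)) = mk _ lh * D (1, 0) (mk _ hψ)
        - mk _ hc * D (0, 1) (mk _ hψ) := by
      rw [ψy]
      linear_combination ψxx
    simp only [← mk_dx, ← mk_dy, two, mk_mul, mk_add, mk_neg, sub_eq_add_neg] at e1 e2 e3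
    rw [mk_eq_mk] at e1 e2 e3
    filter_upwards [e1, e2, e3] with z h1 h2 h3
    simp only [sub_eq_add_neg]
    exact ⟨h1, h2, h3⟩

theorem FibreEquivalent.of_invariantsVanish {J : ℝ → ℝ → ℝ → ℝ} {p₀ : ℝ}
    (hJ : IsAnalyticODE J x₀ y₀ p₀) (h : InvariantsVanish J x₀ y₀ p₀) :
    FibreEquivalent J x₀ y₀ p₀ (fun _ _ _ => 0) 0 0 0 := by
  obtain ⟨a, b, c, ha, hb, hc, hq⟩ := exists_quadratic hJ h.jetDp_eq_zero
  obtain ⟨φ, k, ψ, hφ, hψ, hφ0, hφ1, hψ0, hψy, hp, hk, he⟩ := exists_linearizing ha hb hc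
    (relations_of_invariantsVanish hJ ha hb hc hq h) p₀
  refine ⟨φ, ψ, hφ, hψ, by simp [hφ1], hψy, hφ0, hψ0, by rw [prolongP, hp, zero_div], ?_⟩
  have c1 : ContinuousAt (fun z : ℝ × ℝ × ℝ => z.1) (x₀, y₀, p₀) := continuousAt_fst
  filter_upwards [hq, eventually_jet he p₀, c1.eventually hk] with ⟨x, y, p⟩ h1 ⟨h2, h3, h4⟩ h5
  dsimp only at h1 h2 h3 h4 h5
  rw [MapsODEAt, prolongQ, h1, h2, h4, h5]
  refine div_eq_zero_iff.2 (Or.inl ?_)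
  -- In the numerator of the second prolongation the coefficient of p² and the term free of p have
  -- cancelled; the rest is p times the equation for ψ_xy.
  linear_combination deriv φ x * p * h3

end Linearization

/-! ### Normal forms with the two relations are trivial. -/

section NormalForm

open AnGerm

variable {K : ℝ → ℝ → ℝ → ℝ} {M N : ℝ → ℝ → ℝ}

theorem eventually_tangent {x y p : ℝ} {Q : ℝ × ℝ × ℝ → Prop} (h : ∀ᶠ z in 𝓝 (x, y, p), Q z) :
    ∀ᶠ t in 𝓝 p, Q (x, y, t) := by
  have : Continuous fun t : ℝ => (x, y, t) := by fun_prop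
  exact (this.tendsto p).eventually h

theorem HasQuadraticShape.jetDp_eq (h : HasQuadraticShape K M N) :
    ∀ᶠ z : ℝ × ℝ × ℝ in 𝓝 (0, 0, 0),
      jetDp K z.1 z.2.1 z.2.2 = 2 * M z.1 z.2.1 * z.2.2 + N z.1 z.2.1 := by
  filter_upwards [h.eq.eventually_nhds] with ⟨x, y, p⟩ hz
  have e : K x y =ᶠ[𝓝 p] fun t => M x y * t ^ 2 + N x y * t := eventually_tangent hz
  have d := (((hasDerivAt_id p).pow 2).const_mul (M x y)).add
    ((hasDerivAt_id p).const_mul (N x y))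
  refine e.deriv_eq.trans (d.deriv.trans ?_)
  simp
  ring

theorem HasQuadraticShape.jetDp_jetDp_eq (h : HasQuadraticShape K M N) :
    ∀ᶠ z : ℝ × ℝ × ℝ in 𝓝 (0, 0, 0), jetDp (jetDp K) z.1 z.2.1 z.2.2 = 2 * M z.1 z.2.1 := by
  filter_upwards [h.jetDp_eq.eventually_nhds] with ⟨x, y, p⟩ hz
  have e : jetDp K x y =ᶠ[𝓝 p] fun t => 2 * M x y * t + N x y := eventually_tangent hz
  have d := ((hasDerivAt_id p).const_mul (2 * M x y)).add_const (N x y)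
  refine e.deriv_eq.trans (d.deriv.trans ?_)
  simp

/-- A solution of a linear homogeneous equation in `x` that vanishes for `x = 0` is zero. -/
theorem eventually_eq_zero_of_linear {f q : ℝ → ℝ → ℝ} (hf : AnalyticAt ℝ (unc₂ f) (0, 0))
    (hq : AnalyticAt ℝ (unc₂ q) (0, 0))
    (h : ∀ᶠ z : ℝ × ℝ in 𝓝 (0, 0), dx f z.1 z.2 = f z.1 z.2 * q z.1 z.2)
    (h0 : ∀ᶠ y in 𝓝 (0 : ℝ), f 0 y = 0) : ∀ᶠ z : ℝ × ℝ in 𝓝 (0, 0), f z.1 z.2 = 0 := by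
  have c2 : ContinuousAt (fun z : ℝ × ℝ => z.2) ((0 : ℝ), (0 : ℝ)) := continuousAt_snd
  obtain ⟨r, hr, H⟩ := Metric.eventually_nhds_iff_ball.1
    (hf.eventually_analyticAt.and (hq.eventually_analyticAt.and (h.and (c2.eventually h0))))
  filter_upwards [Metric.ball_mem_nhds _ hr] with ⟨x, y⟩ hz
  rw [← ball_prod_same] at hz H
  have line : ∀ {g : ℝ → ℝ → ℝ} {t : ℝ}, AnalyticAt ℝ (unc₂ g) (t, y) →
      AnalyticAt ℝ (fun s => g s y) t := fun {g t} hg =>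
    AnalyticAt.fun_comp (f := fun s : ℝ => (s, y)) hg (analyticAt_id.prod analyticAt_const)
  have hfy : AnalyticOnNhd ℝ (fun s => f s y) (Metric.ball 0 r) := fun t ht =>
    line (H (t, y) ⟨ht, hz.2⟩).1
  have h00 := H (0, y) ⟨Metric.mem_ball_self hr, hz.2⟩
  have hg : mk (fun s => f s y) (line h00.1) = 0 := by
    -- For fixed y, f_x = f q says that the ideal generated by the germ of f is stable under
    -- differentiation.
    refine eq_zero_of_mem_span {mk (fun s => f s y) (line h00.1)} ?_ ?_
      (Ideal.subset_span rfl)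
    · rintro _ rfl
      exact h00.2.2.2
    · rintro v _ rfl
      have e : D v (mk (fun s => f s y) (line h00.1)) =
          mk (fun s => v * q s y) (analyticAt_const.mul (line h00.2.1)) *
            mk (fun s => f s y) (line h00.1) := by
        rw [D_mk, mk_mul, mk_eq_mk]
        filter_upwards [Metric.ball_mem_nhds (0 : ℝ) hr] with t ht
        obtain ⟨h1, -, h3, -⟩ := H (t, y) ⟨ht, hz.2⟩
        have d := (hasDerivAt_dx h1).hasFDerivAt.fderiv
        rw [dirDeriv, d, h3]
        simp
        ring
      rw [e]
      exact Ideal.mul_mem_left _ _ (Ideal.subset_span rfl)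
  exact hfy.eqOn_zero_of_preconnected_of_eventuallyEq_zero (convex_ball _ _).isPreconnected
    (Metric.mem_ball_self hr) (mk_eq_zero.1 hg) hz.1

/-- The normalizations say N(0, y) = 0, N(x, 0) = 0 and M(0, y) = 0. The first kills N_y through the
linear equation (N_y)_x = N_y N, the second then kills N, and the third kills M since 2M_x = N_y =
0. -/
theorem eventually_eq_zero_of_isNormalForm (hK : IsNormalForm K) (hs : HasQuadraticShape K M N)
    (hr : SatisfyRelations M N) :
    ∀ᶠ z : ℝ × ℝ in 𝓝 (0, 0), M z.1 z.2 = 0 ∧ N z.1 z.2 = 0 := by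
  have aM : AnalyticAt ℝ (unc₂ M) (0, 0) := hs.analytic_M
  have aN : AnalyticAt ℝ (unc₂ N) (0, 0) := hs.analytic_N
  have ty : Tendsto (fun y : ℝ => ((0 : ℝ), y, (0 : ℝ))) (𝓝 0) (𝓝 (0, 0, 0)) :=
    (by fun_prop : Continuous fun y : ℝ => ((0 : ℝ), y, (0 : ℝ))).tendsto 0
  have tx : Tendsto (fun x : ℝ => (x, (0 : ℝ), (0 : ℝ))) (𝓝 0) (𝓝 (0, 0, 0)) :=
    (by fun_prop : Continuous fun x : ℝ => (x, (0 : ℝ), (0 : ℝ))).tendsto 0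
  have N0y : ∀ᶠ y in 𝓝 (0 : ℝ), N 0 y = 0 := by
    filter_upwards [ty.eventually hs.jetDp_eq, hK.d2] with y h1 h2
    simpa [h2] using h1.symm
  have Nx0 : ∀ᶠ x in 𝓝 (0 : ℝ), N x 0 = 0 := by
    filter_upwards [tx.eventually hs.jetDp_eq, hK.d3] with x h1 h2
    simpa [h2] using h1.symm
  have M0y : ∀ᶠ y in 𝓝 (0 : ℝ), M 0 y = 0 := by
    filter_upwards [ty.eventually hs.jetDp_jetDp_eq, hK.d4] with y h1 h2
    simpa [h2] using h1.symm
  have c1 : ContinuousAt (fun z : ℝ × ℝ => z.1) ((0 : ℝ), (0 : ℝ)) := continuousAt_fst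
  have c2 : ContinuousAt (fun z : ℝ × ℝ => z.2) ((0 : ℝ), (0 : ℝ)) := continuousAt_snd
  have Ny : ∀ᶠ z : ℝ × ℝ in 𝓝 (0, 0), dy N z.1 z.2 = 0 := by
    refine eventually_eq_zero_of_linear (analyticAt_dy aN) aN ?_ ?_
    · filter_upwards [hr, aN.eventually_analyticAt] with z h1 h2
      rw [← dx_dy_comm h2]
      exact h1.2
    · filter_upwards [N0y.eventually_nhds] with y hy
      have : N 0 =ᶠ[𝓝 y] fun _ => 0 := hy
      simpa [dy] using this.deriv_eq
  have N0 : ∀ᶠ z : ℝ × ℝ in 𝓝 (0, 0), N z.1 z.2 = 0 := by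
    filter_upwards [eventually_eq_of_dy_eq_zero aN Ny, c1.eventually Nx0] with z h1 h2
    exact h1.trans h2
  have Mx : ∀ᶠ z : ℝ × ℝ in 𝓝 (0, 0), dx M z.1 z.2 = 0 := by
    filter_upwards [hr, Ny] with z h1 h2
    linarith [h1.1]
  filter_upwards [eventually_eq_of_dx_eq_zero aM Mx, c2.eventually M0y, N0] with z h1 h2 h3
  exact ⟨h1.trans h2, h3⟩

theorem HasQuadraticShape.eventually_eq_zero (hs : HasQuadraticShape K M N)
    (h : ∀ᶠ z : ℝ × ℝ in 𝓝 (0, 0), M z.1 z.2 = 0 ∧ N z.1 z.2 = 0) :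
    ∀ᶠ z : ℝ × ℝ × ℝ in 𝓝 (0, 0, 0), K z.1 z.2.1 z.2.2 = 0 := by
  filter_upwards [hs.eq, eventually_jet h 0] with z h1 h2
  rw [h1, h2.1, h2.2]
  ring

theorem iteratedDeriv_eq_zero {f : ℝ → ℝ} {x : ℝ} (h : ∀ᶠ t in 𝓝 x, f t = 0) (n : ℕ) :
    iteratedDeriv n f x = 0 := by
  have : f =ᶠ[𝓝 x] fun _ => 0 := h
  rw [this.iteratedDeriv_eq]
  simp

theorem jetCoeff_eq_zero (h : ∀ᶠ z : ℝ × ℝ × ℝ in 𝓝 (0, 0, 0), K z.1 z.2.1 z.2.2 = 0)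
    (i j k : ℕ) : jetCoeff K i j k = 0 := by
  rw [nhds_prod_eq] at h
  refine iteratedDeriv_eq_zero (h.curry.mono fun x hx => iteratedDeriv_eq_zero ?_ j) i
  rw [nhds_prod_eq] at hx
  exact hx.curry.mono fun y hy => iteratedDeriv_eq_zero hy k

theorem hasNormalExpansion_of_eventually_eq_zero
    (hK : ∀ᶠ z : ℝ × ℝ × ℝ in 𝓝 (0, 0, 0), K z.1 z.2.1 z.2.2 = 0)
    (h : ∀ᶠ z : ℝ × ℝ in 𝓝 (0, 0), M z.1 z.2 = 0 ∧ N z.1 z.2 = 0) : HasNormalExpansion K M N := by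
  filter_upwards [h] with z hz
  simp only [jetCoeff_eq_zero hK, zero_mul, zero_div, hz.1, hz.2]
  exact ⟨hasSum_zero, hasSum_zero⟩

theorem isNormalForm_zero : IsNormalForm fun _ _ _ => 0 where
  analytic := analyticAt_const
  d1 := Eventually.of_forall fun _ => rfl
  d2 := by simp [jetDp]
  d3 := by simp [jetDp]
  d4 := by simp [jetDp]

theorem hasQuadraticShape_zero :
    HasQuadraticShape (fun _ _ _ => 0) (fun _ _ => 0) fun _ _ => 0 where
  analytic_M := analyticAt_const
  analytic_N := analyticAt_const
  eq := Eventually.of_forall fun _ => by simp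

theorem satisfyRelations_zero : SatisfyRelations (fun _ _ => 0) fun _ _ => 0 :=
  Eventually.of_forall fun _ => by simp [dx, dy]

/-- A normal form with vanishing invariants is quadratic in `p` without constant term. -/
theorem IsNormalForm.exists_quadraticShape (hK : IsNormalForm K)
    (h : InvariantsVanish K 0 0 0) :
    ∃ M N : ℝ → ℝ → ℝ, HasQuadraticShape K M N ∧ SatisfyRelations M N := by
  obtain ⟨a, b, c, ha, hb, hc, hq⟩ := exists_quadratic hK.analytic h.jetDp_eq_zero
  have hrel := relations_of_invariantsVanish hK.analytic ha hb hc hq h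
  have c0 : ∀ᶠ z : ℝ × ℝ in 𝓝 (0, 0), c z.1 z.2 = 0 := by
    filter_upwards [eventually_slice hq, hK.d1] with z h1 h2
    rw [h2] at h1
    simpa using h1.symm
  refine ⟨a, b, ⟨ha, hb, ?_⟩, ?_⟩
  · filter_upwards [hq, eventually_jet c0 0] with z h1 h2
    rw [h1, h2]
    ring
  · filter_upwards [hrel, c0.eventually_nhds, hb.eventually_analyticAt] with z h1 h2 h3
    have e : unc₂ c =ᶠ[𝓝 z] unc₂ fun _ _ => 0 := h2
    have e1 : dy c z.1 z.2 = 0 := by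
      rw [dy_congr e]
      simp [dy]
    have e2 : dy (dy c) z.1 z.2 = 0 := by
      rw [dy_congr (unc₂_dy_congr e)]
      simp [dy]
    refine ⟨h1.1, ?_⟩
    rw [dx_dy_comm h3]
    have e0 : c z.1 z.2 = 0 := h2.self_of_nhds
    -- With c = 0 the second relation becomes b_xy = b_y b.
    linear_combination h1.2 - 2 * dy a z.1 z.2 * e0 - 2 * a z.1 z.2 * e1 + 2 * e2

end NormalForm

end

end SecondOrderODE


/-! ### Assembly of the equivalences. -/

theorem corollary6p44 (J : ℝ → ℝ → ℝ → ℝ) (x₀ y₀ p₀ : ℝ) (hJ : IsAnalyticODE J x₀ y₀ p₀) :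
    [ AdmitsSymmetryGroup 6 J x₀ y₀ p₀,
      InvariantsVanish J x₀ y₀ p₀,
      ∃ (K : ℝ → ℝ → ℝ → ℝ) (M N : ℝ → ℝ → ℝ),
        FibreEquivalent J x₀ y₀ p₀ K 0 0 0 ∧ IsNormalForm K ∧ HasQuadraticShape K M N ∧
          HasNormalExpansion K M N ∧ SatisfyRelations M N,
      FibreEquivalent J x₀ y₀ p₀ (fun _ _ _ => 0) 0 0 0 ].TFAE ∧
    (AdmitsSymmetryGroup 6 J x₀ y₀ p₀ →
      ∀ K : ℝ → ℝ → ℝ → ℝ, IsNormalForm K → FibreEquivalent J x₀ y₀ p₀ K 0 0 0 →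
        ∃ M N : ℝ → ℝ → ℝ, HasQuadraticShape K M N ∧ HasNormalExpansion K M N ∧
          SatisfyRelations M N) ∧
    (∀ (K : ℝ → ℝ → ℝ → ℝ) (M N : ℝ → ℝ → ℝ),
      IsNormalForm K → HasQuadraticShape K M N → SatisfyRelations M N →
        (∀ᶠ z : ℝ × ℝ in 𝓝 (0, 0), M z.1 z.2 = 0 ∧ N z.1 z.2 = 0) ∧
        FibreEquivalent K 0 0 0 (fun _ _ _ => 0) 0 0 0) := by
  refine ⟨?_, fun hG K hK hJK => ?_, fun K M N hK hs hr => ?_⟩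
  · tfae_have 1 → 2 := invariantsVanish_of_admitsSymmetryGroup hJ
    tfae_have 2 → 4 := FibreEquivalent.of_invariantsVanish hJ
    tfae_have 4 → 1 := fun h => AdmitsSymmetryGroup.of_fibreEquivalent h admitsSymmetryGroup_flat
    tfae_have 4 → 3 := fun h => ⟨_, _, _, h, isNormalForm_zero, hasQuadraticShape_zero,
      hasNormalExpansion_of_eventually_eq_zero (Eventually.of_forall fun _ => rfl)
        (Eventually.of_forall fun _ => ⟨rfl, rfl⟩), satisfyRelations_zero⟩
    tfae_have 3 → 4 := fun ⟨K, M, N, h, hK, hs, _, hr⟩ =>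
      h.congr_right (hs.eventually_eq_zero (eventually_eq_zero_of_isNormalForm hK hs hr))
    tfae_finish
  · obtain ⟨M, N, hs, hr⟩ := hK.exists_quadraticShape
      -- The group of J is carried to K by the inverse equivalence, so the invariants of K itself
      -- vanish.
      (invariantsVanish_of_admitsSymmetryGroup hK.analytic (.of_fibreEquivalent hJK.symm hG))
    have h0 := eventually_eq_zero_of_isNormalForm hK hs hr
    exact ⟨M, N, hs, hasNormalExpansion_of_eventually_eq_zero (hs.eventually_eq_zero h0) h0, hr⟩
  · have h0 := eventually_eq_zero_of_isNormalForm hK hs hr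
    exact ⟨h0, (FibreEquivalent.refl K 0 0 0).congr_right (hs.eventually_eq_zero h0)⟩
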